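/- Let $m,s\in\mathbb N$ and $1\le p,q\le\infty$ with $\hat\varrho:=s-m/p>0$ (where $m/\infty:=0$). Let $\nu$ be a finite Borel measure on $\mathbb R^m$ whose support is infinite and contained in the open cube $(0,1)^m$, and let $\Lambda$ denote Lebesgue measure. **Sobolev ball.** $W^{s,p}$ is the space of all $f\in L^p((0,1)^m)$ whose weak derivatives $D^kf$, $|k|\le s$, lie in $L^p((0,1)^m)$, with norm $\|f\|_{L^p}+\big\|\big(\sum_{|k|=s}|D^kf|^2\big)^{1/2}\big\|_{L^p}$. Its closed unit ball $\mathscr BW^{s,p}$ is regarded as a subset of $L^q_\nu$ through the representatives that are continuous on $[0,1]^m$. **Widths.** For a subset $A$ of a normed space $V$ and $n\in\mathbb N_0$, put $$d_n^K(A,V)=\inf_{W}\sup_{x\in A}\inf_{y\in W}\|x-y\|,\qquad d_n^G(A,V)=\inf_{U}\sup_{x\in A\cap U}\|x\|,\qquad d_n^L(A,V)=\inf_{B}\sup_{x\in A}\|x-Bx\|,$$ where $W$ runs over the linear subspaces of $V$ of dimension at most $n$, $U$ over the common kernels of at most $n$ continuous linear functionals on $V$, and $B$ over the bounded linear operators $V\to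 V$ of rank at most $n$. Let $\ell_p^M$ be $\mathbb R^M$ with the $p$-norm, and $b_p^M$ its closed unit ball. **Partitions.** For $n\in\mathbb N_0$ let $\mathcal D_n$ be the set of cubes $Q=\prod_{i=1}^m(l_i2^{-n},(l_i+1)2^{-n}]$, $l\in\mathbb Z^m$, with $\nu(Q)>0$. If $q<\infty$, put $\mathfrak J(Q)=\nu(Q)\Lambda(Q)^{q\hat\varrho/m}$ and, for $t>0$, let $P_t$ be the set of all $Q\in\bigcup_{n\ge1}\mathcal D_n$ with $\mathfrak J(Q)<t$ such that the cube $Q'\in\mathcal D_{n-1}$ containing $Q$ (where $Q\in\mathcal D_n$) satisfies $\mathfrak J(Q')\ge t$. Let $(t_k)_{k\ge1}$ be a non-increasing sequence of positive reals with $t_k\to0$ and $(j_k)_{k\ge1}$ a strictly increasing sequence of positive integers such that $\sup_k(j_{k+1}-j_k)<\infty$ and, if $q<\infty$, $$\sup\big\{|\log_2\Lambda(Q)-\log_2\Lambda(\tilde Q)| : k\ge1,\ Q\in P_{t_{k+1}},\ \tilde Q\in P_{t_k},\ Q\subset\tilde Q\big\}<\infty .$$ Put $\boldsymbol P_k=P_{t_k}$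 and $T_k=t_k^{1/q}$ if $q<\infty$, and $\boldsymbol P_k=\mathcal D_{j_k}$ and $T_k=2^{-k\hat\varrho}$ if $q=\infty$. Let $M_k=\operatorname{card}\boldsymbol P_k$, and let $\kappa$ be the dimension of the space of real polynomials in $m$ variables of degree at most $s-1$. **Statement.** There is a constant $C$, depending on the data above but not on $n$ or $(n_k)$, such that for every $\star\in\{K,G,L\}$ and every sequence $(n_k)_{k\ge1}$ in $\mathbb N_0$ with $n:=\sum_kn_k<\infty$, $$0<d_n^\star\big(\mathscr BW^{s,p},L^q_\nu\big)\le C\sum_{k\ge1}T_k\,d_{n_k}^\star\big(b_p^{\kappa M_k},\ell_q^{\kappa M_k}\big),$$ where the right-hand side may be $+\infty$. -/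

import Mathlib

open MeasureTheory Filter Topology
open scoped ENNReal NNReal

noncomputable section

namespace SobolevWidths

/-! ## Widths of a set in a normed space

All widths take values in `[0, ∞]`. -/

section Widths

variable {V : Type*} [NormedAddCommGroup V] [NormedSpace ℝ V]

/-- The Kolmogorov `n`-width of `A` in `V`: the infimum, over all linear subspaces `W` of dimension
at most `n`, of `sup_{x ∈ A} inf_{y ∈ W} ‖x - y‖`. -/
def kolmogorovWidth (n : ℕ) (A : Set V) : ℝ≥0∞ :=
  ⨅ (W : Submodule ℝ V) (_ : Module.rank ℝ W ≤ (n : Cardinal)),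
    ⨆ x ∈ A, ⨅ y ∈ W, ‖x - y‖ₑ

/-- `U` is the common kernel of `n` continuous linear functionals. As the functionals need not be
linearly independent, this says that `U` is cut out by at most `n` linearly independent ones, i.e.
that its codimension does not exceed `n`. -/
def CodimLE (U : Submodule ℝ V) (n : ℕ) : Prop :=
  ∃ φ : Fin n → StrongDual ℝ V, ∀ v : V, v ∈ U ↔ ∀ i, φ i v = 0

/-- The Gel'fand `n`-width of `A` in `V`: the infimum of `sup_{x ∈ A ∩ U} ‖x‖` over all subspaces
`U` of codimension at most `n`. -/
def gelfandWidth (n : ℕ) (A : Set V) : ℝ≥0∞ :=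
  ⨅ (U : Submodule ℝ V) (_ : CodimLE U n), ⨆ x ∈ A ∩ (U : Set V), ‖x‖ₑ

/-- The linear `n`-width of `A` in `V`: the infimum of `sup_{x ∈ A} ‖x - B x‖` over all bounded
linear operators `B : V → V` of rank at most `n`. -/
def linearWidth (n : ℕ) (A : Set V) : ℝ≥0∞ :=
  ⨅ (B : V →L[ℝ] V) (_ : LinearMap.rank (B : V →ₗ[ℝ] V) ≤ (n : Cardinal)),
    ⨆ x ∈ A, ‖x - B x‖ₑ

/-- The three kinds of widths (Kolmogorov, Gel'fand, linear). -/
inductive WidthKind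
  | K
  | G
  | L

/-- The `n`-width of kind `K`, `G` or `L`. -/
def nWidth (star : WidthKind) (n : ℕ) (A : Set V) : ℝ≥0∞ :=
  match star with
  | .K => kolmogorovWidth n A
  | .G => gelfandWidth n A
  | .L => linearWidth n A

end Widths

/-- The closed unit ball of `ℓ_p^M`, as a subset of the normed space `ℓ_q^M`. -/
def lpBall (p q : ℝ≥0∞) [Fact (1 ≤ p)] (M : ℕ) : Set (PiLp q (fun _ : Fin M => ℝ)) :=
  {x | ‖(WithLp.toLp p (WithLp.ofLp x) : PiLp p (fun _ : Fin M => ℝ))‖ ≤ 1}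

/-! ## Sobolev spaces on the unit cube -/

section Sobolev

variable {m : ℕ}

/-- The open unit cube `(0,1)^m`. -/
def openCube (m : ℕ) : Set (Fin m → ℝ) := Set.univ.pi fun _ => Set.Ioo 0 1

/-- The closed unit cube `[0,1]^m`. -/
def closedCube (m : ℕ) : Set (Fin m → ℝ) := Set.univ.pi fun _ => Set.Icc 0 1

/-- Lebesgue measure on the open unit cube. -/
def cubeMeasure (m : ℕ) : Measure (Fin m → ℝ) := volume.restrict (openCube m)

/-- The `i`-th classical partial derivative. -/
def partialDeriv (i : Fin m) (φ : (Fin m → ℝ) → ℝ) : (Fin m → ℝ) → ℝ :=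
  fun x => fderiv ℝ φ x (Pi.single i 1)

/-- The classical derivative `∂^|k| / (∂x₁^k₁ ⋯ ∂x_m^k_m)` for a multi-index `k`. -/
def multiDeriv (k : Fin m → ℕ) (φ : (Fin m → ℝ) → ℝ) : (Fin m → ℝ) → ℝ :=
  (List.finRange m).foldr (fun i ψ => (partialDeriv i)^[k i] ψ) φ

/-- Test functions: infinitely differentiable functions with compact support inside the open unit cube. -/
def IsTestFunction (φ : (Fin m → ℝ) → ℝ) : Prop :=
  ContDiff ℝ ((⊤ : ℕ∞) : WithTop ℕ∞) φ ∧ HasCompactSupport φ ∧ tsupport φ ⊆ openCube m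

/-- `g` is the `k`-th weak derivative of `f` on the open unit cube and lies in `L^p`. -/
def IsWeakDerivLp (p : ℝ≥0∞) (k : Fin m → ℕ) (f g : (Fin m → ℝ) → ℝ) : Prop :=
  MemLp g p (cubeMeasure m) ∧
    ∀ φ : (Fin m → ℝ) → ℝ, IsTestFunction φ →
      ∫ x, f x * multiDeriv k φ x ∂(cubeMeasure m) =
        (-1) ^ (∑ i, k i) * ∫ x, g x * φ x ∂(cubeMeasure m)

/-- `f` belongs to `W^{s,p}`: it lies in `L^p` and has weak derivatives in `L^p` for every
multi-index of order at most `s`. -/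
def MemSobolev (s : ℕ) (p : ℝ≥0∞) (f : (Fin m → ℝ) → ℝ) : Prop :=
  MemLp f p (cubeMeasure m) ∧
    ∀ k : Fin m → ℕ, ∑ i, k i ≤ s → ∃ g, IsWeakDerivLp p k f g

open Classical in
/-- A version of the weak derivative `D^k f` in `L^p` (unique almost everywhere); `0` if there is
none. -/
def weakDeriv (p : ℝ≥0∞) (k : Fin m → ℕ) (f : (Fin m → ℝ) → ℝ) : (Fin m → ℝ) → ℝ :=
  if h : ∃ g, IsWeakDerivLp p k f g then h.choose else 0

/-- `|∇_s f| = (∑_{|k| = s} |D^k f|²)^{1/2}`. -/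
def gradNorm (s : ℕ) (p : ℝ≥0∞) (f : (Fin m → ℝ) → ℝ) : (Fin m → ℝ) → ℝ :=
  fun x => √(∑ k ∈ Finset.piAntidiag Finset.univ s, |weakDeriv p k f x| ^ 2)

/-- The Sobolev norm `‖f‖_{L^p} + ‖ |∇_s f| ‖_{L^p}` of an element of `W^{s,p}`. -/
def sobolevNorm (s : ℕ) (p : ℝ≥0∞) (f : (Fin m → ℝ) → ℝ) : ℝ≥0∞ :=
  eLpNorm f p (cubeMeasure m) + eLpNorm (gradNorm s p f) p (cubeMeasure m)

/-- The unit ball of `W^{s,p}` as a subset of `L^q_ν`: the classes, modulo `ν`, of the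
representatives that are continuous on the closed cube. -/
def sobolevBall (s : ℕ) (p q : ℝ≥0∞) (ν : Measure (Fin m → ℝ)) : Set (Lp ℝ q ν) :=
  {u | ∃ f : (Fin m → ℝ) → ℝ, ContinuousOn f (closedCube m) ∧ MemSobolev s p f ∧
    sobolevNorm s p f ≤ 1 ∧ u =ᵐ[ν] f}

end Sobolev

/-! ## Dyadic partitions -/

section Partitions

variable {m : ℕ}

/-- The exponent `s - m / p` (with `m / ∞ = 0`). -/
def rhoHat (m s : ℕ) (p : ℝ≥0∞) : ℝ := (s : ℝ) - m * (p⁻¹).toReal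

/-- The half-open dyadic cube `∏ᵢ (lᵢ 2⁻ⁿ, (lᵢ + 1) 2⁻ⁿ]`. -/
def dyadicCube (n : ℕ) (l : Fin m → ℤ) : Set (Fin m → ℝ) :=
  Set.univ.pi fun i => Set.Ioc ((l i : ℝ) / 2 ^ n) (((l i : ℝ) + 1) / 2 ^ n)

/-- The dyadic cubes of side length `2⁻ⁿ` of positive `ν`-measure. -/
def dyadicCubes (ν : Measure (Fin m → ℝ)) (n : ℕ) : Set (Set (Fin m → ℝ)) :=
  {Q | (∃ l : Fin m → ℤ, Q = dyadicCube n l) ∧ 0 < ν Q}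

/-- `𝔍(Q) = ν(Q) Λ(Q)^{ϱ/m}` with `ϱ = q (s - m/p)`, for `q < ∞`. -/
def cubeWeight (s : ℕ) (p q : ℝ≥0∞) (ν : Measure (Fin m → ℝ)) (Q : Set (Fin m → ℝ)) : ℝ :=
  ν.real Q * volume.real Q ^ (q.toReal * rhoHat m s p / m)

/-- For `q < ∞` and `t > 0`: the dyadic cubes `Q` with `𝔍(Q) < t` whose dyadic parent `Q'`
satisfies `𝔍(Q') ≥ t`. -/
def levelPartition (s : ℕ) (p q : ℝ≥0∞) (ν : Measure (Fin m → ℝ)) (t : ℝ) :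
    Set (Set (Fin m → ℝ)) :=
  {Q | ∃ n : ℕ, Q ∈ dyadicCubes ν (n + 1) ∧ cubeWeight s p q ν Q < t ∧
    ∃ Q' ∈ dyadicCubes ν n, Q ⊆ Q' ∧ t ≤ cubeWeight s p q ν Q'}

open Classical in
/-- The `k`-th partition: the level partition for `t_k` if `q < ∞`, and all dyadic cubes of side
length `2^{-j_k}` and positive `ν`-measure if `q = ∞`. -/
def partition (s : ℕ) (p q : ℝ≥0∞) (ν : Measure (Fin m → ℝ)) (t : ℕ → ℝ) (j : ℕ → ℕ) (k : ℕ) :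
    Set (Set (Fin m → ℝ)) :=
  if q = ∞ then dyadicCubes ν (j k) else levelPartition s p q ν (t k)

/-- The bounded-level-gap condition: the levels of nested cubes from consecutive level partitions
differ by a bounded amount (a condition for `q < ∞` only, where these are defined), and the
increments of `j` are bounded. -/
def BoundedLevelGap (s : ℕ) (p q : ℝ≥0∞) (ν : Measure (Fin m → ℝ)) (t : ℕ → ℝ) (j : ℕ → ℕ) :
    Prop :=
  (q ≠ ∞ → ∃ R : ℝ, ∀ k : ℕ, ∀ Q ∈ levelPartition s p q ν (t (k + 1)),
    ∀ Q' ∈ levelPartition s p q ν (t k), Q ⊆ Q' →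
      |Real.logb 2 (volume.real Q) - Real.logb 2 (volume.real Q')| ≤ R) ∧
  ∃ R : ℕ, ∀ k : ℕ, j (k + 1) ≤ j k + R

/-- The dimension `κ` of the space of polynomials in `m` variables of degree at most `s - 1`. -/
def polyDim (m s : ℕ) : ℕ :=
  Module.finrank ℝ (MvPolynomial.restrictTotalDegree (Fin m) ℝ (s - 1))

open Classical in
/-- The factor `T_k`: `t_k^{1/q}` if `q < ∞` and `2^{-k(s - m/p)}` if `q = ∞`. Sequences are indexed
from `0` here and from `1` in the usual notation, so that the index `k` below stands for the usual
`k + 1`. -/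
def scaleFactor (m s : ℕ) (p q : ℝ≥0∞) (t : ℕ → ℝ) (k : ℕ) : ℝ≥0∞ :=
  if q = ∞ then ENNReal.ofReal ((2 : ℝ) ^ (-((k : ℝ) + 1) * rhoHat m s p))
  else ENNReal.ofReal (t k ^ (1 / q.toReal))

end Partitions

end SobolevWidths

end

open SobolevWidths

open SobolevWidths


/-! The upper bound is a multiscale argument. For `u` in the Sobolev ball let `Π_k u` be its
projection onto piecewise polynomials of degree at most `s - 1` on the `k`-th partition, built cube
by cube from Auerbach bases in `L^q_ν`. The cubes shrink, so `u = Π_0 u + Σ (Π_{k+1} - Π_k) u`. The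
partitions are nested, hence each difference is piecewise polynomial on the finer of its two
partitions. It is therefore encoded by `κ M_k` coefficients, and decoding `ℓ_q → L^q_ν` has norm at
most `κ`. Once the coefficient vectors are bounded in `ℓ_p` by `C T_k`, near-optimal subspaces,
kernels or operators for the finite-dimensional balls can be transported to `L^q_ν` and combined,
which gives the inequality for all three widths (`BlockDecomposition.nWidth_le`).

The coefficient bound rests on a Morrey-type estimate (`exists_poly_approx`): on a cube `Q` inside
the unit cube, `f` is uniformly within `C Λ(Q)^{ϱ̂/m} ‖∇_s f‖_{L^p(Q)}` of a polynomial, up to an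
arbitrarily small error. So the projection error in `L^q_ν(Q)` is at most a constant times
`ν(Q)^{1/q} Λ(Q)^{ϱ̂/m} ≤ T_k` times the local gradient norm, and the `ℓ_p`-norm of the local
gradient norms over disjoint cubes is at most one (`exists_coeff_bound`). A difference on a cube of
level `k + 1` also sees the error on the parent of level `k`. This requires boundedly many children
per cube, which follows from the bounded level gap by comparing volumes, and `T_k ≤ D T_{k+1}`. For
`q < ∞` the latter is not a hypothesis; `level_ratio` derives it by a pigeonhole argument.

The level sets `P_t` need cover `ν` only when `t` does not exceed the total mass. The finitely many
earlier indices are served by zero blocks.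

Positivity: an infinite support provides, for every `n`, disjointly supported bumps at `n + 1`
support points. They are linearly independent in `L^q_ν` and their small combinations lie in the
ball, so the ball contains an `(n + 1)`-dimensional parallelepiped, whose `n`-widths are positive.
-/

namespace SobolevWidths

/-! ### Widths of sets that factor through finite-dimensional blocks. -/

section AbstractWidths

variable {V : Type*} [NormedAddCommGroup V] [NormedSpace ℝ V]

theorem exists_le_iInf_add {ι : Sort*} [Nonempty ι] (f : ι → ℝ≥0∞) {ε : ℝ≥0∞} (hε : ε ≠ 0) :
    ∃ i, f i ≤ (⨅ i, f i) + ε := by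
  by_cases h : (⨅ i, f i) = ∞
  · exact ⟨Classical.arbitrary ι, by rw [h, top_add]; exact le_top⟩
  · obtain ⟨i, hi⟩ := iInf_lt_iff.1 (ENNReal.lt_add_right h hε)
    exact ⟨i, hi.le⟩

theorem exists_mem_le_biInf_add {α : Type*} {P : α → Prop} (h : ∃ a, P a) (f : α → ℝ≥0∞)
    {ε : ℝ≥0∞} (hε : ε ≠ 0) : ∃ a, P a ∧ f a ≤ (⨅ (a) (_ : P a), f a) + ε := by
  obtain ⟨a, ha⟩ := h
  have : Nonempty {a // P a} := ⟨⟨a, ha⟩⟩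
  obtain ⟨i, hi⟩ := exists_le_iInf_add (fun a : {a // P a} => f a) hε
  exact ⟨i, i.2, by rwa [iInf_subtype] at hi⟩

theorem exists_mem_lpBall_smul (p q : ℝ≥0∞) [Fact (1 ≤ p)] {M : ℕ}
    (x : PiLp q (fun _ : Fin M => ℝ)) (r : ℝ≥0)
    (hx : ‖(WithLp.toLp p (WithLp.ofLp x) : PiLp p (fun _ : Fin M => ℝ))‖ ≤ r) :
    ∃ z ∈ lpBall p q M, x = (r : ℝ) • z := by
  rcases eq_or_ne r 0 with rfl | hr
  · refine ⟨0, by simp [lpBall], ?_⟩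
    have h0 : (WithLp.toLp p (WithLp.ofLp x) : PiLp p (fun _ : Fin M => ℝ)) = 0 :=
      norm_le_zero_iff.1 (by simpa using hx)
    have h1 : WithLp.ofLp x = 0 := by simpa using h0
    rw [smul_zero]
    exact (WithLp.ofLp_injective q) (by simpa using h1)
  · have hr' : (r : ℝ) ≠ 0 := by exact_mod_cast hr
    refine ⟨(r : ℝ)⁻¹ • x, ?_, by rw [smul_inv_smul₀ hr']⟩
    simp only [lpBall, Set.mem_ofPred_eq, WithLp.ofLp_smul, WithLp.toLp_smul, norm_smul, norm_inv,
      Real.norm_eq_abs, NNReal.abs_eq]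
    rw [inv_mul_le_iff₀ (by positivity)]
    simpa using hx

/-- A factorisation of the points of `A` through a sequence of finite-dimensional blocks. -/
structure BlockDecomposition (A : Set V) (p q : ℝ≥0∞) [Fact (1 ≤ p)] [Fact (1 ≤ q)]
    (N : ℕ → ℕ) (T : ℕ → ℝ≥0) (c₁ c₂ : ℝ≥0) where
  coeff : ∀ k, V →L[ℝ] PiLp q (fun _ : Fin (N k) => ℝ)
  synth : ∀ k, PiLp q (fun _ : Fin (N k) => ℝ) →L[ℝ] V
  norm_synth_le : ∀ k, ‖synth k‖ ≤ c₁
  coeff_le : ∀ x ∈ A, ∀ k, ‖(WithLp.toLp p (WithLp.ofLp (coeff k x)) :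
    PiLp p (fun _ : Fin (N k) => ℝ))‖ ≤ c₂ * T k
  tendsto_sum : ∀ x ∈ A, Tendsto (fun n => ∑ k ∈ Finset.range n, synth k (coeff k x)) atTop (𝓝 x)

namespace BlockDecomposition

variable {A : Set V} {p q : ℝ≥0∞} [Fact (1 ≤ p)] [Fact (1 ≤ q)]
    {N : ℕ → ℕ} {T : ℕ → ℝ≥0} {c₁ c₂ : ℝ≥0}

/-- The single analytic estimate behind all three widths: `b k` stands for an approximation of the
`k`-th coefficient vector, and only finitely many are nonzero. The triangle inequality bounds every
long partial sum, and the bound passes to the limit. -/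
theorem enorm_sub_sum_le (D : BlockDecomposition A p q N T c₁ c₂) {x : V} (hx : x ∈ A)
    (F : Finset ℕ) (b : ∀ k, PiLp q (fun _ : Fin (N k) => ℝ)) (hb : ∀ k ∉ F, b k = 0) :
    ‖x - ∑ k ∈ F, D.synth k (b k)‖ₑ ≤ c₁ * ∑' k, ‖D.coeff k x - b k‖ₑ := by
  have hlim : Tendsto (fun n => ‖∑ k ∈ Finset.range n, D.synth k (D.coeff k x)
      - ∑ k ∈ F, D.synth k (b k)‖ₑ) atTop (𝓝 ‖x - ∑ k ∈ F, D.synth k (b k)‖ₑ) :=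
    ((D.tendsto_sum x hx).sub_const _).enorm
  refine le_of_tendsto hlim ?_
  filter_upwards [eventually_ge_atTop (F.sup id + 1)] with n hn
  have hF : F ⊆ Finset.range n := fun k hk => Finset.mem_range.2
    (lt_of_lt_of_le (Nat.lt_succ_of_le (Finset.le_sup (f := id) hk)) hn)
  rw [Finset.sum_subset hF (fun k _ hk => by rw [hb k hk, map_zero]), ← Finset.sum_sub_distrib]
  calc ‖∑ k ∈ Finset.range n, (D.synth k (D.coeff k x) - D.synth k (b k))‖ₑ
      ≤ ∑ k ∈ Finset.range n, ‖D.synth k (D.coeff k x) - D.synth k (b k)‖ₑ := enorm_sum_le _ _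
    _ ≤ ∑ k ∈ Finset.range n, c₁ * ‖D.coeff k x - b k‖ₑ := by
        refine Finset.sum_le_sum fun k _ => ?_
        rw [← map_sub]
        refine ((D.synth k).le_opENorm _).trans ?_
        gcongr
        rw [← ofReal_norm]
        exact ENNReal.ofReal_le_of_le_toReal (by simpa using D.norm_synth_le k)
    _ ≤ c₁ * ∑' k, ‖D.coeff k x - b k‖ₑ := by
        rw [← Finset.mul_sum]
        gcongr
        exact ENNReal.sum_le_tsum _

theorem exists_scaled (D : BlockDecomposition A p q N T c₁ c₂) {x : V} (hx : x ∈ A) (k : ℕ) :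
    ∃ z ∈ lpBall p q (N k), D.coeff k x = ((c₂ * T k : ℝ≥0) : ℝ) • z :=
  exists_mem_lpBall_smul p q _ _ (by simpa using D.coeff_le x hx k)

theorem tsum_scaled_le {e : ℕ → ℝ≥0∞} {E : ℕ → ℝ≥0∞}
    (h : ∀ k, E k ≤ (c₂ * T k : ℝ≥0) * e k) :
    (c₁ : ℝ≥0∞) * ∑' k, E k ≤ (c₁ * c₂ : ℝ≥0) * ∑' k, T k * e k := by
  have : ((c₁ * c₂ : ℝ≥0) : ℝ≥0∞) * ∑' k, T k * e k = c₁ * ∑' k, c₂ * (T k * e k) := by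
    rw [ENNReal.coe_mul, mul_assoc, ENNReal.tsum_mul_left]
  rw [this]
  refine mul_le_mul' le_rfl (ENNReal.tsum_le_tsum fun k => (h k).trans (le_of_eq ?_))
  rw [ENNReal.coe_mul, mul_assoc]

/-- In the discrete space `ℕ` a convergent net of partial sums is eventually constant, so adding one
more index to a late finite set cannot change the sum. -/
theorem sum_eq_of_hasSum {nn : ℕ → ℕ} {n : ℕ} (hn : HasSum nn n) :
    ∃ F : Finset ℕ, (∀ k ∉ F, nn k = 0) ∧ ∑ k ∈ F, nn k = n := by
  have hev : ∀ᶠ F : Finset ℕ in atTop, ∑ k ∈ F, nn k = n :=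
    hn.eventually_mem ((isOpen_discrete {n}).mem_nhds rfl)
  obtain ⟨F, hF⟩ := eventually_atTop.1 hev
  refine ⟨F, fun k hk => ?_, hF F le_rfl⟩
  have h1 := hF (insert k F) (Finset.subset_insert k F)
  rw [Finset.sum_insert hk, hF F le_rfl] at h1
  lia

theorem rank_sup_le (F : Finset ℕ) (W : ℕ → Submodule ℝ V) (nn : ℕ → ℕ)
    (hW : ∀ k, Module.rank ℝ (W k) ≤ (nn k : Cardinal)) :
    Module.rank ℝ (F.sup W : Submodule ℝ V) ≤ ((∑ k ∈ F, nn k : ℕ) : Cardinal) := by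
  classical
  induction F using Finset.induction_on with
  | empty => simp
  | insert k F hk ih =>
    rw [Finset.sup_insert, Finset.sum_insert hk, Nat.cast_add]
    exact (Submodule.rank_add_le_rank_add_rank _ _).trans (add_le_add (hW k) ih)

/-- The competitor is the sum of the images of the block subspaces under the decoding maps; ranks
add up to at most `n`. -/
theorem kolmogorovWidth_le (D : BlockDecomposition A p q N T c₁ c₂) {nn : ℕ → ℕ} {n : ℕ}
    (hn : HasSum nn n) {e : ℕ → ℝ≥0∞}
    (he : ∀ k, ∃ W : Submodule ℝ (PiLp q (fun _ : Fin (N k) => ℝ)),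
      Module.rank ℝ W ≤ (nn k : Cardinal) ∧ ⨆ x ∈ lpBall p q (N k), ⨅ y ∈ W, ‖x - y‖ₑ ≤ e k) :
    kolmogorovWidth n A ≤ (c₁ * c₂ : ℝ≥0) * ∑' k, T k * e k := by
  choose W hW he using he
  obtain ⟨F, hF, rfl⟩ := sum_eq_of_hasSum hn
  let W' : ℕ → Submodule ℝ V := fun k => (W k).map (D.synth k : _ →ₗ[ℝ] V)
  have hW' : ∀ k, Module.rank ℝ (W' k) ≤ (nn k : Cardinal) := fun k =>
    Cardinal.lift_le.1 ((lift_rank_map_le _ _).trans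
      (Cardinal.lift_le.2 (hW k)|>.trans (by simp)))
  refine iInf₂_le_of_le (F.sup W') (rank_sup_le F W' nn hW') ?_
  refine iSup₂_le fun x hx => ?_
  refine ENNReal.le_of_forall_pos_le_add fun ε hε _ => ?_
  -- Best approximations in `W k` need not be attained; the slacks `δ k` are small enough that,
  -- weighted by the block constants, they sum to less than `ε`.
  obtain ⟨δ, hδ, hδε⟩ := ENNReal.exists_pos_tsum_mul_lt_of_countable (ι := ℕ)
    (ε := ε) (by simpa using hε.ne') (fun k => (((c₁ * c₂ : ℝ≥0) * T k : ℝ≥0) : ℝ≥0∞))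
    (fun k => ENNReal.coe_ne_top)
  choose z hz hxz using D.exists_scaled hx
  have hy : ∀ k, ∃ y ∈ W k, ‖z k - y‖ₑ ≤ e k + δ k := fun k => by
    obtain ⟨y, hy, hle⟩ := exists_mem_le_biInf_add (P := fun y => y ∈ W k) ⟨0, zero_mem _⟩
      (fun y => ‖z k - y‖ₑ) (ε := δ k) (by simpa using (hδ k).ne')
    refine ⟨y, hy, hle.trans ?_⟩
    gcongr
    exact (le_iSup₂ (f := fun x (_ : x ∈ lpBall p q (N k)) => ⨅ y ∈ W k, ‖x - y‖ₑ) (z k)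
      (hz k)).trans (he k)
  choose y hyW hy using hy
  -- Outside `F` the budget `nn k` is zero, which forces the trivial subspace and so a zero
  -- approximant.
  have hbF : ∀ k ∉ F, ((c₂ * T k : ℝ≥0) : ℝ) • y k = 0 := fun k hk => by
    have : W k = ⊥ := by
      rw [← Submodule.rank_eq_zero]
      simpa [hF k hk] using hW k
    have h0 : y k = 0 := by simpa [this] using hyW k
    rw [h0, smul_zero]
  refine (iInf₂_le (∑ k ∈ F, D.synth k (((c₂ * T k : ℝ≥0) : ℝ) • y k)) ?_).trans ?_
  · refine Submodule.sum_mem _ fun k hk => ?_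
    exact (Finset.le_sup (f := W') hk) ⟨_, (W k).smul_mem _ (hyW k), rfl⟩
  · refine (D.enorm_sub_sum_le hx F _ hbF).trans ?_
    refine (tsum_scaled_le (c₂ := c₂) (T := T) (e := fun k => e k + δ k) fun k => ?_).trans ?_
    · rw [hxz k, ← smul_sub, enorm_smul]
      refine mul_le_mul' (le_of_eq ?_) (hy k)
      rw [Real.enorm_eq_ofReal (by positivity), ENNReal.ofReal_coe_nnreal]
    · simp only [mul_add]
      rw [ENNReal.tsum_add, mul_add]
      gcongr
      refine le_trans (le_of_eq ?_) hδε.le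
      rw [← ENNReal.tsum_mul_left]
      simp only [ENNReal.coe_mul, mul_assoc]

/-- The competitor encodes, applies the block operator and decodes, summed over the finitely many
blocks with a positive budget; outside them rank zero means the zero operator. -/
theorem linearWidth_le (D : BlockDecomposition A p q N T c₁ c₂) {nn : ℕ → ℕ} {n : ℕ}
    (hn : HasSum nn n) {e : ℕ → ℝ≥0∞}
    (he : ∀ k, ∃ B : PiLp q (fun _ : Fin (N k) => ℝ) →L[ℝ] PiLp q (fun _ : Fin (N k) => ℝ),
      LinearMap.rank (B : PiLp q (fun _ : Fin (N k) => ℝ) →ₗ[ℝ] PiLp q (fun _ : Fin (N k) => ℝ)) ≤ (nn k : Cardinal) ∧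
        ⨆ x ∈ lpBall p q (N k), ‖x - B x‖ₑ ≤ e k) :
    linearWidth n A ≤ (c₁ * c₂ : ℝ≥0) * ∑' k, T k * e k := by
  choose B hB he using he
  obtain ⟨F, hF, rfl⟩ := sum_eq_of_hasSum hn
  refine iInf₂_le_of_le (∑ k ∈ F, (D.synth k).comp ((B k).comp (D.coeff k))) ?_ ?_
  · have : ((∑ k ∈ F, (D.synth k).comp ((B k).comp (D.coeff k)) : V →L[ℝ] V) : V →ₗ[ℝ] V)
        = ∑ k ∈ F, ((D.synth k : _ →ₗ[ℝ] V) ∘ₗ ((B k : PiLp q (fun _ : Fin (N k) => ℝ) →ₗ[ℝ] PiLp q (fun _ : Fin (N k) => ℝ)) ∘ₗ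
          (D.coeff k : V →ₗ[ℝ] PiLp q (fun _ : Fin (N k) => ℝ)))) := by
      ext x; simp
    rw [this]
    refine (LinearMap.rank_finsetSum_le _ _).trans ?_
    rw [Nat.cast_sum]
    refine Finset.sum_le_sum fun k _ => ?_
    refine Cardinal.lift_le.1 ((LinearMap.lift_rank_comp_le_right _ _).trans ?_)
    refine (Cardinal.lift_le.2 ((LinearMap.rank_comp_le_left _ _).trans (hB k))).trans (by simp)
  · refine iSup₂_le fun x hx => ?_
    choose z hz hxz using D.exists_scaled hx
    have hbF : ∀ k ∉ F, B k (D.coeff k x) = 0 := fun k hk => by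
      have h0 : LinearMap.range (B k : PiLp q (fun _ : Fin (N k) => ℝ) →ₗ[ℝ] PiLp q (fun _ : Fin (N k) => ℝ)) = ⊥ := by
        rw [← Submodule.rank_eq_zero]
        have := hB k
        rw [hF k hk] at this
        simpa [LinearMap.rank] using this
      exact (Submodule.mem_bot ℝ).1 (h0 ▸ LinearMap.mem_range_self
        (B k : PiLp q (fun _ : Fin (N k) => ℝ) →ₗ[ℝ] PiLp q (fun _ : Fin (N k) => ℝ)) (D.coeff k x))
    have hsum : (∑ k ∈ F, (D.synth k).comp ((B k).comp (D.coeff k))) x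
        = ∑ k ∈ F, D.synth k (B k (D.coeff k x)) := by
      simp
    rw [hsum]
    refine (D.enorm_sub_sum_le hx F _ hbF).trans ?_
    refine tsum_scaled_le (c₂ := c₂) (T := T) fun k => ?_
    rw [hxz k, map_smul, ← smul_sub, enorm_smul]
    refine mul_le_mul' (le_of_eq ?_) ?_
    · rw [Real.enorm_eq_ofReal (by positivity), ENNReal.ofReal_coe_nnreal]
    · exact (le_iSup₂ (f := fun x (_ : x ∈ lpBall p q (N k)) => ‖x - B k x‖ₑ) (z k)
        (hz k)).trans (he k)

/-- Pulling the block functionals back along the encoding maps gives `∑ nn k = n` functionals on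
`V`. No point is approximated here: on their common kernel every coefficient vector lies in its
block kernel, and the norm is estimated with all approximants zero. -/
theorem gelfandWidth_le (D : BlockDecomposition A p q N T c₁ c₂) {nn : ℕ → ℕ} {n : ℕ}
    (hn : HasSum nn n) {e : ℕ → ℝ≥0∞}
    (he : ∀ k, ∃ U : Submodule ℝ (PiLp q (fun _ : Fin (N k) => ℝ)),
      CodimLE U (nn k) ∧ ⨆ x ∈ lpBall p q (N k) ∩ (U : Set _), ‖x‖ₑ ≤ e k) :
    gelfandWidth n A ≤ (c₁ * c₂ : ℝ≥0) * ∑' k, T k * e k := by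
  choose U hU he using he
  choose φ hφ using hU
  obtain ⟨F, hF, hsum⟩ := sum_eq_of_hasSum hn
  let U' : Submodule ℝ V := ⨅ k ∈ F, (U k).comap (D.coeff k : V →ₗ[ℝ] _)
  have hU' : ∀ x, x ∈ U' ↔ ∀ k ∈ F, D.coeff k x ∈ U k := fun x => by
    simp [U', Submodule.mem_iInf]
  have hcard : Fintype.card (Σ k : F, Fin (nn k)) = n := by
    rw [Fintype.card_sigma, ← hsum, ← Finset.sum_coe_sort F]
    simp
  let eq : (Σ k : F, Fin (nn k)) ≃ Fin n := Fintype.equivFinOfCardEq hcard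
  refine iInf₂_le_of_le U' ⟨fun i => (φ (eq.symm i).1 (eq.symm i).2).comp
    (D.coeff (eq.symm i).1), fun v => ?_⟩ ?_
  · rw [hU']
    refine ⟨fun h i => (hφ _ _).1 (h _ (eq.symm i).1.2) _, fun h k hk => (hφ _ _).2 fun i => ?_⟩
    have := (eq.forall_congr_left (p := fun j => φ j.1 j.2 (D.coeff j.1 v) = 0)).2 h
    exact this ⟨⟨k, hk⟩, i⟩
  · refine iSup₂_le fun x ⟨hx, hxU⟩ => ?_
    have hxU' : ∀ k, D.coeff k x ∈ U k := fun k => by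
      by_cases hk : k ∈ F
      · exact (hU' x).1 hxU k hk
      · refine (hφ k _).2 fun i => ?_
        rw [hF k hk] at i
        exact i.elim0
    have h1 := D.enorm_sub_sum_le hx ∅ (fun _ => 0) (fun _ _ => rfl)
    simp only [Finset.sum_empty, sub_zero] at h1
    refine h1.trans (tsum_scaled_le (c₂ := c₂) (T := T) fun k => ?_)
    obtain ⟨z, hz, hxz⟩ := D.exists_scaled hx k
    rw [hxz, enorm_smul, Real.enorm_eq_ofReal (by positivity), ENNReal.ofReal_coe_nnreal]
    -- Membership of `z` in `U k` is recovered by dividing by the scale; at scale zero the whole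
    -- term vanishes instead.
    rcases eq_or_ne (c₂ * T k) 0 with h0 | h0
    · simp [h0]
    gcongr
    have hzU : z ∈ U k := by
      have := hxU' k
      rw [hxz] at this
      exact ((U k).smul_mem_iff (by exact_mod_cast h0)).1 this
    exact (le_iSup₂ (f := fun x (_ : x ∈ lpBall p q (N k) ∩ (U k : Set _)) => ‖x‖ₑ) z
      ⟨hz, hzU⟩).trans (he k)

/-- The block infima are attained only approximately, so each width is enlarged by `δ k`. The
subspaces `⊥`, `⊤` and the operator `0` show that the competitor families are nonempty. -/
theorem nWidth_le (D : BlockDecomposition A p q N T c₁ c₂) (star : WidthKind) {nn : ℕ → ℕ} {n : ℕ}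
    (hn : HasSum nn n) :
    nWidth star n A ≤ (c₁ * c₂ : ℝ≥0) * ∑' k, T k * nWidth star (nn k) (lpBall p q (N k)) := by
  refine ENNReal.le_of_forall_pos_le_add fun ε hε _ => ?_
  obtain ⟨δ, hδ, hδε⟩ := ENNReal.exists_pos_tsum_mul_lt_of_countable (ι := ℕ)
    (ε := ε) (by simpa using hε.ne') (fun k => (((c₁ * c₂ : ℝ≥0) * T k : ℝ≥0) : ℝ≥0∞))
    (fun k => ENNReal.coe_ne_top)
  have hδ' : ∀ k, (δ k : ℝ≥0∞) ≠ 0 := fun k => by simpa using (hδ k).ne'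
  have key : nWidth star n A ≤ (c₁ * c₂ : ℝ≥0) *
      ∑' k, T k * (nWidth star (nn k) (lpBall p q (N k)) + δ k) := by
    cases star with
    | K =>
      refine D.kolmogorovWidth_le hn fun k => ?_
      exact exists_mem_le_biInf_add ⟨⊥, by simp⟩ _ (hδ' k)
    | G =>
      refine D.gelfandWidth_le hn fun k => ?_
      exact exists_mem_le_biInf_add ⟨⊤, fun _ => 0, by simp⟩ _ (hδ' k)
    | L =>
      refine D.linearWidth_le hn fun k => ?_
      exact exists_mem_le_biInf_add ⟨0, by simp⟩ _ (hδ' k)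
  refine key.trans ?_
  simp only [mul_add]
  rw [ENNReal.tsum_add, mul_add]
  gcongr
  refine le_trans (le_of_eq ?_) hδε.le
  rw [← ENNReal.tsum_mul_left]
  simp only [ENNReal.coe_mul, mul_assoc]

end BlockDecomposition

/-! ### Lower bounds for widths from linearly independent vectors. -/

section Positivity

variable {n : ℕ} {v : Fin (n + 1) → V}

/-- Linear independence of a finite family is an open condition. If `W` came too close to all the `v
i`, the nearby vectors would be `n + 1` independent elements of a space of dimension at most `n`. -/
theorem kolmogorovWidth_pos (hv : LinearIndependent ℝ v) {A : Set V} (hA : ∀ i, v i ∈ A) :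
    0 < kolmogorovWidth n A := by
  obtain ⟨ε, hε, hball⟩ := Metric.eventually_nhds_iff.1 hv.eventually
  refine lt_of_lt_of_le (b := ENNReal.ofReal (ε / 2)) (by simpa using hε) ?_
  refine le_iInf₂ fun W hW => ?_
  by_contra! hlt
  have hw : ∀ i, ∃ w ∈ W, ‖v i - w‖ₑ < ENNReal.ofReal (ε / 2) := fun i => by
    have := (le_iSup₂ (f := fun x (_ : x ∈ A) => ⨅ y ∈ W, ‖x - y‖ₑ) (v i) (hA i)).trans_lt hlt
    simpa [iInf_lt_iff] using this
  choose w hwW hw using hw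
  have hli : LinearIndependent ℝ w := by
    refine hball ((dist_pi_lt_iff hε).2 fun i => ?_)
    rw [dist_comm, dist_eq_norm]
    have := hw i
    rw [← ofReal_norm, ENNReal.ofReal_lt_ofReal_iff (by linarith)] at this
    linarith
  have hli' : LinearIndependent ℝ (fun i => (⟨w i, hwW i⟩ : W)) :=
    LinearIndependent.of_comp W.subtype hli
  have := hli'.cardinal_lift_le_rank.trans (Cardinal.lift_le.2 hW)
  rw [Cardinal.mk_fin, Cardinal.lift_natCast, Cardinal.lift_natCast] at this
  exact absurd (Nat.cast_le.1 this) (by lia)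

/-- The range of `B` competes in the Kolmogorov width and `B x` is one of its points, so the linear
width dominates. -/
theorem linearWidth_pos (hv : LinearIndependent ℝ v) {A : Set V} (hA : ∀ i, v i ∈ A) :
    0 < linearWidth n A := by
  refine (kolmogorovWidth_pos hv hA).trans_le (le_iInf₂ fun B hB => ?_)
  refine iInf₂_le_of_le (LinearMap.range (B : V →ₗ[ℝ] V)) hB ?_
  exact iSup₂_mono fun x _ => iInf₂_le (B x) ⟨x, rfl⟩

/-- On an `(n + 1)`-dimensional space `n` functionals have a common nonzero zero. Normalised in the
sup norm of its coefficients, it lies in the parallelepiped, and the coefficient map is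
antilipschitz, so its norm is bounded below independently of `U`. -/
theorem gelfandWidth_pos (hv : LinearIndependent ℝ v) {A : Set V}
    (hA : ∀ c : Fin (n + 1) → ℝ, (∀ i, |c i| ≤ 1) → ∑ i, c i • v i ∈ A) :
    0 < gelfandWidth n A := by
  let L : (Fin (n + 1) → ℝ) →ₗ[ℝ] V := Fintype.linearCombination ℝ v
  have hker : LinearMap.ker L = ⊥ := LinearMap.ker_eq_bot.2
    (linearIndependent_iff_injective_fintypeLinearCombination.1 hv)
  obtain ⟨K, hK, hanti⟩ := L.exists_antilipschitzWith hker
  refine lt_of_lt_of_le (b := ENNReal.ofReal ((K : ℝ)⁻¹)) (by simpa using hK) ?_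
  refine le_iInf₂ fun U ⟨φ, hφ⟩ => ?_
  let Φ : (Fin (n + 1) → ℝ) →ₗ[ℝ] (Fin n → ℝ) :=
    LinearMap.pi fun i => (φ i : V →ₗ[ℝ] ℝ) ∘ₗ L
  obtain ⟨c, hc0, hc⟩ : ∃ c ≠ 0, Φ c = 0 := by
    have : LinearMap.ker Φ ≠ ⊥ := LinearMap.ker_ne_bot_of_finrank_lt (by simp)
    obtain ⟨c, hc, hne⟩ := Submodule.exists_mem_ne_zero_of_ne_bot this
    exact ⟨c, hne, hc⟩
  have hcn : 0 < ‖c‖ := norm_pos_iff.2 hc0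
  let d := ‖c‖⁻¹ • c
  have hd : ‖d‖ = 1 := by simp [d, norm_smul, hcn.ne']
  have hdU : L d ∈ U := by
    rw [hφ]
    intro i
    have h0 : Φ d = 0 := by rw [map_smul, hc, smul_zero]
    exact congrFun h0 i
  have hdA : L d ∈ A := by
    have := hA d fun i => by rw [← Real.norm_eq_abs, ← hd]; exact norm_le_pi_norm d i
    simpa [L, Fintype.linearCombination_apply] using this
  refine le_trans ?_ (le_iSup₂ (f := fun x (_ : x ∈ A ∩ (U : Set V)) => ‖x‖ₑ) (L d) ⟨hdA, hdU⟩)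
  rw [← ofReal_norm]
  refine ENNReal.ofReal_le_ofReal ?_
  have := hanti.le_mul_dist d 0
  rw [map_zero, dist_zero_right, dist_zero_right, hd] at this
  rwa [inv_le_iff_one_le_mul₀' (by exact_mod_cast hK)]

theorem nWidth_pos (star : WidthKind) (hv : LinearIndependent ℝ v) {A : Set V}
    (hA : ∀ c : Fin (n + 1) → ℝ, (∀ i, |c i| ≤ 1) → ∑ i, c i • v i ∈ A) :
    0 < nWidth star n A := by
  have hA' : ∀ i, v i ∈ A := fun i => by
    have := hA (Pi.single i 1) fun k => by
      by_cases h : k = i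
      · subst h; simp
      · simp [h]
    simpa [Pi.single_apply] using this
  cases star with
  | K => exact kolmogorovWidth_pos hv hA'
  | G => exact gelfandWidth_pos hv hA
  | L => exact linearWidth_pos hv hA'

end Positivity

end AbstractWidths

end SobolevWidths

namespace SobolevWidths

/-! ### Auerbach bases and biorthogonal systems. -/

section Auerbach

variable {W : Type*} [NormedAddCommGroup W] [NormedSpace ℝ W] [FiniteDimensional ℝ W]

theorem continuous_basis_det {ι : Type*} [Fintype ι] [DecidableEq ι] (B : Module.Basis ι ℝ W) :
    Continuous fun v : ι → W => B.det v := by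
  simp only [Module.Basis.det_apply]
  refine Continuous.matrix_det (continuous_matrix fun i j => ?_)
  exact (LinearMap.continuous_of_finiteDimensional (B.coord i)).comp (continuous_apply j)

/-- An Auerbach basis: unit vectors whose coordinate functionals have norm at most one. -/
theorem exists_auerbach_basis : ∃ (x : Module.Basis (Fin (Module.finrank ℝ W)) ℝ W),
    (∀ i, ‖x i‖ ≤ 1) ∧ ∀ i w, |x.coord i w| ≤ ‖w‖ := by
  let B := Module.finBasis ℝ W
  have hcomp : IsCompact (Set.univ.pi fun _ : Fin (Module.finrank ℝ W) =>
      Metric.closedBall (0 : W) 1) :=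
    isCompact_univ_pi fun _ => isCompact_closedBall 0 1
  obtain ⟨x, hx, hmax⟩ := hcomp.exists_isMaxOn ⟨0, fun i _ => by simp⟩
    (continuous_basis_det B).abs.continuousOn
  have hx' : ∀ i, ‖x i‖ ≤ 1 := fun i => by simpa using hx i (Set.mem_univ i)
  have hmax' : ∀ y : Fin (Module.finrank ℝ W) → W, (∀ i, ‖y i‖ ≤ 1) → |B.det y| ≤ |B.det x| :=
    fun y hy => hmax (show y ∈ _ from fun i _ => by simpa using hy i)
  have hdet : B.det x ≠ 0 := by
    -- The maximum is nonzero because a reference basis, scaled into the unit ball, already has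
    -- nonzero determinant.
    have h1 := hmax' (fun i => (‖B i‖ + 1)⁻¹ • B i) fun i => by
      rw [norm_smul, norm_inv, Real.norm_of_nonneg (by positivity), inv_mul_le_iff₀ (by positivity)]
      linarith
    rw [AlternatingMap.map_smul_univ, B.det_self] at h1
    intro h0
    rw [h0, abs_zero] at h1
    have h2 : 0 < ∏ i, (‖B i‖ + 1)⁻¹ := Finset.prod_pos fun i _ => by positivity
    rw [smul_eq_mul, mul_one, abs_of_pos h2] at h1
    linarith
  obtain ⟨hli, hsp⟩ := (B.is_basis_iff_det).2 (isUnit_iff_ne_zero.2 hdet)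
  let X := Module.Basis.mk hli hsp.ge
  have hX : ∀ i, X i = x i := fun i => by simp [X]
  refine ⟨X, fun i => by rw [hX]; exact hx' i, fun i w => ?_⟩
  -- Cramer's rule: a coordinate is a quotient of determinants. Maximality of the denominator over
  -- the unit ball then gives the norm bound.
  have hcoord : X.coord i = (B.det x)⁻¹ • B.det.toMultilinearMap.toLinearMap x i := by
    refine X.ext fun j => ?_
    rw [X.coord_apply, X.repr_self, hX]
    by_cases hij : j = i
    · subst hij
      simp [hdet]
    · rw [Finsupp.single_eq_of_ne (Ne.symm hij)]
      have := B.det.map_update_self x (Ne.symm hij)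
      simp [this]
  rcases eq_or_ne w 0 with rfl | hw
  · simp
  have hw' : 0 < ‖w‖ := norm_pos_iff.2 hw
  have h1 := hmax' (Function.update x i (‖w‖⁻¹ • w)) fun j => by
    by_cases hj : j = i
    · subst hj; simp [norm_smul, hw'.ne']
    · simpa [hj] using hx' j
  rw [AlternatingMap.map_update_smul, smul_eq_mul, abs_mul, abs_of_pos (inv_pos.2 hw'),
    inv_mul_le_iff₀ hw'] at h1
  rw [hcoord]
  simp only [LinearMap.smul_apply, MultilinearMap.toLinearMap_apply, smul_eq_mul, abs_mul, abs_inv]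
  rw [inv_mul_le_iff₀ (abs_pos.2 hdet), mul_comm]
  exact h1

end Auerbach

/-- Coordinates extend to `V` by Hahn–Banach without increasing their norms. The system is padded
with zeros to length `κ`: different polynomials may agree `ν`-almost everywhere, so the dimension of
the local space can drop, while the block sizes must be exactly `κ M_k`. -/
theorem exists_auerbach_system {V : Type*} [NormedAddCommGroup V] [NormedSpace ℝ V]
    (W : Submodule ℝ V) [FiniteDimensional ℝ W] {κ : ℕ} (hκ : Module.finrank ℝ W ≤ κ) :
    ∃ (b : Fin κ → V) (l : Fin κ → StrongDual ℝ V), (∀ i, b i ∈ W) ∧ (∀ i, ‖b i‖ ≤ 1) ∧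
      (∀ i, ‖l i‖ ≤ 1) ∧ ∀ w ∈ W, ∑ i, l i w • b i = w := by
  obtain ⟨X, hX, hc⟩ := exists_auerbach_basis (W := W)
  obtain ⟨e, rfl⟩ := Nat.exists_eq_add_of_le hκ
  have hext : ∀ i, ∃ g : StrongDual ℝ V, (∀ w : W, g w = X.coord i w) ∧ ‖g‖ ≤ 1 := fun i => by
    obtain ⟨g, hg, hn⟩ := exists_extension_norm_eq W
      ((X.coord i).mkContinuous 1 fun w => by simpa using hc i w)
    exact ⟨g, hg, hn.trans_le (LinearMap.mkContinuous_norm_le _ zero_le_one _)⟩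
  choose g hg hgn using hext
  refine ⟨Fin.append (fun i => (X i : V)) 0, Fin.append g 0, fun i => ?_, fun i => ?_, fun i => ?_,
    fun w hw => ?_⟩
  · refine Fin.addCases (fun i => ?_) (fun i => ?_) i <;> simp
  · refine Fin.addCases (fun i => ?_) (fun i => ?_) i
    · simpa using hX i
    · simp
  · refine Fin.addCases (fun i => ?_) (fun i => ?_) i
    · simpa using hgn i
    · simp
  · rw [Fin.sum_univ_add]
    simp only [Fin.append_left, Fin.append_right, Pi.zero_apply, smul_zero, Finset.sum_const_zero,
      add_zero]
    have h1 := congrArg (W.subtype) (X.sum_repr ⟨w, hw⟩)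
    simp only [map_sum, map_smul, Submodule.subtype_apply] at h1
    rw [← h1]
    refine Finset.sum_congr rfl fun i _ => ?_
    have := hg i ⟨w, hw⟩
    simp only [Module.Basis.coord_apply] at this
    rw [← this, h1]

end SobolevWidths

namespace SobolevWidths

/-! ### Commuting partial derivatives and Taylor's formula with integral remainder. -/

section SmoothFunctions

variable {m : ℕ}

/-- The space of smooth real functions on `ℝ^m`. -/
def smoothFunctions (m : ℕ) : Submodule ℝ ((Fin m → ℝ) → ℝ) where
  carrier := {f | ContDiff ℝ ((⊤ : ℕ∞) : WithTop ℕ∞) f}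
  add_mem' hf hg := by
    rw [Set.mem_ofPred_eq] at *
    exact hf.add hg
  zero_mem' := by
    rw [Set.mem_ofPred_eq]
    exact contDiff_const
  smul_mem' c _ hf := by
    rw [Set.mem_ofPred_eq] at *
    exact contDiff_const.smul hf

theorem contDiff_partialDeriv {f : (Fin m → ℝ) → ℝ} (hf : ContDiff ℝ ((⊤ : ℕ∞) : WithTop ℕ∞) f)
    (i : Fin m) : ContDiff ℝ ((⊤ : ℕ∞) : WithTop ℕ∞) (partialDeriv i f) :=
  (hf.fderiv_right (m := ((⊤ : ℕ∞) : WithTop ℕ∞)) (by norm_cast)).clm_apply contDiff_const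

theorem differentiable_of_smooth {f : (Fin m → ℝ) → ℝ}
    (hf : ContDiff ℝ ((⊤ : ℕ∞) : WithTop ℕ∞) f) : Differentiable ℝ f :=
  hf.differentiable (by simp)

/-- The partial derivative as an endomorphism of the space of smooth functions. -/
noncomputable def partialEnd (i : Fin m) : Module.End ℝ (smoothFunctions m) where
  toFun f := ⟨partialDeriv i f, contDiff_partialDeriv f.2 i⟩
  map_add' f g := by
    ext x
    simp only [partialDeriv, Submodule.coe_add, Pi.add_apply]
    rw [fderiv_add (differentiable_of_smooth f.2 x) (differentiable_of_smooth g.2 x)]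
    rfl
  map_smul' c f := by
    ext x
    simp only [partialDeriv, Submodule.coe_smul, RingHom.id_apply, Pi.smul_apply]
    rw [fderiv_const_smul (differentiable_of_smooth f.2 x)]
    rfl

@[simp]
theorem coe_partialEnd (i : Fin m) (f : smoothFunctions m) :
    (partialEnd i f : (Fin m → ℝ) → ℝ) = partialDeriv i f := rfl

theorem partialDeriv_comm {f : (Fin m → ℝ) → ℝ} (hf : ContDiff ℝ ((⊤ : ℕ∞) : WithTop ℕ∞) f)
    (i l : Fin m) : partialDeriv i (partialDeriv l f) = partialDeriv l (partialDeriv i f) := by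
  ext x
  have hd : Differentiable ℝ (fderiv ℝ f) :=
    (hf.fderiv_right (m := ((⊤ : ℕ∞) : WithTop ℕ∞)) (by norm_cast)).differentiable (by simp)
  have h : ∀ i l : Fin m, partialDeriv i (partialDeriv l f) x
      = fderiv ℝ (fderiv ℝ f) x (Pi.single i 1) (Pi.single l 1) := fun i l => by
    unfold partialDeriv
    rw [fderiv_clm_apply (hd x) (differentiableAt_const _)]
    simp
  rw [h, h]
  exact (hf.contDiffAt.isSymmSndFDerivAt (by simp; norm_cast)) _ _

theorem partialEnd_commute (i l : Fin m) : Commute (partialEnd i) (partialEnd l) := by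
  refine LinearMap.ext fun f => Subtype.ext ?_
  exact partialDeriv_comm f.2 i l

/-- The mixed derivative as an endomorphism of the space of smooth functions. -/
noncomputable def multiEnd (k : Fin m → ℕ) : Module.End ℝ (smoothFunctions m) :=
  ((List.finRange m).map fun i => partialEnd i ^ k i).prod

theorem coe_partialEnd_pow (i : Fin m) (n : ℕ) (f : smoothFunctions m) :
    ((partialEnd i ^ n) f : (Fin m → ℝ) → ℝ) = (partialDeriv i)^[n] f := by
  induction n with
  | zero => rfl
  | succ n ih => rw [pow_succ', Module.End.mul_apply, coe_partialEnd, ih,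
      Function.iterate_succ_apply']

theorem coe_multiEnd (k : Fin m → ℕ) (f : smoothFunctions m) :
    (multiEnd k f : (Fin m → ℝ) → ℝ) = multiDeriv k f := by
  unfold multiEnd multiDeriv
  induction List.finRange m with
  | nil => rfl
  | cons i l ih =>
    rw [List.map_cons, List.prod_cons, Module.End.mul_apply, List.foldr_cons, ← ih,
      coe_partialEnd_pow]

theorem contDiff_multiDeriv {f : (Fin m → ℝ) → ℝ} (hf : ContDiff ℝ ((⊤ : ℕ∞) : WithTop ℕ∞) f)
    (k : Fin m → ℕ) : ContDiff ℝ ((⊤ : ℕ∞) : WithTop ℕ∞) (multiDeriv k f) := by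
  rw [← coe_multiEnd k ⟨f, hf⟩]
  exact (multiEnd k ⟨f, hf⟩).2

/-- The derivative in direction `v`. -/
noncomputable def dirEnd (v : Fin m → ℝ) : Module.End ℝ (smoothFunctions m) := ∑ i, v i • partialEnd i

theorem coe_dirEnd (v : Fin m → ℝ) (f : smoothFunctions m) (x : Fin m → ℝ) :
    (dirEnd v f : (Fin m → ℝ) → ℝ) x = fderiv ℝ f x v := by
  have : v = ∑ i, v i • (Pi.single i 1 : Fin m → ℝ) := by
    ext l; simp [Pi.single_apply]
  conv_rhs => rw [this, map_sum]
  simp only [map_smul]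
  simp [dirEnd, partialDeriv, Finset.sum_apply, LinearMap.sum_apply]

/-- The multinomial theorem in the algebra of endomorphisms, available because partial derivatives
of smooth functions commute. -/
theorem dirEnd_pow (v : Fin m → ℝ) (n : ℕ) :
    dirEnd v ^ n = ∑ k ∈ Finset.piAntidiag Finset.univ n,
      ((Nat.multinomial Finset.univ k : ℝ) * ∏ i, v i ^ k i) • multiEnd k := by
  unfold dirEnd
  rw [Finset.sum_pow_eq_sum_piAntidiag_of_commute _ _ fun i _ l _ _ =>
    ((partialEnd_commute i l).smul_left _).smul_right _]
  refine Finset.sum_congr rfl fun k _ => ?_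
  -- The product is written along `List.finRange`, the order in which `multiEnd` and `multiDeriv`
  -- differentiate.
  have h1 : ∀ (hc), Finset.noncommProd (Finset.univ : Finset (Fin m))
      (fun i => (v i • partialEnd i) ^ k i) hc = (∏ i, v i ^ k i) • multiEnd k := fun hc => by
    have h2 : ∀ l : List (Fin m), (l.map fun i => (v i • partialEnd i) ^ k i).prod =
        (l.map fun i => v i ^ k i).prod • (l.map fun i => partialEnd i ^ k i).prod := fun l => by
      induction l with
      | nil => simp
      | cons i l ih =>
        rw [List.map_cons, List.prod_cons, ih, smul_pow, smul_mul_smul_comm]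
        simp only [List.map_cons, List.prod_cons]
    have h3 := h2 (List.finRange m)
    rw [← Fin.prod_univ_def] at h3
    rw [multiEnd, ← h3]
    have hc' : ((List.finRange m).toFinset : Set (Fin m)).Pairwise
        (Function.onFun Commute fun i => (v i • partialEnd i) ^ k i) := by
      simpa using hc
    rw [← Finset.noncommProd_toFinset (List.finRange m) _ hc' (List.nodup_finRange m)]
    congr 1
    simp
  rw [h1, ← nsmul_eq_mul, ← Nat.cast_smul_eq_nsmul ℝ, smul_smul]

theorem dirEnd_pow_apply (v : Fin m → ℝ) (n : ℕ) (f : smoothFunctions m) (x : Fin m → ℝ) :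
    ((dirEnd v ^ n) f : (Fin m → ℝ) → ℝ) x = ∑ k ∈ Finset.piAntidiag Finset.univ n,
      ((Nat.multinomial Finset.univ k : ℝ) * ∏ i, v i ^ k i) * multiDeriv k f x := by
  rw [dirEnd_pow, LinearMap.sum_apply]
  simp [Finset.sum_apply, coe_multiEnd]

theorem abs_dirEnd_pow_le (v : Fin m → ℝ) (n : ℕ) (f : smoothFunctions m) (x : Fin m → ℝ) :
    |((dirEnd v ^ n) f : (Fin m → ℝ) → ℝ) x| ≤
      (∑ k ∈ Finset.piAntidiag (Finset.univ : Finset (Fin m)) n,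
        (Nat.multinomial Finset.univ k : ℝ)) * ‖v‖ ^ n *
      ∑ k ∈ Finset.piAntidiag Finset.univ n, |multiDeriv k f x| := by
  rw [dirEnd_pow_apply, Finset.sum_mul, Finset.sum_mul]
  refine (Finset.abs_sum_le_sum_abs _ _).trans (Finset.sum_le_sum fun k hk => ?_)
  rw [abs_mul, abs_mul, Nat.abs_cast]
  have h1 : |∏ i, v i ^ k i| ≤ ‖v‖ ^ n := by
    rw [Finset.abs_prod, ← (Finset.mem_piAntidiag.1 hk).1, ← Finset.prod_pow_eq_pow_sum]
    refine Finset.prod_le_prod (fun _ _ => abs_nonneg _) fun i _ => ?_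
    rw [abs_pow]
    exact pow_le_pow_left₀ (abs_nonneg _) (norm_le_pi_norm v i) _
  have h2 : |multiDeriv k f x| ≤ ∑ k ∈ Finset.piAntidiag Finset.univ n, |multiDeriv k f x| :=
    Finset.single_le_sum (f := fun k => |multiDeriv k (f : (Fin m → ℝ) → ℝ) x|)
      (fun _ _ => abs_nonneg _) hk
  exact mul_le_mul (mul_le_mul_of_nonneg_left h1 (by positivity)) h2 (abs_nonneg _) (by positivity)

/-- The derivative of each Taylor term produces the next term and cancels the previous one, so the
sum telescopes to its top term. Integration over `[0, 1]` yields Taylor's formula, since at `θ = 1`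
only `j = 0` survives. -/
theorem hasDerivAt_taylor (f : smoothFunctions m) (y v : Fin m → ℝ) (s : ℕ) (θ : ℝ) :
    HasDerivAt (fun θ => ∑ j ∈ Finset.range (s + 1), (1 - θ) ^ j / j.factorial *
      ((dirEnd v ^ j) f : (Fin m → ℝ) → ℝ) (y + θ • v))
      ((1 - θ) ^ s / s.factorial * ((dirEnd v ^ (s + 1)) f : (Fin m → ℝ) → ℝ) (y + θ • v)) θ := by
  have hdir : ∀ j, HasDerivAt (fun θ : ℝ => ((dirEnd v ^ j) f : (Fin m → ℝ) → ℝ) (y + θ • v))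
      (((dirEnd v ^ (j + 1)) f : (Fin m → ℝ) → ℝ) (y + θ • v)) θ := fun j => by
    rw [pow_succ', Module.End.mul_apply, coe_dirEnd]
    have h1 : HasDerivAt (fun θ : ℝ => y + θ • v) v θ := by
      simpa using ((hasDerivAt_id θ).smul_const v).const_add y
    exact (differentiable_of_smooth ((dirEnd v ^ j) f).2 _).hasFDerivAt.comp_hasDerivAt θ h1
  induction s with
  | zero => simpa using hdir 0
  | succ s ih =>
    simp only [Finset.sum_range_succ _ (s + 1)]
    have h1 : HasDerivAt (fun θ : ℝ => (1 - θ) ^ (s + 1) / ((s + 1).factorial : ℝ))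
        (-((1 - θ) ^ s / s.factorial)) θ := by
      have h2 := (((hasDerivAt_id θ).const_sub 1).pow (s + 1)).div_const ((s + 1).factorial : ℝ)
      refine h2.congr_deriv ?_
      simp only [Nat.factorial_succ, Nat.cast_mul, id, Nat.add_sub_cancel]
      have : (s.factorial : ℝ) ≠ 0 := by positivity
      have : ((s + 1 : ℕ) : ℝ) ≠ 0 := by positivity
      field_simp
    refine (ih.add (h1.mul (hdir (s + 1)))).congr_deriv ?_
    ring

theorem continuous_dirEnd_pow (f : smoothFunctions m) (s : ℕ) :
    Continuous fun z : (Fin m → ℝ) × (Fin m → ℝ) =>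
      ((dirEnd z.1 ^ s) f : (Fin m → ℝ) → ℝ) z.2 := by
  simp only [dirEnd_pow_apply]
  refine continuous_finsetSum _ fun k _ => ?_
  have := (contDiff_multiDeriv f.2 k).continuous
  fun_prop

theorem taylor_integral (f : smoothFunctions m) (y v : Fin m → ℝ) (s : ℕ) :
    (f : (Fin m → ℝ) → ℝ) (y + v) = ∑ j ∈ Finset.range (s + 1), ((j.factorial : ℝ))⁻¹ *
      ((dirEnd v ^ j) f : (Fin m → ℝ) → ℝ) y +
      ∫ θ in (0 : ℝ)..1, (1 - θ) ^ s / s.factorial *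
        ((dirEnd v ^ (s + 1)) f : (Fin m → ℝ) → ℝ) (y + θ • v) := by
  have hcont : Continuous fun θ : ℝ => (1 - θ) ^ s / s.factorial *
        ((dirEnd v ^ (s + 1)) f : (Fin m → ℝ) → ℝ) (y + θ • v) := by
    have := (differentiable_of_smooth ((dirEnd v ^ (s + 1)) f).2).continuous
    fun_prop
  rw [intervalIntegral.integral_eq_sub_of_hasDerivAt
    (fun θ _ => hasDerivAt_taylor f y v s θ) (hcont.intervalIntegrable _ _)]
  have h1 : ∑ j ∈ Finset.range (s + 1), (1 - (1 : ℝ)) ^ j / j.factorial *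
      ((dirEnd v ^ j) f : (Fin m → ℝ) → ℝ) (y + (1 : ℝ) • v) = (f : (Fin m → ℝ) → ℝ) (y + v) := by
    rw [Finset.sum_range_succ']
    simp
  rw [h1]
  simp

end SmoothFunctions

end SobolevWidths

namespace SobolevWidths

/-! ### Averaged Taylor polynomials and a Morrey-type estimate for smooth functions. -/

section AveragedTaylor

variable {m : ℕ}

/-- Functions given by a real polynomial of total degree at most `n`. -/
def IsPolyFun (n : ℕ) (F : (Fin m → ℝ) → ℝ) : Prop :=
  ∃ P ∈ MvPolynomial.restrictTotalDegree (Fin m) ℝ n, ∀ x, MvPolynomial.eval x P = F x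

theorem IsPolyFun.sum {ι : Type*} {n : ℕ} (t : Finset ι) {F : ι → (Fin m → ℝ) → ℝ}
    (h : ∀ i ∈ t, IsPolyFun n (F i)) : IsPolyFun n fun x => ∑ i ∈ t, F i x := by
  choose! P hP hPF using h
  refine ⟨∑ i ∈ t, P i, Submodule.sum_mem _ hP, fun x => ?_⟩
  rw [map_sum]
  exact Finset.sum_congr rfl fun i hi => hPF i hi x

theorem IsPolyFun.const_mul {n : ℕ} (c : ℝ) {F : (Fin m → ℝ) → ℝ} (h : IsPolyFun n F) :
    IsPolyFun n fun x => c * F x := by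
  obtain ⟨P, hP, hPF⟩ := h
  exact ⟨c • P, Submodule.smul_mem _ _ hP, fun x => by simp [hPF]⟩

theorem isPolyFun_prod_pow {n : ℕ} (a : Fin m → ℕ) (ha : ∑ i, a i ≤ n) (g h : Fin m → ℝ) :
    IsPolyFun n fun x => ∏ i, (g i + h i * x i) ^ a i := by
  refine ⟨∏ i, (MvPolynomial.C (g i) + MvPolynomial.C (h i) * MvPolynomial.X i) ^ a i, ?_,
    fun x => by simp⟩
  rw [MvPolynomial.mem_restrictTotalDegree]
  refine (MvPolynomial.totalDegree_finsetProd _ _).trans ((Finset.sum_le_sum fun i _ => ?_).trans ha)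
  refine (MvPolynomial.totalDegree_pow _ _).trans ?_
  have : (MvPolynomial.C (g i) + MvPolynomial.C (h i) * MvPolynomial.X i :
      MvPolynomial (Fin m) ℝ).totalDegree ≤ 1 := by
    refine (MvPolynomial.totalDegree_add _ _).trans (max_le (by simp) ?_)
    exact (MvPolynomial.totalDegree_mul _ _).trans (by simp)
  nlinarith

theorem IsPolyFun.comp_affine {n : ℕ} {F : (Fin m → ℝ) → ℝ} (hF : IsPolyFun n F)
    (g : Fin m → ℝ) (h : ℝ) : IsPolyFun n fun x => F (g + h • x) := by
  obtain ⟨P, hP, hPF⟩ := hF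
  have : (fun x => F (g + h • x)) = fun x => ∑ d ∈ P.support,
      P.coeff d * ∏ i, (g i + h * x i) ^ d i := by
    ext x
    rw [← hPF, MvPolynomial.eval_eq']
    rfl
  rw [this]
  refine IsPolyFun.sum _ fun d hd => (isPolyFun_prod_pow _ ?_ g fun _ => h).const_mul _
  rw [MvPolynomial.mem_restrictTotalDegree] at hP
  refine le_trans (le_of_eq ?_) ((MvPolynomial.le_totalDegree hd).trans hP)
  rw [Finsupp.sum_fintype _ _ (fun _ => rfl)]

/-- The binomial theorem separates `x` from `y`; the `y`-integrals become coefficients. -/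
theorem isPolyFun_integral {n : ℕ} (k : Fin m → ℕ) (hk : ∑ i, k i ≤ n) {B : Set (Fin m → ℝ)}
    (hB : IsCompact B) {g : (Fin m → ℝ) → ℝ} (hg : Continuous g) :
    IsPolyFun n fun x => ∫ y in B, (∏ i, (x i - y i) ^ k i) * g y := by
  have hexp : ∀ x y : Fin m → ℝ, (∏ i, (x i - y i) ^ k i) * g y =
      ∑ a ∈ Fintype.piFinset fun i => Finset.range (k i + 1),
        (∏ i, (0 + 1 * x i) ^ a i) * ((∏ i, (-y i) ^ (k i - a i) * ((k i).choose (a i) : ℝ)) * g y) := by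
    intro x y
    have hb : ∀ i, (x i - y i) ^ k i = ∑ l ∈ Finset.range (k i + 1),
        (0 + 1 * x i) ^ l * ((-y i) ^ (k i - l) * ((k i).choose l : ℝ)) := fun i => by
      rw [sub_eq_add_neg, add_pow]
      simp only [zero_add, one_mul, mul_assoc]
    simp only [hb]
    rw [Finset.prod_univ_sum, Finset.sum_mul]
    refine Finset.sum_congr rfl fun a _ => ?_
    rw [← mul_assoc, ← Finset.prod_mul_distrib]
  have : (fun x : Fin m → ℝ => ∫ y in B, (∏ i, (x i - y i) ^ k i) * g y) = fun x =>
      ∑ a ∈ Fintype.piFinset fun i => Finset.range (k i + 1),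
        (∫ y in B, (∏ i, (-y i) ^ (k i - a i) * ((k i).choose (a i) : ℝ)) * g y) *
          ∏ i, (0 + 1 * x i) ^ a i := by
    ext x
    simp only [hexp]
    rw [integral_finsetSum]
    · refine Finset.sum_congr rfl fun a _ => ?_
      rw [integral_const_mul, mul_comm]
    · intro a _
      refine Continuous.continuousOn (by fun_prop) |>.integrableOn_compact hB
  rw [this]
  refine IsPolyFun.sum _ fun a ha => (isPolyFun_prod_pow a ?_ _ _).const_mul _
  refine (Finset.sum_le_sum fun i _ => ?_).trans hk
  have := Fintype.mem_piFinset.1 ha i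
  rw [Finset.mem_range] at this
  lia

/-- The Taylor polynomial at `y` is averaged over `y` because only integrals of the derivatives over
small balls will be controlled, not their values at a point. -/
theorem isPolyFun_averagedTaylor (f : smoothFunctions m) (s : ℕ) {B : Set (Fin m → ℝ)}
    (hB : IsCompact B) :
    IsPolyFun s fun x => ∫ y in B, ∑ j ∈ Finset.range (s + 1), ((j.factorial : ℝ))⁻¹ *
      ((dirEnd (x - y) ^ j) f : (Fin m → ℝ) → ℝ) y := by
  have hc : ∀ k, Continuous (multiDeriv k (f : (Fin m → ℝ) → ℝ)) :=
    fun k => (contDiff_multiDeriv f.2 k).continuous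
  have : (fun x => ∫ y in B, ∑ j ∈ Finset.range (s + 1), ((j.factorial : ℝ))⁻¹ *
      ((dirEnd (x - y) ^ j) f : (Fin m → ℝ) → ℝ) y) = fun x =>
      ∑ j ∈ Finset.range (s + 1), ((j.factorial : ℝ))⁻¹ *
        ∑ k ∈ Finset.piAntidiag Finset.univ j, (Nat.multinomial Finset.univ k : ℝ) *
          ∫ y in B, (∏ i, (x i - y i) ^ k i) * multiDeriv k (f : (Fin m → ℝ) → ℝ) y := by
    ext x
    simp only [dirEnd_pow_apply, Pi.sub_apply]
    have hint : ∀ k, IntegrableOn (fun y => (∏ i, (x i - y i) ^ k i) *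
        multiDeriv k (f : (Fin m → ℝ) → ℝ) y) B := fun k => by
      have := hc k
      exact Continuous.continuousOn (by fun_prop) |>.integrableOn_compact hB
    have hint' : ∀ k, IntegrableOn (fun y => (Nat.multinomial Finset.univ k : ℝ) *
        (∏ i, (x i - y i) ^ k i) * multiDeriv k (f : (Fin m → ℝ) → ℝ) y) B := fun k => by
      simp only [mul_assoc]
      exact (hint k).const_mul _
    rw [integral_finsetSum]
    · refine Finset.sum_congr rfl fun j _ => ?_
      rw [integral_const_mul, integral_finsetSum _ fun k _ => hint' k]
      congr 1
      refine Finset.sum_congr rfl fun k _ => ?_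
      simp only [mul_assoc]
      rw [integral_const_mul]
    · intro j _
      exact (integrable_finsetSum _ fun k _ => hint' k).const_mul _
  rw [this]
  refine IsPolyFun.sum _ fun j hj => IsPolyFun.const_mul _ (IsPolyFun.sum _ fun k hk =>
    IsPolyFun.const_mul _ (isPolyFun_integral k ?_ hB (hc k)))
  rw [(Finset.mem_piAntidiag.1 hk).1]
  rw [Finset.mem_range] at hj
  lia

theorem lintegral_closedBall_homothety {g : (Fin m → ℝ) → ℝ≥0∞} (hg : Measurable g)
    {a : ℝ} (ha : 0 < a) (b c : Fin m → ℝ) (r : ℝ) :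
    ∫⁻ y in Metric.closedBall c r, g (a • y + b) =
      ENNReal.ofReal ((a ^ m)⁻¹) * ∫⁻ z in Metric.closedBall (a • c + b) (a * r), g z := by
  have hT : Measurable fun y : Fin m → ℝ => a • y + b := by fun_prop
  have hmap : Measure.map (fun y : Fin m → ℝ => a • y + b) volume =
      ENNReal.ofReal ((a ^ m)⁻¹) • volume := by
    have h1 : (fun y : Fin m → ℝ => a • y + b) = (fun y => y + b) ∘ fun y => a • y := rfl
    rw [h1, ← Measure.map_map (by fun_prop) (by fun_prop), Measure.map_addHaar_smul _ ha.ne',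
      Measure.map_smul, map_add_right_eq_self, Module.finrank_fin_fun,
      abs_of_pos (by positivity)]
  have hpre : (fun y : Fin m → ℝ => a • y + b) ⁻¹' Metric.closedBall (a • c + b) (a * r) =
      Metric.closedBall c r := by
    ext y
    simp only [Set.mem_preimage, Metric.mem_closedBall, dist_add_right, dist_smul₀,
      Real.norm_of_nonneg ha.le]
    exact mul_le_mul_iff_right₀ ha
  rw [← hpre, ← setLIntegral_map measurableSet_closedBall hg hT, hmap,
    Measure.restrict_smul, lintegral_smul_measure, smul_eq_mul]

theorem lintegral_one_sub_rpow {β : ℝ} (hβ : -1 < β) :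
    ∫⁻ θ in Set.Ioo (0 : ℝ) 1, ENNReal.ofReal ((1 - θ) ^ β) = ENNReal.ofReal (1 / (β + 1)) := by
  have hint : IntervalIntegrable (fun θ : ℝ => (1 - θ) ^ β) volume 0 1 := by
    have := ((intervalIntegral.intervalIntegrable_rpow' (a := 0) (b := 1) hβ).comp_sub_left 1).symm
    simpa using this
  have hval : ∫ θ in (0 : ℝ)..1, (1 - θ) ^ β = 1 / (β + 1) := by
    rw [intervalIntegral.integral_comp_sub_left (fun x => x ^ β) 1]
    rw [sub_self, sub_zero, integral_rpow (Or.inl hβ)]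
    rw [Real.one_rpow, Real.zero_rpow (by linarith), sub_zero]
  have hint' : IntegrableOn (fun θ : ℝ => (1 - θ) ^ β) (Set.Ioo 0 1) :=
    ((intervalIntegrable_iff_integrableOn_Ioc_of_le zero_le_one).1 hint).mono_set
      Set.Ioo_subset_Ioc_self
  rw [← hval, intervalIntegral.integral_of_le zero_le_one, integral_Ioc_eq_integral_Ioo,
    ofReal_integral_eq_lintegral_ofReal hint']
  refine (ae_restrict_iff' measurableSet_Ioo).2 (Eventually.of_forall fun θ hθ => ?_)
  exact Real.rpow_nonneg (by linarith [hθ.2]) _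

/-- The constant in the pointwise estimate for the averaged Taylor polynomial. -/
noncomputable def taylorConst (m s : ℕ) (α : ℝ) : ℝ :=
  (∑ k ∈ Finset.piAntidiag (Finset.univ : Finset (Fin m)) (s + 1),
    (Nat.multinomial Finset.univ k : ℝ)) * 2 ^ (s + 1) / 2 ^ m / (s + 1 - α)

theorem taylorConst_nonneg {s : ℕ} {α : ℝ} (hα : α < s + 1) : 0 ≤ taylorConst m s α := by
  have : 0 < (s : ℝ) + 1 - α := by linarith
  unfold taylorConst
  positivity

/-- After Tonelli, fix `θ`. The map `y ↦ (1 - θ) y + θ x` carries the ball onto one of radius `(1 -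
θ) r`, still inside by convexity, and contributes the Jacobian factor `(1 - θ)^{-m}`. The growth
hypothesis supplies `(1 - θ)^{m - α}` and the remainder kernel `(1 - θ)^s`. The resulting power `(1
- θ)^{s - α}` is integrable exactly because `α < s + 1`. -/
theorem lintegral_taylor_remainder_le (f : smoothFunctions m) (s : ℕ) (c : Fin m → ℝ) {r : ℝ}
    (hr : 0 < r) {α K : ℝ} (hα : α < s + 1) (hK : 0 ≤ K)
    (hM : ∀ z ϱ, 0 < ϱ → Metric.closedBall z ϱ ⊆ Metric.closedBall c r →
      ∫⁻ y in Metric.closedBall z ϱ, ENNReal.ofReal (∑ k ∈ Finset.piAntidiag Finset.univ (s + 1),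
        |multiDeriv k (f : (Fin m → ℝ) → ℝ) y|) ≤ ENNReal.ofReal (K * ϱ ^ ((m : ℝ) - α)))
    {x : Fin m → ℝ} (hx : x ∈ Metric.closedBall c r) :
    ∫⁻ y in Metric.closedBall c r, ‖∫ θ in (0 : ℝ)..1, (1 - θ) ^ s / s.factorial *
        ((dirEnd (x - y) ^ (s + 1)) f : (Fin m → ℝ) → ℝ) (y + θ • (x - y))‖ₑ ≤
      ENNReal.ofReal ((2 * r) ^ m * (taylorConst m s α * K * r ^ ((s : ℝ) + 1 - α))) := by
  set G : (Fin m → ℝ) → ℝ := fun y => ∑ k ∈ Finset.piAntidiag Finset.univ (s + 1),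
        |multiDeriv k (f : (Fin m → ℝ) → ℝ) y| with hG
  set C₀ : ℝ := ∑ k ∈ Finset.piAntidiag (Finset.univ : Finset (Fin m)) (s + 1),
    (Nat.multinomial Finset.univ k : ℝ) with hC₀
  have hC₀0 : 0 ≤ C₀ := by positivity
  have hGc : Continuous G := by
    refine continuous_finsetSum _ fun k _ => (contDiff_multiDeriv f.2 k).continuous.abs
  have hG0 : ∀ y, 0 ≤ G y := fun y => Finset.sum_nonneg fun _ _ => abs_nonneg _
  -- Bounds the directional derivatives of order `s + 1`: two points of the ball are at distance at
  -- most `2 r`.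
  set A : ℝ := C₀ * (2 * r) ^ (s + 1) with hA
  have hA0 : 0 ≤ A := by positivity
  have hpt : ∀ y ∈ Metric.closedBall c r, ‖∫ θ in (0 : ℝ)..1, (1 - θ) ^ s / s.factorial *
        ((dirEnd (x - y) ^ (s + 1)) f : (Fin m → ℝ) → ℝ) (y + θ • (x - y))‖ₑ ≤
      ∫⁻ θ in Set.Ioo (0 : ℝ) 1, ENNReal.ofReal ((1 - θ) ^ s * A) *
        ENNReal.ofReal (G ((1 - θ) • y + θ • x)) := by
    intro y hy
    rw [intervalIntegral.integral_of_le zero_le_one, integral_Ioc_eq_integral_Ioo]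
    refine (enorm_integral_le_lintegral_enorm _).trans ?_
    refine setLIntegral_mono' measurableSet_Ioo fun θ hθ => ?_
    have h1 : 0 ≤ 1 - θ := by linarith [hθ.2]
    rw [← ENNReal.ofReal_mul (by positivity), ← ofReal_norm]
    refine ENNReal.ofReal_le_ofReal ?_
    have hz : y + θ • (x - y) = (1 - θ) • y + θ • x := by
      rw [smul_sub, sub_smul, one_smul]; abel
    rw [Real.norm_eq_abs, abs_mul, hz]
    have h2 : |(1 - θ) ^ s / s.factorial| ≤ (1 - θ) ^ s := by
      rw [abs_of_nonneg (by positivity)]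
      exact div_le_self (by positivity) (by exact_mod_cast Nat.one_le_iff_ne_zero.2 s.factorial_ne_zero)
    have h3 := abs_dirEnd_pow_le (x - y) (s + 1) f ((1 - θ) • y + θ • x)
    have h4 : ‖x - y‖ ≤ 2 * r := by
      rw [← dist_eq_norm]
      have := dist_triangle_right x y c
      rw [Metric.mem_closedBall] at hx hy
      linarith
    rw [mul_assoc]
    refine mul_le_mul h2 (h3.trans ?_) (abs_nonneg _) (by positivity)
    refine mul_le_mul_of_nonneg_right ?_ (hG0 _)
    exact mul_le_mul_of_nonneg_left (pow_le_pow_left₀ (norm_nonneg _) h4 _) hC₀0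
  refine (setLIntegral_mono' measurableSet_closedBall hpt).trans ?_
  rw [lintegral_lintegral_swap]
  swap
  · refine Measurable.aemeasurable ?_
    refine (ENNReal.measurable_ofReal.comp ?_).mul (ENNReal.measurable_ofReal.comp ?_)
    · exact Continuous.measurable (by fun_prop)
    · exact Continuous.measurable (by fun_prop)
  have hin : ∀ θ ∈ Set.Ioo (0 : ℝ) 1, ∫⁻ y in Metric.closedBall c r,
      ENNReal.ofReal ((1 - θ) ^ s * A) * ENNReal.ofReal (G ((1 - θ) • y + θ • x)) ≤
      ENNReal.ofReal (A * K * r ^ ((m : ℝ) - α)) * ENNReal.ofReal ((1 - θ) ^ ((s : ℝ) - α)) := by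
    intro θ hθ
    have h1 : 0 < 1 - θ := by linarith [hθ.2]
    have hGm : Measurable fun y => ENNReal.ofReal (G y) :=
      ENNReal.measurable_ofReal.comp hGc.measurable
    rw [lintegral_const_mul _ (by
      exact hGm.comp (by fun_prop : Measurable fun y : Fin m → ℝ => (1 - θ) • y + θ • x))]
    rw [lintegral_closedBall_homothety hGm h1 (θ • x) c r]
    have hsub : Metric.closedBall ((1 - θ) • c + θ • x) ((1 - θ) * r) ⊆ Metric.closedBall c r := by
      refine Metric.closedBall_subset_closedBall' ?_
      have h5 : dist ((1 - θ) • c + θ • x) c = θ * dist x c := by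
        rw [dist_eq_norm, dist_eq_norm, show (1 - θ) • c + θ • x - c = θ • (x - c) by
          rw [sub_smul, smul_sub, one_smul]; abel, norm_smul, Real.norm_of_nonneg hθ.1.le]
      rw [h5]
      have := Metric.mem_closedBall.1 hx
      nlinarith [hθ.1]
    refine (mul_le_mul' le_rfl (mul_le_mul' le_rfl (hM _ _ (by positivity) hsub))).trans ?_
    rw [← ENNReal.ofReal_mul (by positivity), ← ENNReal.ofReal_mul (by positivity),
      ← ENNReal.ofReal_mul (by positivity)]
    refine ENNReal.ofReal_le_ofReal (le_of_eq ?_)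
    rw [Real.mul_rpow h1.le hr.le, show (1 - θ) ^ ((s : ℝ) - α) =
      (1 - θ) ^ s * ((1 - θ) ^ m)⁻¹ * (1 - θ) ^ ((m : ℝ) - α) by
        rw [← Real.rpow_natCast, ← Real.rpow_natCast, ← Real.rpow_neg h1.le, ← Real.rpow_add h1,
          ← Real.rpow_add h1]
        congr 1; ring]
    ring
  refine (setLIntegral_mono' measurableSet_Ioo hin).trans ?_
  rw [lintegral_const_mul _ (by fun_prop), lintegral_one_sub_rpow (by linarith),
    ← ENNReal.ofReal_mul (by positivity)]
  refine ENNReal.ofReal_le_ofReal (le_of_eq ?_)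
  have h6 : (0 : ℝ) < s + 1 - α := by linarith
  -- The volume `(2 r)^m` of the ball is split off, whence the factor `1 / 2^m` in `taylorConst`.
  have h7 : r ^ ((m : ℝ) - α) * r ^ (s + 1) = r ^ m * r ^ ((s : ℝ) + 1 - α) := by
    rw [← Real.rpow_natCast, ← Real.rpow_natCast, ← Real.rpow_add hr, ← Real.rpow_add hr]
    congr 1; push_cast; ring
  rw [hA, taylorConst, ← hC₀, mul_pow, mul_pow]
  have h8 : (s : ℝ) - α + 1 = s + 1 - α := by ring
  rw [h8]
  field_simp
  linear_combination C₀ * K * h7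

/-- Averaging Taylor's formula at `x` over the base point `y` expresses `f x - P x` as the mean of
the remainders; dividing by the volume cancels the factor `(2 r)^m`. -/
theorem exists_poly_approx_of_smooth (f : smoothFunctions m) (s : ℕ) (c : Fin m → ℝ) {r : ℝ}
    (hr : 0 < r) {α K : ℝ} (hα : α < s + 1) (hK : 0 ≤ K)
    (hM : ∀ z ϱ, 0 < ϱ → Metric.closedBall z ϱ ⊆ Metric.closedBall c r →
      ∫⁻ y in Metric.closedBall z ϱ, ENNReal.ofReal (∑ k ∈ Finset.piAntidiag Finset.univ (s + 1),
        |multiDeriv k (f : (Fin m → ℝ) → ℝ) y|) ≤ ENNReal.ofReal (K * ϱ ^ ((m : ℝ) - α))) :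
    ∃ P, IsPolyFun s P ∧ ∀ x ∈ Metric.closedBall c r,
      |(f : (Fin m → ℝ) → ℝ) x - P x| ≤ taylorConst m s α * K * r ^ ((s : ℝ) + 1 - α) := by
  set B := Metric.closedBall c r
  have hB : IsCompact B := isCompact_closedBall c r
  have hvol : volume.real B = (2 * r) ^ m := by
    rw [measureReal_def, Real.volume_pi_closedBall _ hr.le]
    simp [hr.le]
  have hv0 : 0 < volume.real B := by rw [hvol]; positivity
  refine ⟨_, (isPolyFun_averagedTaylor f s hB).const_mul (volume.real B)⁻¹, fun x hx => ?_⟩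
  have hTc : Continuous fun y => ∑ j ∈ Finset.range (s + 1), ((j.factorial : ℝ))⁻¹ *
      ((dirEnd (x - y) ^ j) f : (Fin m → ℝ) → ℝ) y := by
    refine continuous_finsetSum _ fun j _ => continuous_const.mul ?_
    exact (continuous_dirEnd_pow f j).comp (f := fun y => (x - y, y)) (by fun_prop)
  have hR : ∀ y, ∫ θ in (0 : ℝ)..1, (1 - θ) ^ s / s.factorial *
        ((dirEnd (x - y) ^ (s + 1)) f : (Fin m → ℝ) → ℝ) (y + θ • (x - y)) =
      (f : (Fin m → ℝ) → ℝ) x - ∑ j ∈ Finset.range (s + 1), ((j.factorial : ℝ))⁻¹ *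
      ((dirEnd (x - y) ^ j) f : (Fin m → ℝ) → ℝ) y := fun y => by
    have := taylor_integral f y (x - y) s
    rw [add_sub_cancel] at this
    rw [this]; ring
  have hle := lintegral_taylor_remainder_le f s c hr hα hK hM hx
  simp only [hR] at hle
  have hI : (f : (Fin m → ℝ) → ℝ) x - (volume.real B)⁻¹ * ∫ y in B, ∑ j ∈ Finset.range (s + 1),
      ((j.factorial : ℝ))⁻¹ * ((dirEnd (x - y) ^ j) f : (Fin m → ℝ) → ℝ) y =
      (volume.real B)⁻¹ * ∫ y in B, ((f : (Fin m → ℝ) → ℝ) x - ∑ j ∈ Finset.range (s + 1),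
      ((j.factorial : ℝ))⁻¹ * ((dirEnd (x - y) ^ j) f : (Fin m → ℝ) → ℝ) y) := by
    rw [integral_sub (continuous_const.continuousOn.integrableOn_compact hB)
      (hTc.continuousOn.integrableOn_compact hB), setIntegral_const, smul_eq_mul]
    field_simp
  rw [hI, abs_mul, abs_of_pos (inv_pos.2 hv0), inv_mul_le_iff₀ hv0, hvol]
  have h1 := (enorm_integral_le_lintegral_enorm (μ := volume.restrict B) _).trans hle
  rw [← ofReal_norm, Real.norm_eq_abs] at h1
  have hT := taylorConst_nonneg (m := m) hα
  exact (ENNReal.ofReal_le_ofReal_iff (by positivity)).1 h1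

end AveragedTaylor

end SobolevWidths

namespace SobolevWidths

/-! ### Transfer of the estimate to Sobolev functions by mollification. -/

section Mollification

variable {m : ℕ}

theorem contDiff_iterate_partialDeriv {f : (Fin m → ℝ) → ℝ}
    (hf : ContDiff ℝ ((⊤ : ℕ∞) : WithTop ℕ∞) f) (i : Fin m) (n : ℕ) :
    ContDiff ℝ ((⊤ : ℕ∞) : WithTop ℕ∞) ((partialDeriv i)^[n] f) := by
  rw [← coe_partialEnd_pow i n ⟨f, hf⟩]
  exact ((partialEnd i ^ n) ⟨f, hf⟩).2

theorem contDiff_foldr_partialDeriv {f : (Fin m → ℝ) → ℝ}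
    (hf : ContDiff ℝ ((⊤ : ℕ∞) : WithTop ℕ∞) f) (k : Fin m → ℕ) (l : List (Fin m)) :
    ContDiff ℝ ((⊤ : ℕ∞) : WithTop ℕ∞) (l.foldr (fun i ψ => (partialDeriv i)^[k i] ψ) f) := by
  induction l with
  | nil => exact hf
  | cons i l ih => exact contDiff_iterate_partialDeriv ih i _

theorem iterate_partialDeriv_reflect (a : Fin m → ℝ) (i : Fin m) (n : ℕ) (c : ℝ)
    {φ : (Fin m → ℝ) → ℝ} (hφ : ContDiff ℝ ((⊤ : ℕ∞) : WithTop ℕ∞) φ) :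
    (partialDeriv i)^[n] (fun x => c * φ (a - x)) =
      fun x => (c * (-1) ^ n) * (partialDeriv i)^[n] φ (a - x) := by
  induction n generalizing c φ with
  | zero => simp
  | succ n ih =>
    have h1 : partialDeriv i (fun x => c * φ (a - x)) =
        fun x => (c * (-1)) * partialDeriv i φ (a - x) := by
      ext x
      have h2 : HasFDerivAt (fun x : Fin m → ℝ => a - x) (-ContinuousLinearMap.id ℝ _) x :=
        (hasFDerivAt_id x).const_sub a
      have h3 := ((differentiable_of_smooth hφ (a - x)).hasFDerivAt.comp x h2).const_mul c
      have h4 : fderiv ℝ (fun x => c * φ (a - x)) x = _ := h3.fderiv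
      simp [partialDeriv, h4]
    rw [Function.iterate_succ_apply, h1, ih _ (contDiff_partialDeriv hφ i)]
    ext x
    rw [Function.iterate_succ_apply, pow_succ]
    ring

/-- Reflection turns a mollifier into a test function; the sign it creates cancels the one in the
definition of the weak derivative. -/
theorem multiDeriv_reflect (a : Fin m → ℝ) (k : Fin m → ℕ) {φ : (Fin m → ℝ) → ℝ}
    (hφ : ContDiff ℝ ((⊤ : ℕ∞) : WithTop ℕ∞) φ) :
    multiDeriv k (fun x => φ (a - x)) = fun x => (-1) ^ (∑ i, k i) * multiDeriv k φ (a - x) := by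
  have h : ∀ l : List (Fin m), l.foldr (fun i ψ => (partialDeriv i)^[k i] ψ) (fun x => φ (a - x)) =
      fun x => (-1) ^ (l.map k).sum * l.foldr (fun i ψ => (partialDeriv i)^[k i] ψ) φ (a - x) := by
    intro l
    induction l with
    | nil => simp
    | cons i l ih =>
      rw [List.foldr_cons, ih,
        iterate_partialDeriv_reflect _ _ _ _ (contDiff_foldr_partialDeriv hφ k l)]
      ext x
      rw [List.map_cons, List.sum_cons, pow_add, List.foldr_cons]
      ring
  rw [multiDeriv, h, Fin.sum_univ_def]
  rfl

theorem hasCompactSupport_partialDeriv {φ : (Fin m → ℝ) → ℝ} (h : HasCompactSupport φ)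
    (i : Fin m) : HasCompactSupport (partialDeriv i φ) := h.fderiv_apply ℝ _

theorem hasCompactSupport_iterate_partialDeriv {φ : (Fin m → ℝ) → ℝ} (h : HasCompactSupport φ)
    (i : Fin m) (n : ℕ) : HasCompactSupport ((partialDeriv i)^[n] φ) := by
  induction n with
  | zero => exact h
  | succ n ih => rw [Function.iterate_succ_apply']; exact hasCompactSupport_partialDeriv ih i

theorem hasCompactSupport_foldr_partialDeriv {φ : (Fin m → ℝ) → ℝ} (h : HasCompactSupport φ)
    (k : Fin m → ℕ) (l : List (Fin m)) :
    HasCompactSupport (l.foldr (fun i ψ => (partialDeriv i)^[k i] ψ) φ) := by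
  induction l with
  | nil => exact h
  | cons i l ih => exact hasCompactSupport_iterate_partialDeriv ih i _

theorem partialDeriv_convolution {g φ : (Fin m → ℝ) → ℝ} (hg : LocallyIntegrable g)
    (hφ : ContDiff ℝ ((⊤ : ℕ∞) : WithTop ℕ∞) φ) (hc : HasCompactSupport φ) (i : Fin m) :
    partialDeriv i (convolution g φ (ContinuousLinearMap.lsmul ℝ ℝ) volume) =
      convolution g (partialDeriv i φ) (ContinuousLinearMap.lsmul ℝ ℝ) volume := by
  ext x
  have hφ1 : ContDiff ℝ 1 φ := hφ.of_le (by exact_mod_cast le_top)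
  rw [partialDeriv, (hc.hasFDerivAt_convolution_right _ hg hφ1 x).fderiv,
    convolution_precompR_apply _ hg (hc.fderiv ℝ) (hφ1.continuous_fderiv one_ne_zero)]
  rfl

theorem iterate_partialDeriv_convolution {g φ : (Fin m → ℝ) → ℝ} (hg : LocallyIntegrable g)
    (hφ : ContDiff ℝ ((⊤ : ℕ∞) : WithTop ℕ∞) φ) (hc : HasCompactSupport φ) (i : Fin m) (n : ℕ) :
    (partialDeriv i)^[n] (convolution g φ (ContinuousLinearMap.lsmul ℝ ℝ) volume) =
      convolution g ((partialDeriv i)^[n] φ) (ContinuousLinearMap.lsmul ℝ ℝ) volume := by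
  induction n with
  | zero => rfl
  | succ n ih =>
    rw [Function.iterate_succ_apply', ih, Function.iterate_succ_apply', partialDeriv_convolution hg
      (contDiff_iterate_partialDeriv hφ i n) (hasCompactSupport_iterate_partialDeriv hc i n)]

theorem multiDeriv_convolution {g φ : (Fin m → ℝ) → ℝ} (hg : LocallyIntegrable g)
    (hφ : ContDiff ℝ ((⊤ : ℕ∞) : WithTop ℕ∞) φ) (hc : HasCompactSupport φ) (k : Fin m → ℕ) :
    multiDeriv k (convolution g φ (ContinuousLinearMap.lsmul ℝ ℝ) volume) =
      convolution g (multiDeriv k φ) (ContinuousLinearMap.lsmul ℝ ℝ) volume := by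
  unfold multiDeriv
  induction List.finRange m with
  | nil => rfl
  | cons i l ih =>
    rw [List.foldr_cons, ih, iterate_partialDeriv_convolution hg
      (contDiff_foldr_partialDeriv hφ k l) (hasCompactSupport_foldr_partialDeriv hc k l)]
    rfl

theorem isOpen_openCube : IsOpen (openCube m) := isOpen_set_pi Set.finite_univ fun _ _ => isOpen_Ioo

theorem measurableSet_openCube : MeasurableSet (openCube m) := isOpen_openCube.measurableSet

theorem isCompact_closedCube : IsCompact (closedCube m) := isCompact_univ_pi fun _ => isCompact_Icc

theorem openCube_subset_closedCube : openCube m ⊆ closedCube m :=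
  Set.pi_mono fun _ _ => Set.Ioo_subset_Icc_self

/-- All derivatives fall on the kernel, and `t ↦ η (y - t)` is an admissible test function because
its support stays inside the cube. Extending `f` by zero may destroy weak differentiability across
the boundary, but at such `y` this is not seen. -/
theorem multiDeriv_mollify {p : ℝ≥0∞} {k : Fin m → ℕ} {f g η : (Fin m → ℝ) → ℝ}
    (hf : IntegrableOn f (openCube m)) (hfg : IsWeakDerivLp p k f g)
    (hη : ContDiff ℝ ((⊤ : ℕ∞) : WithTop ℕ∞) η) {ε : ℝ}
    (hsupp : Function.support η ⊆ Metric.closedBall 0 ε) {y : Fin m → ℝ}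
    (hy : Metric.closedBall y ε ⊆ openCube m) :
    multiDeriv k (convolution ((openCube m).indicator f) η (ContinuousLinearMap.lsmul ℝ ℝ) volume) y
      = ∫ t, g t * η (y - t) ∂(cubeMeasure m) := by
  have hc : HasCompactSupport η := HasCompactSupport.intro (isCompact_closedBall 0 ε) fun x hx => by
    by_contra h
    exact hx (hsupp h)
  have hloc : LocallyIntegrable ((openCube m).indicator f) :=
    ((integrable_indicator_iff measurableSet_openCube).2 hf).locallyIntegrable
  have hsub : Function.support (fun t => η (y - t)) ⊆ Metric.closedBall y ε := fun t ht => by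
    have := hsupp (show y - t ∈ Function.support η from ht)
    rw [Metric.mem_closedBall, dist_zero_right] at this
    rwa [Metric.mem_closedBall, dist_comm, dist_eq_norm]
  have htest : IsTestFunction (fun t => η (y - t)) := by
    refine ⟨hη.comp (contDiff_const.sub contDiff_id), ?_, ?_⟩
    · refine HasCompactSupport.intro (isCompact_closedBall y ε) fun x hx => ?_
      by_contra h
      exact hx (hsub h)
    · exact (closure_minimal hsub Metric.isClosed_closedBall).trans hy
  have h1 := hfg.2 _ htest
  rw [multiDeriv_reflect y k hη] at h1
  rw [multiDeriv_convolution hloc hη hc, convolution_def]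
  have h2 : ∫ t, (ContinuousLinearMap.lsmul ℝ ℝ) ((openCube m).indicator f t)
      (multiDeriv k η (y - t)) = ∫ t, f t * multiDeriv k η (y - t) ∂(cubeMeasure m) := by
    rw [cubeMeasure, ← integral_indicator measurableSet_openCube]
    congr 1
    ext t
    by_cases ht : t ∈ openCube m <;> simp [ht]
  rw [h2]
  have h3 : ∀ t, f t * ((-1) ^ (∑ i, k i) * multiDeriv k η (y - t)) =
      (-1) ^ (∑ i, k i) * (f t * multiDeriv k η (y - t)) := fun t => by ring
  simp only [h3] at h1
  rw [integral_const_mul] at h1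
  exact mul_left_cancel₀ (by simp) h1

theorem MemSobolev.isWeakDerivLp {s : ℕ} {p : ℝ≥0∞} {f : (Fin m → ℝ) → ℝ} (hf : MemSobolev s p f)
    {k : Fin m → ℕ} (hk : ∑ i, k i ≤ s) : IsWeakDerivLp p k f (weakDeriv p k f) := by
  have h := hf.2 k hk
  rw [weakDeriv, dif_pos h]
  exact h.choose_spec

theorem abs_weakDeriv_le_gradNorm {s : ℕ} {p : ℝ≥0∞} {f : (Fin m → ℝ) → ℝ} {k : Fin m → ℕ}
    (hk : k ∈ Finset.piAntidiag Finset.univ s) (x : Fin m → ℝ) :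
    |weakDeriv p k f x| ≤ gradNorm s p f x := by
  refine Real.abs_le_sqrt ?_
  rw [← sq_abs]
  exact Finset.single_le_sum (f := fun k => |weakDeriv p k f x| ^ 2) (fun _ _ => by positivity) hk

theorem gradNorm_nonneg (s : ℕ) (p : ℝ≥0∞) (f : (Fin m → ℝ) → ℝ) (x : Fin m → ℝ) :
    0 ≤ gradNorm s p f x := Real.sqrt_nonneg _

theorem MemSobolev.aestronglyMeasurable_gradNorm {s : ℕ} {p : ℝ≥0∞} {f : (Fin m → ℝ) → ℝ}
    (hf : MemSobolev s p f) : AEStronglyMeasurable (gradNorm s p f) (cubeMeasure m) := by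
  refine Real.continuous_sqrt.comp_aestronglyMeasurable ?_
  refine Finset.aestronglyMeasurable_fun_sum _ fun k hk => ?_
  have h := (hf.isWeakDerivLp (k := k) (Finset.mem_piAntidiag.1 hk).1.le).1.1
  simp only [sq_abs]
  exact h.pow 2

theorem ofReal_sum_multiDeriv_mollify_le {s : ℕ} {p : ℝ≥0∞} {f η : (Fin m → ℝ) → ℝ}
    (hf : IntegrableOn f (openCube m)) (hfs : MemSobolev s p f)
    (hη : ContDiff ℝ ((⊤ : ℕ∞) : WithTop ℕ∞) η) (hη0 : ∀ x, 0 ≤ η x) {ε : ℝ}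
    (hsupp : Function.support η ⊆ Metric.closedBall 0 ε) {y : Fin m → ℝ}
    (hy : Metric.closedBall y ε ⊆ openCube m) :
    ENNReal.ofReal (∑ k ∈ Finset.piAntidiag Finset.univ s, |multiDeriv k
      (convolution ((openCube m).indicator f) η (ContinuousLinearMap.lsmul ℝ ℝ) volume) y|) ≤
      ((Finset.piAntidiag (Finset.univ : Finset (Fin m)) s).card : ℝ≥0∞) *
        ∫⁻ t, ENNReal.ofReal (gradNorm s p f t) * ENNReal.ofReal (η (y - t)) ∂(cubeMeasure m) := by
  rw [ENNReal.ofReal_sum_of_nonneg fun _ _ => abs_nonneg _, ← nsmul_eq_mul]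
  refine Finset.sum_le_card_nsmul _ _ _ fun k hk => ?_
  rw [multiDeriv_mollify hf (hfs.isWeakDerivLp (Finset.mem_piAntidiag.1 hk).1.le) hη hsupp hy,
    ← Real.norm_eq_abs, ofReal_norm]
  refine (enorm_integral_le_lintegral_enorm _).trans (lintegral_mono fun t => ?_)
  rw [enorm_mul, Real.enorm_eq_ofReal (hη0 _)]
  refine mul_le_mul' ?_ le_rfl
  rw [← ofReal_norm, Real.norm_eq_abs]
  exact ENNReal.ofReal_le_ofReal (abs_weakDeriv_le_gradNorm hk t)

/-- Hölder's inequality on a ball of volume `(2 ϱ)^m`: this is the growth condition with `α = m /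
p`, and `ϱ̂ > 0` is precisely `α < s`, the requirement of the Taylor estimate. -/
theorem lintegral_gradNorm_le {s : ℕ} {p : ℝ≥0∞} [hp : Fact (1 ≤ p)] {f : (Fin m → ℝ) → ℝ}
    (hfs : MemSobolev s p f) (hfin : eLpNorm (gradNorm s p f) p (cubeMeasure m) ≠ ∞)
    {c : Fin m → ℝ} {r : ℝ} (hcr : Metric.ball c r ⊆ openCube m) {z : Fin m → ℝ} {ϱ : ℝ}
    (hϱ : 0 < ϱ) (hz : Metric.closedBall z ϱ ⊆ Metric.ball c r) :
    ∫⁻ t in Metric.closedBall z ϱ, ENNReal.ofReal (gradNorm s p f t) ≤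
      ENNReal.ofReal ((eLpNorm (gradNorm s p f) p (volume.restrict (Metric.ball c r))).toReal *
        (2 * ϱ) ^ ((m : ℝ) - m * (p⁻¹).toReal)) := by
  have hmono : ∀ {A B : Set (Fin m → ℝ)}, A ⊆ B → eLpNorm (gradNorm s p f) p (volume.restrict A) ≤
      eLpNorm (gradNorm s p f) p (volume.restrict B) := fun h =>
    eLpNorm_mono_measure _ (Measure.restrict_mono_set _ h)
  have hfin' : eLpNorm (gradNorm s p f) p (volume.restrict (Metric.ball c r)) ≠ ∞ :=
    ((hmono hcr).trans_lt hfin.lt_top).ne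
  have hmeas : AEStronglyMeasurable (gradNorm s p f) (volume.restrict (Metric.closedBall z ϱ)) :=
    hfs.aestronglyMeasurable_gradNorm.mono_measure (Measure.restrict_mono_set _ (hz.trans hcr))
  have h1 := eLpNorm_le_eLpNorm_mul_rpow_measure_univ hp.out hmeas
  rw [eLpNorm_one_eq_lintegral_enorm] at h1
  have h2 : ∀ t, ‖gradNorm s p f t‖ₑ = ENNReal.ofReal (gradNorm s p f t) := fun t =>
    Real.enorm_eq_ofReal (gradNorm_nonneg _ _ _ _)
  simp only [h2] at h1
  refine h1.trans ?_
  rw [ENNReal.ofReal_mul ENNReal.toReal_nonneg, ENNReal.ofReal_toReal hfin']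
  refine mul_le_mul' (hmono hz) (le_of_eq ?_)
  rw [Measure.restrict_apply_univ, Real.volume_pi_closedBall _ hϱ.le, Fintype.card_fin,
    ENNReal.ofReal_rpow_of_pos (by positivity)]
  congr 1
  rw [← Real.rpow_natCast, ← Real.rpow_mul (by positivity), ENNReal.toReal_one, ENNReal.toReal_inv]
  congr 1
  ring

/-- The mollified gradient is dominated by an average of translates of the weak gradient.
Translations by at most `ε` keep the balls inside `Metric.ball c r`, so the growth condition
survives with a constant independent of the mollifier. -/
theorem lintegral_mollify_le {s : ℕ} {p : ℝ≥0∞} [Fact (1 ≤ p)] {f η : (Fin m → ℝ) → ℝ}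
    (hf : IntegrableOn f (openCube m)) (hfs : MemSobolev s p f)
    (hfin : eLpNorm (gradNorm s p f) p (cubeMeasure m) ≠ ∞)
    (hη : ContDiff ℝ ((⊤ : ℕ∞) : WithTop ℕ∞) η) (hη0 : ∀ x, 0 ≤ η x) {ε : ℝ}
    (hsupp : Function.support η ⊆ Metric.closedBall 0 ε)
    (hone : ∫⁻ w, ENNReal.ofReal (η w) = 1)
    {c : Fin m → ℝ} {r r' : ℝ} (hcr : Metric.ball c r ⊆ openCube m) (hr' : r' + ε < r)
    {z : Fin m → ℝ} {ϱ : ℝ} (hϱ : 0 < ϱ) (hz : Metric.closedBall z ϱ ⊆ Metric.closedBall c r') :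
    ∫⁻ y in Metric.closedBall z ϱ, ENNReal.ofReal (∑ k ∈ Finset.piAntidiag Finset.univ s,
      |multiDeriv k (convolution ((openCube m).indicator f) η
        (ContinuousLinearMap.lsmul ℝ ℝ) volume) y|) ≤
      ENNReal.ofReal (((Finset.piAntidiag (Finset.univ : Finset (Fin m)) s).card *
        ((eLpNorm (gradNorm s p f) p (volume.restrict (Metric.ball c r))).toReal *
        2 ^ ((m : ℝ) - m * (p⁻¹).toReal))) * ϱ ^ ((m : ℝ) - m * (p⁻¹).toReal)) := by
  have hshift : ∀ y w : Fin m → ℝ, y ∈ Metric.closedBall c r' → ‖w‖ ≤ ε →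
      y - w ∈ Metric.ball c r := fun y w hy hw => by
    rw [Metric.mem_closedBall] at hy
    rw [Metric.mem_ball]
    have h1 : dist (y - w) y = ‖w‖ := by rw [dist_eq_norm]; simp
    linarith [dist_triangle (y - w) y c]
  have hcl : ∀ y ∈ Metric.closedBall c r', Metric.closedBall y ε ⊆ openCube m := fun y hy t ht => by
    refine hcr ?_
    have := hshift y (y - t) hy (by rwa [← dist_eq_norm, dist_comm])
    rwa [sub_sub_cancel] at this
  have hHm : AEMeasurable (fun t => ENNReal.ofReal (gradNorm s p f t)) (cubeMeasure m) :=
    hfs.aestronglyMeasurable_gradNorm.aemeasurable.ennreal_ofReal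
  -- `gradNorm` is measurable only almost everywhere; Tonelli is applied to a measurable version.
  set H := hHm.mk _ with hH
  have hHmeas : Measurable H := hHm.measurable_mk
  have hHae : (fun t => ENNReal.ofReal (gradNorm s p f t)) =ᵐ[cubeMeasure m] H := hHm.ae_eq_mk
  set H₁ := (openCube m).indicator H
  have hH₁ : Measurable H₁ := hHmeas.indicator measurableSet_openCube
  have hηm : Measurable fun w => ENNReal.ofReal (η w) :=
    ENNReal.measurable_ofReal.comp hη.continuous.measurable
  have hconv : ∀ y, ∫⁻ t, ENNReal.ofReal (gradNorm s p f t) * ENNReal.ofReal (η (y - t))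
      ∂(cubeMeasure m) = ∫⁻ w, H₁ (y - w) * ENNReal.ofReal (η w) := fun y => by
    have h1 : ∫⁻ t, ENNReal.ofReal (gradNorm s p f t) * ENNReal.ofReal (η (y - t))
        ∂(cubeMeasure m) = ∫⁻ t, H t * ENNReal.ofReal (η (y - t)) ∂(cubeMeasure m) :=
      lintegral_congr_ae (hHae.mono fun t ht => by simp only at ht ⊢; rw [ht])
    rw [h1, cubeMeasure, ← lintegral_indicator measurableSet_openCube,
      ← lintegral_sub_left_eq_self _ y]
    congr 1
    ext w
    by_cases hw : y - w ∈ openCube m <;> simp [H₁, hw]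
  set N : ℝ≥0∞ := ((Finset.piAntidiag (Finset.univ : Finset (Fin m)) s).card : ℝ≥0∞)
  set L := (eLpNorm (gradNorm s p f) p (volume.restrict (Metric.ball c r))).toReal
  calc _ ≤ ∫⁻ y in Metric.closedBall z ϱ, N * ∫⁻ w, H₁ (y - w) * ENNReal.ofReal (η w) := by
        refine setLIntegral_mono' measurableSet_closedBall fun y hy => ?_
        rw [← hconv]
        exact ofReal_sum_multiDeriv_mollify_le hf hfs hη hη0 hsupp (hcl y (hz hy))
    _ = N * ∫⁻ w, ENNReal.ofReal (η w) * ∫⁻ y in Metric.closedBall z ϱ, H₁ (y - w) := by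
        have hm2 : Measurable fun q : (Fin m → ℝ) × (Fin m → ℝ) =>
            H₁ (q.1 - q.2) * ENNReal.ofReal (η q.2) :=
          (hH₁.comp (measurable_fst.sub measurable_snd)).mul (hηm.comp measurable_snd)
        rw [lintegral_const_mul _ hm2.lintegral_prod_right', lintegral_lintegral_swap
          hm2.aemeasurable]
        congr 1
        refine lintegral_congr fun w => ?_
        have hmw : Measurable fun y => H₁ (y - w) := hH₁.comp (measurable_id.sub_const w)
        rw [mul_comm, ← lintegral_mul_const _ hmw]
    _ ≤ N * ∫⁻ w, ENNReal.ofReal (η w) *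
          ENNReal.ofReal (L * (2 * ϱ) ^ ((m : ℝ) - m * (p⁻¹).toReal)) := by
        refine mul_le_mul' le_rfl (lintegral_mono fun w => ?_)
        by_cases hw : η w = 0
        · simp [hw]
        refine mul_le_mul' le_rfl ?_
        have hwε : ‖w‖ ≤ ε := by simpa using hsupp hw
        have h1 := lintegral_closedBall_homothety hH₁ one_pos (-w) z ϱ
        simp only [one_smul, one_pow, inv_one, ENNReal.ofReal_one, one_mul] at h1
        simp only [sub_eq_add_neg]
        rw [h1]
        have hsub : Metric.closedBall (z + -w) ϱ ⊆ Metric.ball c r := fun t ht => by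
          have h2 : t + w ∈ Metric.closedBall z ϱ := by
            rw [Metric.mem_closedBall, dist_eq_norm] at ht ⊢
            rwa [show t + w - z = t - (z + -w) by abel]
          have := hshift _ w (hz h2) hwε
          rwa [add_sub_cancel_right] at this
        refine le_trans (le_of_eq ?_) (lintegral_gradNorm_le hfs hfin hcr hϱ hsub)
        have hae : ∀ᵐ t ∂(volume.restrict (Metric.closedBall (z + -w) ϱ)),
            ENNReal.ofReal (gradNorm s p f t) = H t :=
          ae_mono (Measure.restrict_mono_set _ (hsub.trans hcr)) hHae
        rw [lintegral_congr_ae hae]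
        refine setLIntegral_congr_fun measurableSet_closedBall fun t ht => ?_
        simp [H₁, hcr (hsub ht)]
    _ = _ := by
        rw [lintegral_mul_const _ hηm, hone, one_mul]
        rw [mul_assoc, ENNReal.ofReal_mul (Nat.cast_nonneg _), ENNReal.ofReal_natCast]
        congr 2
        rw [Real.mul_rpow zero_le_two hϱ.le, mul_assoc]

/-- The mollified function obeys the estimate only on the ball of radius `r - d`. A point `x` of the
full closed ball is therefore moved to `x' = c + (1 - d / r) (x - c)`, and the polynomial is
composed with this affine map, which preserves its degree. Uniform continuity of `f` controls both
the shift and the mollification error. Here `s` is the degree and `s + 1` the order; the polynomial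
may depend on `δ`. -/
theorem exists_poly_approx (s : ℕ) {p : ℝ≥0∞} [Fact (1 ≤ p)] (hρ : 0 < rhoHat m (s + 1) p) :
    ∃ C : ℝ, 0 ≤ C ∧ ∀ f : (Fin m → ℝ) → ℝ, ContinuousOn f (closedCube m) →
      MemSobolev (s + 1) p f → eLpNorm (gradNorm (s + 1) p f) p (cubeMeasure m) ≠ ∞ →
      ∀ (c : Fin m → ℝ) (r : ℝ), 0 < r → Metric.ball c r ⊆ openCube m → ∀ δ > 0,
      ∃ P, IsPolyFun s P ∧ ∀ x ∈ Metric.closedBall c r, |f x - P x| ≤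
        C * r ^ rhoHat m (s + 1) p *
          (eLpNorm (gradNorm (s + 1) p f) p (volume.restrict (Metric.ball c r))).toReal + δ := by
  set α : ℝ := m * (p⁻¹).toReal with hα
  have hρα : rhoHat m (s + 1) p = (s : ℝ) + 1 - α := by simp [rhoHat, hα]
  have hα' : α < s + 1 := by rw [hρα] at hρ; linarith
  have hT := taylorConst_nonneg (m := m) hα'
  refine ⟨taylorConst m s α * ((Finset.piAntidiag (Finset.univ : Finset (Fin m)) (s + 1)).card *
    2 ^ ((m : ℝ) - α)), by positivity, fun f hfc hfs hfin c r hr hcr δ hδ => ?_⟩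
  have hclosed : Metric.closedBall c r ⊆ closedCube m := by
    rw [← closure_ball c hr.ne']
    exact closure_minimal (hcr.trans openCube_subset_closedCube) isCompact_closedCube.isClosed
  obtain ⟨κ, hκ, hunif⟩ := Metric.uniformContinuousOn_iff.1
    (isCompact_closedCube.uniformContinuousOn_of_continuous hfc) (δ / 2) (by positivity)
  have hint : IntegrableOn f (openCube m) :=
    (hfc.integrableOn_compact isCompact_closedCube).mono_set openCube_subset_closedCube
  -- Makes `d` smaller both than the modulus of continuity `κ` for `δ / 2` and than `r`.
  set d := min κ r / 2 with hd
  have hd0 : 0 < d := by positivity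
  have hdκ : d < κ := by have := min_le_left κ r; linarith [lt_min hκ hr]
  have hdr : d < r := by have := min_le_right κ r; linarith [lt_min hκ hr]
  let b : ContDiffBump (0 : Fin m → ℝ) := ⟨d / 4, d / 2, by positivity, by linarith⟩
  set η := b.normed volume
  have hη : ContDiff ℝ ((⊤ : ℕ∞) : WithTop ℕ∞) η := b.contDiff_normed
  have hsupp : Function.support η ⊆ Metric.closedBall 0 (d / 2) := by
    rw [b.support_normed_eq]
    exact Metric.ball_subset_closedBall
  have hone : ∫⁻ w, ENNReal.ofReal (η w) = 1 := by
    rw [← ofReal_integral_eq_lintegral_ofReal b.integrable_normed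
      (Eventually.of_forall b.nonneg_normed), b.integral_normed, ENNReal.ofReal_one]
  set L := (eLpNorm (gradNorm (s + 1) p f) p (volume.restrict (Metric.ball c r))).toReal
  have hind : Integrable ((openCube m).indicator f) :=
    (integrable_indicator_iff measurableSet_openCube).2 hint
  let F : smoothFunctions m := ⟨convolution ((openCube m).indicator f) η
    (ContinuousLinearMap.lsmul ℝ ℝ) volume,
    b.hasCompactSupport_normed.contDiff_convolution_right _ hind.locallyIntegrable hη⟩
  obtain ⟨P, hP, hPF⟩ := exists_poly_approx_of_smooth F s c (r := r - d) (by linarith) hα'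
    (K := (Finset.piAntidiag (Finset.univ : Finset (Fin m)) (s + 1)).card *
      (L * 2 ^ ((m : ℝ) - α))) (by positivity)
    fun z ϱ hϱ hz => lintegral_mollify_le hint hfs hfin hη b.nonneg_normed hsupp hone hcr
      (by linarith) hϱ hz
  have hθ : 0 ≤ 1 - d / r := by rw [sub_nonneg, div_le_one hr]; exact hdr.le
  refine ⟨_, hP.comp_affine (c - (1 - d / r) • c) (1 - d / r), fun x hx => ?_⟩
  set x' := c - (1 - d / r) • c + (1 - d / r) • x with hx'
  rw [Metric.mem_closedBall] at hx
  have hx'c : dist x' c ≤ r - d := by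
    rw [dist_eq_norm, hx', show c - (1 - d / r) • c + (1 - d / r) • x - c = (1 - d / r) • (x - c) by
      rw [smul_sub]; abel, norm_smul, Real.norm_of_nonneg hθ, ← dist_eq_norm]
    calc (1 - d / r) * dist x c ≤ (1 - d / r) * r := mul_le_mul_of_nonneg_left hx hθ
      _ = r - d := by field_simp
  have hxx' : dist x x' < κ := by
    rw [dist_eq_norm, hx', show x - (c - (1 - d / r) • c + (1 - d / r) • x) = (d / r) • (x - c) by
      rw [smul_sub, sub_smul, sub_smul, one_smul, one_smul]; abel, norm_smul,
      Real.norm_of_nonneg (by positivity), ← dist_eq_norm]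
    calc d / r * dist x c ≤ d / r * r := mul_le_mul_of_nonneg_left hx (by positivity)
      _ = d := by field_simp
      _ < κ := hdκ
  have hx'ball : Metric.closedBall x' (d / 2) ⊆ openCube m := by
    refine (Metric.closedBall_subset_ball' ?_).trans hcr
    linarith
  have hx'o : x' ∈ openCube m := hx'ball (Metric.mem_closedBall_self (by positivity))
  have h1 : dist (f x) (f x') < δ / 2 := hunif x (hclosed hx) x'
    (openCube_subset_closedCube hx'o) hxx'
  have h2 : dist ((F : (Fin m → ℝ) → ℝ) x') (f x') ≤ δ / 2 := by
    have h3 : (F : (Fin m → ℝ) → ℝ) x' = convolution η ((openCube m).indicator f)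
        (ContinuousLinearMap.lsmul ℝ ℝ) volume x' := by
      rw [convolution_eq_swap]
      change convolution ((openCube m).indicator f) η (ContinuousLinearMap.lsmul ℝ ℝ) volume x' = _
      rw [convolution_def]
      refine integral_congr_ae (Eventually.of_forall fun t => ?_)
      simp [mul_comm]
    have h4 : f x' = (openCube m).indicator f x' := by simp [hx'o]
    rw [h3, h4]
    refine b.dist_normed_convolution_le hind.aestronglyMeasurable fun t ht => ?_
    have hto : t ∈ openCube m := hx'ball (Metric.ball_subset_closedBall ht)
    have htd : dist t x' < d / 2 := ht
    rw [Set.indicator_of_mem hto, Set.indicator_of_mem hx'o]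
    exact (hunif t (openCube_subset_closedCube hto) x' (openCube_subset_closedCube hx'o)
      (by linarith)).le
  have h5 := hPF x' hx'c
  have h6 : (r - d) ^ ((s : ℝ) + 1 - α) ≤ r ^ ((s : ℝ) + 1 - α) :=
    Real.rpow_le_rpow (by linarith) (by linarith) (by linarith)
  rw [hρα]
  have h7 : taylorConst m s α * ((Finset.piAntidiag (Finset.univ : Finset (Fin m)) (s + 1)).card *
      (L * 2 ^ ((m : ℝ) - α))) * (r - d) ^ ((s : ℝ) + 1 - α) ≤ taylorConst m s α *
      ((Finset.piAntidiag (Finset.univ : Finset (Fin m)) (s + 1)).card *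
      (L * 2 ^ ((m : ℝ) - α))) * r ^ ((s : ℝ) + 1 - α) :=
    mul_le_mul_of_nonneg_left h6 (by positivity)
  rw [Real.dist_eq] at h1 h2
  have h8 : |f x - P x'| ≤ |f x - f x'| + |(F : (Fin m → ℝ) → ℝ) x' - f x'| +
      |(F : (Fin m → ℝ) → ℝ) x' - P x'| := by
    rw [show f x - P x' = (f x - f x') - ((F : (Fin m → ℝ) → ℝ) x' - f x') +
      ((F : (Fin m → ℝ) → ℝ) x' - P x') by ring]
    exact (abs_add_le _ _).trans (add_le_add (abs_sub _ _) le_rfl)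
  refine h8.trans ?_
  linarith

end Mollification

end SobolevWidths

namespace SobolevWidths

/-! ### Dyadic cubes, stopping-time partitions and the comparison of consecutive levels. -/

section Dyadic

variable {m : ℕ}

/-- The index of the dyadic cube of side `2⁻ⁿ` containing `x`. -/
noncomputable def dyadicIndex (n : ℕ) (x : Fin m → ℝ) : Fin m → ℤ := fun i => ⌈x i * 2 ^ n⌉ - 1

/-- The dyadic cube of side `2⁻ⁿ` containing `x`. -/
def dyadicAt (n : ℕ) (x : Fin m → ℝ) : Set (Fin m → ℝ) := dyadicCube n (dyadicIndex n x)

theorem mem_dyadicCube_iff {n : ℕ} {l : Fin m → ℤ} {x : Fin m → ℝ} :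
    x ∈ dyadicCube n l ↔ dyadicIndex n x = l := by
  have h2 : (0 : ℝ) < 2 ^ n := by positivity
  simp only [dyadicCube, Set.mem_pi, Set.mem_univ, true_imp_iff, Set.mem_Ioc, funext_iff,
    dyadicIndex, sub_eq_iff_eq_add, Int.ceil_eq_iff, div_lt_iff₀ h2, le_div_iff₀ h2]
  push_cast
  simp only [add_sub_cancel_right]

theorem mem_dyadicAt (n : ℕ) (x : Fin m → ℝ) : x ∈ dyadicAt n x := mem_dyadicCube_iff.2 rfl

theorem dyadicAt_eq_of_mem {n : ℕ} {x y : Fin m → ℝ} (h : y ∈ dyadicAt n x) :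
    dyadicAt n y = dyadicAt n x := by
  rw [dyadicAt, mem_dyadicCube_iff.1 h]; rfl

theorem dyadicCube_eq_dyadicAt {n : ℕ} {l : Fin m → ℤ} {x : Fin m → ℝ} (h : x ∈ dyadicCube n l) :
    dyadicCube n l = dyadicAt n x := by
  rw [dyadicAt, mem_dyadicCube_iff.1 h]

/-- Nesting of dyadic cubes in one coordinate: the index at a level is determined by the index at
the next. -/
theorem ceil_eq_of_ceil_two_mul {a b : ℝ} (h : ⌈a * 2⌉ = ⌈b * 2⌉) : ⌈a⌉ = ⌈b⌉ := by
  have key : ∀ (a : ℝ) (z : ℤ), ⌈a⌉ ≤ z ↔ ⌈a * 2⌉ ≤ z * 2 := fun a z => by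
    rw [Int.ceil_le, Int.ceil_le]
    push_cast
    constructor <;> intro h <;> linarith
  exact eq_of_forall_ge_iff fun z => by rw [key a, key b, h]

theorem dyadicAt_antitone (x : Fin m → ℝ) : Antitone fun n => dyadicAt n x := by
  refine antitone_nat_of_succ_le fun n y hy => ?_
  have h := mem_dyadicCube_iff.1 hy
  refine mem_dyadicCube_iff.2 ?_
  ext i
  have hi := congrFun h i
  simp only [dyadicIndex, sub_left_inj, pow_succ, ← mul_assoc] at hi ⊢
  exact ceil_eq_of_ceil_two_mul hi

theorem measurableSet_dyadicCube (n : ℕ) (l : Fin m → ℤ) : MeasurableSet (dyadicCube n l) :=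
  MeasurableSet.univ_pi fun _ => measurableSet_Ioc

theorem volume_real_dyadicCube (n : ℕ) (l : Fin m → ℤ) :
    volume.real (dyadicCube n l) = ((2 ^ n : ℝ)⁻¹) ^ m := by
  rw [measureReal_def, dyadicCube, Real.volume_pi_Ioc_toReal]
  · simp only [← sub_div, add_sub_cancel_left, one_div, Finset.prod_const, Finset.card_univ,
      Fintype.card_fin]
  · intro i
    simp only
    gcongr
    linarith

theorem volume_real_dyadicAt (n : ℕ) (x : Fin m → ℝ) :
    volume.real (dyadicAt n x) = ((2 ^ n : ℝ)⁻¹) ^ m := volume_real_dyadicCube _ _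

/-- A cube comparable to a sup-norm ball inside the unit cube. -/
def IsSubcube (Q : Set (Fin m → ℝ)) : Prop :=
  MeasurableSet Q ∧ ∃ (c : Fin m → ℝ) (r : ℝ), 0 < r ∧ Metric.ball c r ⊆ openCube m ∧
    Metric.ball c r ⊆ Q ∧ Q ⊆ Metric.closedBall c r ∧ volume.real Q = (2 * r) ^ m

theorem dyadicIndex_bounds {x : Fin m → ℝ} (hx : x ∈ openCube m) (n : ℕ) (i : Fin m) :
    0 ≤ dyadicIndex n x i ∧ dyadicIndex n x i + 1 ≤ 2 ^ n := by
  have h := hx i (Set.mem_univ i)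
  have h2 : (0 : ℝ) < 2 ^ n := by positivity
  simp only [dyadicIndex]
  refine ⟨by have := Int.ceil_pos.2 (mul_pos h.1 h2); lia, ?_⟩
  rw [sub_add_cancel, Int.ceil_le]
  push_cast
  nlinarith [h.2]

/-- The half-open cube may contain points of the upper faces of the unit cube, so only its interior
ball is claimed to lie in `openCube m`. -/
theorem isSubcube_dyadicAt {x : Fin m → ℝ} (hx : x ∈ openCube m) (n : ℕ) :
    IsSubcube (dyadicAt n x) := by
  have h2 : (0 : ℝ) < 2 ^ n := by positivity
  refine ⟨measurableSet_dyadicCube _ _, fun i => ((dyadicIndex n x i : ℝ) + 1 / 2) / 2 ^ n,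
    1 / 2 / 2 ^ n, by positivity, ?_, ?_, ?_, ?_⟩
  · rw [ball_pi _ (by positivity)]
    refine Set.pi_mono fun i _ => ?_
    rw [Real.ball_eq_Ioo, ← sub_div, ← add_div]
    obtain ⟨h3, h4⟩ := dyadicIndex_bounds hx n i
    have h3' : (0 : ℝ) ≤ dyadicIndex n x i := by exact_mod_cast h3
    have h4' : (dyadicIndex n x i : ℝ) + 1 ≤ 2 ^ n := by exact_mod_cast h4
    refine Set.Ioo_subset_Ioo (div_nonneg (by linarith) h2.le) ?_
    rw [div_le_one h2]
    linarith
  · rw [ball_pi _ (by positivity)]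
    refine Set.pi_mono fun i _ => ?_
    rw [Real.ball_eq_Ioo, ← sub_div, ← add_div]
    refine Set.Ioo_subset_Ioc_self.trans (Set.Ioc_subset_Ioc ?_ ?_) <;>
      exact div_le_div_of_nonneg_right (by linarith) h2.le
  · rw [closedBall_pi _ (by positivity)]
    refine Set.pi_mono fun i _ => ?_
    rw [Real.closedBall_eq_Icc, ← sub_div, ← add_div]
    refine Set.Ioc_subset_Icc_self.trans (Set.Icc_subset_Icc ?_ ?_) <;>
      exact div_le_div_of_nonneg_right (by linarith) h2.le
  · rw [volume_real_dyadicAt]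
    congr 1
    ring

theorem openCube_subset_dyadicAt_zero {x : Fin m → ℝ} (hx : x ∈ openCube m) :
    openCube m ⊆ dyadicAt 0 x := fun y hy => by
  refine mem_dyadicCube_iff.2 ?_
  ext i
  have h1 := dyadicIndex_bounds hx 0 i
  have h2 := dyadicIndex_bounds hy 0 i
  lia

variable {ν : Measure (Fin m → ℝ)}

theorem mem_dyadicCubes_iff (n : ℕ) (Q : Set (Fin m → ℝ)) (hν : ν (openCube m)ᶜ = 0) :
    Q ∈ dyadicCubes ν n ↔ 0 < ν Q ∧ ∃ x ∈ openCube m, Q = dyadicAt n x := by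
  constructor
  · rintro ⟨⟨l, rfl⟩, hpos⟩
    refine ⟨hpos, ?_⟩
    obtain ⟨x, hxQ, hx⟩ : (dyadicCube n l ∩ openCube m).Nonempty := by
      by_contra h
      rw [Set.not_nonempty_iff_eq_empty, ← Set.disjoint_iff_inter_eq_empty,
        ← Set.subset_compl_iff_disjoint_right] at h
      exact hpos.ne' (measure_mono_null h hν)
    exact ⟨x, hx, dyadicCube_eq_dyadicAt hxQ⟩
  · rintro ⟨hpos, x, -, rfl⟩
    exact ⟨⟨_, rfl⟩, hpos⟩

theorem finite_dyadicCubes (hν : ν (openCube m)ᶜ = 0) (n : ℕ) : (dyadicCubes ν n).Finite := by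
  have hfin : (Set.univ.pi fun _ : Fin m => Set.Icc (0 : ℤ) (2 ^ n)).Finite :=
    Set.Finite.pi fun _ => Set.finite_Icc _ _
  refine (hfin.image (dyadicCube n)).subset fun Q hQ => ?_
  obtain ⟨-, x, hx, rfl⟩ := (mem_dyadicCubes_iff n Q hν).1 hQ
  refine ⟨_, fun i _ => ?_, rfl⟩
  have := dyadicIndex_bounds hx n i
  exact ⟨this.1, by lia⟩

/-- There are only countably many dyadic cubes, so the null ones can be discarded together. -/
theorem ae_dyadicAt_pos (ν : Measure (Fin m → ℝ)) : ∀ᵐ x ∂ν, ∀ n, 0 < ν (dyadicAt n x) := by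
  rw [ae_all_iff]
  intro n
  have h : ∀ᵐ x ∂ν, ∀ l : {l : Fin m → ℤ // ν (dyadicCube n l) = 0}, x ∉ dyadicCube n l :=
    ae_all_iff.2 fun l => measure_eq_zero_iff_ae_notMem.1 l.2
  filter_upwards [h] with x hx
  by_contra h0
  exact hx ⟨_, nonpos_iff_eq_zero.1 (not_lt.1 h0)⟩ (mem_dyadicAt n x)

/-- A finite partition, up to `ν`-null sets, into subcubes of the unit cube of positive measure. -/
structure IsCubePartition (ν : Measure (Fin m → ℝ)) (P : Set (Set (Fin m → ℝ))) : Prop where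
  finite : P.Finite
  isSubcube : ∀ Q ∈ P, IsSubcube Q
  measure_pos : ∀ Q ∈ P, 0 < ν Q
  disjoint : ∀ Q ∈ P, ∀ Q' ∈ P, ∀ x, x ∈ Q → x ∈ Q' → Q = Q'
  cover : ∀ᵐ x ∂ν, ∃ Q ∈ P, x ∈ Q

theorem isCubePartition_dyadicCubes (hν : ν (openCube m)ᶜ = 0) (n : ℕ) :
    IsCubePartition ν (dyadicCubes ν n) where
  finite := finite_dyadicCubes hν n
  isSubcube Q hQ := by
    obtain ⟨-, x, hx, rfl⟩ := (mem_dyadicCubes_iff n Q hν).1 hQ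
    exact isSubcube_dyadicAt hx n
  measure_pos Q hQ := hQ.2
  disjoint := by
    rintro Q ⟨⟨l, rfl⟩, -⟩ Q' ⟨⟨l', rfl⟩, -⟩ x hx hx'
    rw [dyadicCube_eq_dyadicAt hx, dyadicCube_eq_dyadicAt hx']
  cover := by
    filter_upwards [ae_dyadicAt_pos ν] with x hx
    exact ⟨_, ⟨⟨_, rfl⟩, hx n⟩, mem_dyadicAt n x⟩

variable {s : ℕ} {p q : ℝ≥0∞} {t : ℝ}

theorem cubeWeight_mono [IsFiniteMeasure ν] (h : 0 ≤ q.toReal * rhoHat m s p / m)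
    {Q Q' : Set (Fin m → ℝ)} (hQ : Q ⊆ Q') (hQ' : volume Q' ≠ ∞) :
    cubeWeight s p q ν Q ≤ cubeWeight s p q ν Q' := by
  have h1 : ν.real Q ≤ ν.real Q' := measureReal_mono hQ
  have h2 : volume.real Q ≤ volume.real Q' := measureReal_mono hQ hQ'
  unfold cubeWeight
  gcongr

theorem volume_dyadicAt_ne_top (n : ℕ) (x : Fin m → ℝ) :
    volume (dyadicAt n x) ≠ ∞ := by
  have h := volume_real_dyadicAt n x
  intro h0
  rw [measureReal_def, h0, ENNReal.toReal_top] at h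
  have : (0 : ℝ) < ((2 ^ n : ℝ)⁻¹) ^ m := by positivity
  linarith

theorem cubeWeight_dyadicAt_antitone [IsFiniteMeasure ν]
    (h : 0 ≤ q.toReal * rhoHat m s p / m) (x : Fin m → ℝ) :
    Antitone fun n => cubeWeight s p q ν (dyadicAt n x) := fun _ _ hab =>
  cubeWeight_mono h (dyadicAt_antitone x hab) (volume_dyadicAt_ne_top _ x)

/-- Recasts the partition as a stopping time: the dyadic cubes containing a point form a chain, and
a cube is selected where the weight first falls below `t`. Any point of the cube may serve as base
point. -/
theorem mem_levelPartition_iff (hν : ν (openCube m)ᶜ = 0) {Q : Set (Fin m → ℝ)} :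
    Q ∈ levelPartition s p q ν t ↔ 0 < ν Q ∧ ∃ n, (Q ∩ openCube m).Nonempty ∧
      ∀ x ∈ Q, Q = dyadicAt (n + 1) x ∧ cubeWeight s p q ν (dyadicAt (n + 1) x) < t ∧
        t ≤ cubeWeight s p q ν (dyadicAt n x) := by
  constructor
  · rintro ⟨n, hQ, hlt, Q', ⟨⟨l', rfl⟩, hQ'⟩, hsub, hle⟩
    obtain ⟨hpos, x₀, hx₀, hQx₀⟩ := (mem_dyadicCubes_iff _ Q hν).1 hQ
    refine ⟨hpos, n, ⟨x₀, by rw [hQx₀]; exact mem_dyadicAt _ _, hx₀⟩, fun x hx => ?_⟩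
    have hQx : Q = dyadicAt (n + 1) x := by
      rw [hQx₀] at hx ⊢
      exact (dyadicAt_eq_of_mem hx).symm
    rw [← hQx, ← dyadicCube_eq_dyadicAt (hsub hx)]
    exact ⟨rfl, hlt, hle⟩
  · rintro ⟨hpos, n, ⟨x, hx, -⟩, h⟩
    obtain ⟨hQ, hlt, hle⟩ := h x hx
    have hsub : Q ⊆ dyadicAt n x := by
      rw [hQ]; exact dyadicAt_antitone x n.le_succ
    rw [← hQ] at hlt
    exact ⟨n, ⟨⟨_, hQ⟩, hpos⟩, hlt, dyadicAt n x, ⟨⟨_, rfl⟩, hpos.trans_le (measure_mono hsub)⟩,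
      hsub, hle⟩

theorem tendsto_cubeWeight_bound (hm : 0 < m) (h : 0 < q.toReal * rhoHat m s p / m) (a : ℝ) :
    Tendsto (fun n : ℕ => a * (((2 ^ n : ℝ)⁻¹) ^ m) ^ (q.toReal * rhoHat m s p / m)) atTop (𝓝 0) := by
  have h1 : Tendsto (fun n : ℕ => (((2 : ℝ)⁻¹) ^ m) ^ n) atTop (𝓝 0) :=
    tendsto_pow_atTop_nhds_zero_of_lt_one (by positivity) (pow_lt_one₀ (by norm_num) (by norm_num)
      hm.ne')
  have h2 := (h1.rpow_const (p := q.toReal * rhoHat m s p / m) (Or.inr h.le)).const_mul a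
  rw [Real.zero_rpow h.ne', mul_zero] at h2
  refine h2.congr fun n => ?_
  rw [← pow_mul, mul_comm m n, pow_mul, inv_pow]

theorem cubeWeight_dyadicAt_le [IsFiniteMeasure ν] (n : ℕ) (x : Fin m → ℝ) :
    cubeWeight s p q ν (dyadicAt n x) ≤
      ν.real Set.univ * (((2 ^ n : ℝ)⁻¹) ^ m) ^ (q.toReal * rhoHat m s p / m) := by
  rw [cubeWeight, volume_real_dyadicAt]
  have : ν.real (dyadicAt n x) ≤ ν.real Set.univ := measureReal_mono (Set.subset_univ _)
  gcongr

theorem exists_cubeWeight_lt [IsFiniteMeasure ν] (hm : 0 < m)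
    (h : 0 < q.toReal * rhoHat m s p / m) (ht : 0 < t) :
    ∃ N : ℕ, ∀ n ≥ N, ∀ x : Fin m → ℝ, cubeWeight s p q ν (dyadicAt n x) < t := by
  obtain ⟨N, hN⟩ := eventually_atTop.1
    ((tendsto_cubeWeight_bound hm h (ν.real Set.univ)).eventually_lt_const ht)
  exact ⟨N, fun n hn x => (cubeWeight_dyadicAt_le n x).trans_lt (hN n hn)⟩

/-- The cube of level zero has volume one and carries all of `ν`; this is why `t ≤ ν.real Set.univ`
is the condition for the stopping argument to start. -/
theorem le_cubeWeight_dyadicAt_zero [IsFiniteMeasure ν] (hν : ν (openCube m)ᶜ = 0)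
    {x : Fin m → ℝ} (hx : x ∈ openCube m) :
    cubeWeight s p q ν (dyadicAt 0 x) = ν.real Set.univ := by
  have h1 : ν.real (dyadicAt 0 x) = ν.real Set.univ := by
    have : ν (dyadicAt 0 x)ᶜ = 0 :=
      measure_mono_null (Set.compl_subset_compl.2 (openCube_subset_dyadicAt_zero hx)) hν
    rw [measureReal_def, measureReal_def]
    congr 1
    exact measure_congr (ae_eq_univ.2 this)
  rw [cubeWeight, volume_real_dyadicAt, h1]
  simp

theorem exists_mem_levelPartition [IsFiniteMeasure ν] (hν : ν (openCube m)ᶜ = 0) (ht' : t ≤ ν.real Set.univ)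
    {x : Fin m → ℝ} (hx : x ∈ openCube m) {N : ℕ} (hpos : 0 < ν (dyadicAt N x))
    (hN : cubeWeight s p q ν (dyadicAt N x) < t) :
    ∃ n < N, dyadicAt (n + 1) x ∈ levelPartition s p q ν t := by
  classical
  have hex : ∃ n, cubeWeight s p q ν (dyadicAt n x) < t := ⟨N, hN⟩
  have hspec := Nat.find_spec hex
  have hne : Nat.find hex ≠ 0 := fun h0 => by
    rw [h0, le_cubeWeight_dyadicAt_zero hν hx] at hspec
    linarith
  obtain ⟨n, hn⟩ := Nat.exists_eq_succ_of_ne_zero hne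
  have hle : Nat.find hex ≤ N := Nat.find_min' hex hN
  have hmin := Nat.find_min hex (show n < Nat.find hex by lia)
  rw [hn] at hspec
  refine ⟨n, by lia, (mem_levelPartition_iff hν).2 ⟨hpos.trans_le (measure_mono
    (dyadicAt_antitone x (by lia))), n, ⟨x, mem_dyadicAt _ _, hx⟩, fun y hy => ?_⟩⟩
  have h1 := dyadicAt_eq_of_mem hy
  have h2 := dyadicAt_eq_of_mem (dyadicAt_antitone x n.le_succ hy)
  rw [h1, h2]
  exact ⟨rfl, hspec, not_lt.1 hmin⟩

/-- Weights tend to zero uniformly with the level, giving finiteness and existence of a stopping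
level. Monotonicity along the chain of a point makes the crossing of `t` unique, giving
disjointness. -/
theorem isCubePartition_levelPartition [IsFiniteMeasure ν] (hm : 0 < m)
    (h : 0 < q.toReal * rhoHat m s p / m) (hν : ν (openCube m)ᶜ = 0) (ht : 0 < t)
    (ht' : t ≤ ν.real Set.univ) : IsCubePartition ν (levelPartition s p q ν t) := by
  obtain ⟨N, hN⟩ := exists_cubeWeight_lt (ν := ν) hm h ht
  have hcube : ∀ᵐ x ∂ν, x ∈ openCube m := by
    rw [ae_iff]; exact hν
  refine ⟨?_, fun Q hQ => ?_, fun Q hQ => ((mem_levelPartition_iff hν).1 hQ).1, ?_, ?_⟩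
  · refine ((Set.finite_Iic N).biUnion fun n _ => finite_dyadicCubes hν n).subset fun Q hQ => ?_
    obtain ⟨n, hQ, -, Q', hQ', -, hle⟩ := hQ
    obtain ⟨-, x, -, rfl⟩ := (mem_dyadicCubes_iff _ Q' hν).1 hQ'
    refine Set.mem_biUnion (x := n + 1) ?_ hQ
    by_contra hn
    rw [Set.mem_Iic, not_le] at hn
    linarith [hN n (by lia) x]
  · obtain ⟨-, n, ⟨x, hxQ, hx⟩, hall⟩ := (mem_levelPartition_iff hν).1 hQ
    rw [(hall x hxQ).1]
    exact isSubcube_dyadicAt hx _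
  · intro Q hQ Q' hQ' x hxQ hxQ'
    obtain ⟨-, n, -, hall⟩ := (mem_levelPartition_iff hν).1 hQ
    obtain ⟨-, n', -, hall'⟩ := (mem_levelPartition_iff hν).1 hQ'
    obtain ⟨e, h1, h2⟩ := hall x hxQ
    obtain ⟨e', h1', h2'⟩ := hall' x hxQ'
    have hanti := cubeWeight_dyadicAt_antitone (s := s) (p := p) (q := q) (ν := ν) h.le x
    have hnn : n = n' := by
      rcases lt_trichotomy n n' with hlt | heq | hlt
      · have := hanti (show n + 1 ≤ n' from hlt)
        simp only at this
        linarith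
      · exact heq
      · have := hanti (show n' + 1 ≤ n from hlt)
        simp only at this
        linarith
    rw [e, e', hnn]
  · filter_upwards [hcube, ae_dyadicAt_pos ν] with x hx hpos
    obtain ⟨n, -, hn⟩ := exists_mem_levelPartition hν ht' hx (hpos N) (hN N le_rfl x)
    exact ⟨_, hn, mem_dyadicAt _ _⟩

/-- A weight below `t'` is also below `t`, so the stopping for `t` happens no later than that for
`t'`. -/
theorem levelPartition_nested [IsFiniteMeasure ν] (hν : ν (openCube m)ᶜ = 0) {t' : ℝ} (htt : t' ≤ t)
    (ht' : t ≤ ν.real Set.univ) {Q : Set (Fin m → ℝ)} (hQ : Q ∈ levelPartition s p q ν t') :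
    ∃ Q' ∈ levelPartition s p q ν t, Q ⊆ Q' := by
  obtain ⟨hpos, n, ⟨x, hxQ, hx⟩, hall⟩ := (mem_levelPartition_iff hν).1 hQ
  obtain ⟨e, h1, -⟩ := hall x hxQ
  rw [e] at hpos
  obtain ⟨n', hn', hmem⟩ := exists_mem_levelPartition hν ht' hx hpos (h1.trans_le htt)
  refine ⟨_, hmem, ?_⟩
  rw [e]
  exact dyadicAt_antitone x (by lia)

/-- The finitely many cubes up to a given level have positive weight; once `t k` is below all these
weights, only finer cubes can be selected. -/
theorem eventually_volume_lt [IsFiniteMeasure ν] (hm : 0 < m) (hν : ν (openCube m)ᶜ = 0)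
    {t : ℕ → ℝ} (ht : Tendsto t atTop (𝓝 0)) {ε : ℝ} (hε : 0 < ε) :
    ∀ᶠ k in atTop, ∀ Q ∈ levelPartition s p q ν (t k), volume.real Q < ε := by
  have h1 : Tendsto (fun n : ℕ => (((2 : ℝ)⁻¹) ^ m) ^ n) atTop (𝓝 0) :=
    tendsto_pow_atTop_nhds_zero_of_lt_one (by positivity) (pow_lt_one₀ (by norm_num) (by norm_num)
      hm.ne')
  obtain ⟨N, hN⟩ := eventually_atTop.1 (h1.eventually_lt_const hε)
  have hfin : (⋃ n ∈ Set.Iic N, dyadicCubes ν n).Finite :=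
    (Set.finite_Iic N).biUnion fun n _ => finite_dyadicCubes hν n
  have hev : ∀ᶠ k in atTop, ∀ Q ∈ ⋃ n ∈ Set.Iic N, dyadicCubes ν n,
      t k < cubeWeight s p q ν Q := by
    refine (eventually_all_finite hfin).2 fun Q hQ => ht.eventually_lt_const ?_
    obtain ⟨n, -, hQn⟩ := Set.mem_iUnion₂.1 hQ
    obtain ⟨hpos, x, -, rfl⟩ := (mem_dyadicCubes_iff n Q hν).1 hQn
    rw [cubeWeight, volume_real_dyadicAt]
    have : 0 < ν.real (dyadicAt n x) := ENNReal.toReal_pos hpos.ne' (measure_ne_top _ _)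
    positivity
  filter_upwards [hev] with k hk Q hQ
  obtain ⟨n, hQn, hlt, -⟩ := hQ
  have hnN : N < n + 1 := by
    by_contra hle
    have := hk Q (Set.mem_biUnion (x := n + 1) (by simpa using hle) hQn)
    linarith
  obtain ⟨-, x, -, rfl⟩ := (mem_dyadicCubes_iff _ Q hν).1 hQn
  rw [volume_real_dyadicAt]
  have h3 := hN (n + 1) hnN.le
  rwa [← pow_mul, mul_comm, pow_mul, inv_pow] at h3

/-- Among boundedly many disjoint pieces covering `Q'`, one carries a definite part of the mass. -/
theorem exists_large_piece [IsFiniteMeasure ν] {S : Set (Set (Fin m → ℝ))} (hS : S.Finite)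
    (hmeas : ∀ Q ∈ S, MeasurableSet Q) (hdisj : ∀ Q ∈ S, ∀ Q' ∈ S, ∀ x, x ∈ Q → x ∈ Q' → Q = Q')
    {Q' : Set (Fin m → ℝ)} (hQ' : volume Q' ≠ ∞) (hpos : 0 < ν Q') (hsub : ∀ Q ∈ S, Q ⊆ Q')
    (hvol0 : 0 < volume.real Q') {c : ℝ}
    (hvol : ∀ Q ∈ S, c * volume.real Q' ≤ volume.real Q)
    (hcov : ∀ᵐ x ∂ν, x ∈ Q' → ∃ Q ∈ S, x ∈ Q) :
    ∃ Q ∈ S, c * ν.real Q' ≤ ν.real Q := by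
  classical
  have hpd : (hS.toFinset : Set (Set (Fin m → ℝ))).PairwiseDisjoint id := by
    intro A hA B hB hAB
    rw [Function.onFun, Set.disjoint_left]
    intro x hxA hxB
    exact hAB (hdisj A (by simpa using hA) B (by simpa using hB) x hxA hxB)
  have hm' : ∀ Q ∈ hS.toFinset, MeasurableSet (id Q) := fun Q hQ => hmeas Q (by simpa using hQ)
  -- Disjointness inside `Q'` limits the number of pieces to `1 / c`; if each had less than `c`
  -- times the mass, they could not cover `Q'`.
  have hcard : c * (hS.toFinset.card : ℝ) ≤ 1 := by
    have h1 : ∑ Q ∈ hS.toFinset, volume.real (id Q) ≤ volume.real Q' := by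
      rw [← measureReal_biUnion_finset hpd hm' fun Q hQ =>
        ((measure_mono (hsub Q (by simpa using hQ))).trans_lt hQ'.lt_top).ne]
      refine measureReal_mono ?_ hQ'
      exact Set.iUnion₂_subset fun Q hQ => hsub Q (by simpa using hQ)
    have h2 := Finset.card_nsmul_le_sum hS.toFinset (fun Q => volume.real (id Q))
      (c * volume.real Q') fun Q hQ => hvol Q (by simpa using hQ)
    rw [nsmul_eq_mul] at h2
    have h3 : (c * hS.toFinset.card) * volume.real Q' ≤ 1 * volume.real Q' := by linarith
    exact le_of_mul_le_mul_right h3 hvol0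
  by_contra! hlt
  have hsum : ν.real Q' ≤ ∑ Q ∈ hS.toFinset, ν.real (id Q) := by
    rw [← measureReal_biUnion_finset hpd hm']
    refine ENNReal.toReal_mono (measure_ne_top _ _) (measure_mono_ae ?_)
    filter_upwards [hcov] with x hx hxQ'
    obtain ⟨Q, hQ, hxQ⟩ := hx hxQ'
    exact Set.mem_biUnion (by simpa using hQ) hxQ
  have hνpos : 0 < ν.real Q' := ENNReal.toReal_pos hpos.ne' (measure_ne_top _ _)
  have hne : hS.toFinset.Nonempty := by
    by_contra h0
    rw [Finset.not_nonempty_iff_eq_empty] at h0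
    rw [h0, Finset.sum_empty] at hsum
    linarith
  have h4 : ∑ Q ∈ hS.toFinset, ν.real (id Q) < ∑ _Q ∈ hS.toFinset, c * ν.real Q' :=
    Finset.sum_lt_sum_of_nonempty hne fun Q hQ => hlt Q (by simpa using hQ)
  rw [Finset.sum_const, nsmul_eq_mul] at h4
  have h5 : (c * hS.toFinset.card) * ν.real Q' ≤ 1 * ν.real Q' :=
    mul_le_mul_of_nonneg_right hcard hνpos.le
  linarith

theorem mul_cubeWeight_le {Q Q' : Set (Fin m → ℝ)} {c : ℝ} (hc : 0 < c)
    (h : 0 ≤ q.toReal * rhoHat m s p / m) (h1 : c * ν.real Q' ≤ ν.real Q)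
    (h2 : c * volume.real Q' ≤ volume.real Q) :
    c * c ^ (q.toReal * rhoHat m s p / m) * cubeWeight s p q ν Q' ≤ cubeWeight s p q ν Q := by
  unfold cubeWeight
  calc c * c ^ (q.toReal * rhoHat m s p / m) *
        (ν.real Q' * volume.real Q' ^ (q.toReal * rhoHat m s p / m))
      = (c * ν.real Q') * (c * volume.real Q') ^ (q.toReal * rhoHat m s p / m) := by
        rw [Real.mul_rpow hc.le measureReal_nonneg]; ring
    _ ≤ _ := by gcongr

/-- Pigeonhole twice. The parent of a smallest cube of `P_t` has weight at least `t` and is covered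
by at most `2^m` cubes of `P_t`, so one of them, `Q₂`, keeps a fixed share of mass and volume, hence
of the weight. Likewise `Q₂` is covered by boundedly many cubes of `P_{t'}`, and one keeps a fixed
share of its weight. That weight is below `t'`. -/
theorem level_ratio [IsFiniteMeasure ν] (hm : 0 < m)
    (h : 0 < q.toReal * rhoHat m s p / m) (hν : ν (openCube m)ᶜ = 0) (hν0 : ν ≠ 0) {t' : ℝ}
    (ht0 : 0 < t') (htt : t' ≤ t) (ht' : t ≤ ν.real Set.univ) {c : ℝ} (hc : 0 < c)
    (hratio : ∀ Q ∈ levelPartition s p q ν t', ∀ Q' ∈ levelPartition s p q ν t, Q ⊆ Q' →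
      c * volume.real Q' ≤ volume.real Q) :
    (((2 : ℝ)⁻¹ ^ m) * ((2 : ℝ)⁻¹ ^ m) ^ (q.toReal * rhoHat m s p / m)) *
      (c * c ^ (q.toReal * rhoHat m s p / m)) * t ≤ t' := by
  have hP := isCubePartition_levelPartition hm h hν (ht0.trans_le htt) ht'
  have hP' := isCubePartition_levelPartition hm h hν ht0 (htt.trans ht')
  have hQ₁ : (levelPartition s p q ν t).Nonempty := by
    have : (ae ν).NeBot := ae_neBot.2 hν0
    obtain ⟨x, Q, hQ, -⟩ := hP.cover.exists
    exact ⟨Q, hQ⟩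
  -- Minimality ensures that every cube of `P_t` inside the parent has at least `2^{-m}` of the
  -- parent's volume.
  obtain ⟨Q₁, hQ₁, hmin⟩ := Set.exists_min_image _ (fun Q => volume.real Q) hP.finite hQ₁
  obtain ⟨hpos₁, n, ⟨x, hxQ, hx⟩, hall⟩ := (mem_levelPartition_iff hν).1 hQ₁
  obtain ⟨e₁, h1, h2⟩ := hall x hxQ
  have hvolpos : ∀ (n : ℕ) (x : Fin m → ℝ), 0 < volume.real (dyadicAt n x) := fun n x => by
    rw [volume_real_dyadicAt]; positivity
  obtain ⟨Q₂, ⟨hQ₂, hsub₂⟩, hν₂⟩ := exists_large_piece (ν := ν)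
    (S := {Q | Q ∈ levelPartition s p q ν t ∧ Q ⊆ dyadicAt n x}) (Q' := dyadicAt n x)
    (c := (2 : ℝ)⁻¹ ^ m)
    (hP.finite.subset fun Q hQ => hQ.1) (fun Q hQ => (hP.isSubcube Q hQ.1).1)
    (fun Q hQ Q' hQ' => hP.disjoint Q hQ.1 Q' hQ'.1) (volume_dyadicAt_ne_top n x)
    (hpos₁.trans_le (measure_mono (by rw [e₁]; exact dyadicAt_antitone x n.le_succ)))
    (fun Q hQ => hQ.2) (hvolpos n x) (fun Q hQ => by
      refine le_trans (le_of_eq ?_) (hmin Q hQ.1)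
      rw [e₁, volume_real_dyadicAt, volume_real_dyadicAt, ← mul_pow, ← mul_inv, pow_succ']) (by
      -- A selected cube meeting the parent lies inside it: it has weight below `t` and the parent
      -- does not, so it comes later in the chain of `y`.
      filter_upwards [hP.cover] with y ⟨Q, hQ, hyQ⟩ hy
      refine ⟨Q, ⟨hQ, ?_⟩, hyQ⟩
      obtain ⟨-, n', -, hall'⟩ := (mem_levelPartition_iff hν).1 hQ
      obtain ⟨e', h1', -⟩ := hall' y hyQ
      rw [← dyadicAt_eq_of_mem hy] at h2 ⊢
      rw [e']
      refine dyadicAt_antitone y ?_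
      by_contra hlt
      have := cubeWeight_dyadicAt_antitone (s := s) (p := p) (q := q) (ν := ν) h.le y
        (show n' + 1 ≤ n by lia)
      simp only at this
      linarith)
  have hw₂ := mul_cubeWeight_le (s := s) (p := p) (q := q) (ν := ν) (by positivity) h.le hν₂
    (by
      refine le_trans (le_of_eq ?_) (hmin Q₂ hQ₂)
      rw [e₁, volume_real_dyadicAt, volume_real_dyadicAt, ← mul_pow, ← mul_inv, pow_succ'])
  obtain ⟨hpos₂, n₂, ⟨x₂, hxQ₂, -⟩, hall₂⟩ := (mem_levelPartition_iff hν).1 hQ₂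
  have e₂ := (hall₂ x₂ hxQ₂).1
  obtain ⟨Q₃, ⟨hQ₃, hsub₃⟩, hν₃⟩ := exists_large_piece (ν := ν)
    (S := {Q | Q ∈ levelPartition s p q ν t' ∧ Q ⊆ Q₂}) (Q' := Q₂) (c := c)
    (hP'.finite.subset fun Q hQ => hQ.1) (fun Q hQ => (hP'.isSubcube Q hQ.1).1)
    (fun Q hQ Q' hQ' => hP'.disjoint Q hQ.1 Q' hQ'.1) (by rw [e₂]; exact volume_dyadicAt_ne_top _ _)
    hpos₂ (fun Q hQ => hQ.2) (by rw [e₂]; exact hvolpos _ _)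
    (fun Q hQ => hratio Q hQ.1 Q₂ hQ₂ hQ.2) (by
      filter_upwards [hP'.cover] with y ⟨Q, hQ, hyQ⟩ hy
      obtain ⟨Q'', hQ'', hsub⟩ := levelPartition_nested hν htt ht' hQ
      have := hP.disjoint Q'' hQ'' Q₂ hQ₂ y (hsub hyQ) hy
      exact ⟨Q, ⟨hQ, this ▸ hsub⟩, hyQ⟩)
  have hw₃ := mul_cubeWeight_le (s := s) (p := p) (q := q) (ν := ν) hc h.le hν₃
    (hratio Q₃ hQ₃ Q₂ hQ₂ hsub₃)
  have hlt : cubeWeight s p q ν Q₃ < t' := hQ₃.choose_spec.2.1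
  set a := (2 : ℝ)⁻¹ ^ m * ((2 : ℝ)⁻¹ ^ m) ^ (q.toReal * rhoHat m s p / m)
  set b := c * c ^ (q.toReal * rhoHat m s p / m)
  have hb : 0 ≤ b := by positivity
  have ha : 0 ≤ a := by positivity
  calc a * b * t = b * (a * t) := by ring
    _ ≤ b * (a * cubeWeight s p q ν (dyadicAt n x)) := by gcongr
    _ ≤ b * cubeWeight s p q ν Q₂ := by gcongr
    _ ≤ cubeWeight s p q ν Q₃ := hw₃
    _ ≤ t' := hlt.le

end Dyadic

end SobolevWidths

namespace SobolevWidths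

/-! ### A common interface for the level partitions (`q < ∞`) and the uniform dyadic ones (`q = ∞`).
-/

section PartitionSequences

variable {m : ℕ}

/-- A refining sequence of cube partitions together with admissible scale factors. -/
structure IsPartitionSequence (s : ℕ) (p q : ℝ≥0∞) (ν : Measure (Fin m → ℝ))
    (P : ℕ → Set (Set (Fin m → ℝ))) (T : ℕ → ℝ) : Prop where
  isCubePartition : ∀ k, IsCubePartition ν (P k)
  nested : ∀ k, ∀ Q ∈ P (k + 1), ∃ Q' ∈ P k, Q ⊆ Q'
  ratio : ∃ c > 0, ∀ k, ∀ Q ∈ P (k + 1), ∀ Q' ∈ P k, Q ⊆ Q' → c * volume.real Q' ≤ volume.real Q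
  scale_pos : ∀ k, 0 < T k
  scale_ratio : ∃ D > 0, ∀ k, T k ≤ D * T (k + 1)
  weight_le : ∀ k, ∀ Q ∈ P k, ν.real Q ^ (q.toReal)⁻¹ * volume.real Q ^ (rhoHat m s p / m) ≤ T k
  volume_small : ∀ ε > 0, ∀ᶠ k in atTop, ∀ Q ∈ P k, volume.real Q < ε

variable {s : ℕ} {p q : ℝ≥0∞} {ν : Measure (Fin m → ℝ)} {t : ℕ → ℝ} {j : ℕ → ℕ}

theorem isPartitionSequence_level [IsFiniteMeasure ν] (hm : 0 < m) (hρ : 0 < rhoHat m s p) (hq : q ≠ ∞)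
    [hq1 : Fact (1 ≤ q)] (hν : ν (openCube m)ᶜ = 0) (hν0 : ν ≠ 0)
    (ht_pos : ∀ k, 0 < t k) (ht_anti : Antitone t) (ht_lim : Tendsto t atTop (𝓝 0))
    (ht0 : t 0 ≤ ν.real Set.univ) {R : ℝ}
    (hR : ∀ k : ℕ, ∀ Q ∈ levelPartition s p q ν (t (k + 1)),
      ∀ Q' ∈ levelPartition s p q ν (t k), Q ⊆ Q' →
      |Real.logb 2 (volume.real Q) - Real.logb 2 (volume.real Q')| ≤ R) :
    IsPartitionSequence s p q ν (fun k => levelPartition s p q ν (t k))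
      (fun k => t k ^ (1 / q.toReal)) := by
  have hm' : (0 : ℝ) < m := by exact_mod_cast hm
  have hq0 : 0 < q.toReal := ENNReal.toReal_pos (one_pos.trans_le hq1.out).ne' hq
  have h : 0 < q.toReal * rhoHat m s p / m := by positivity
  have htk : ∀ k, t k ≤ ν.real Set.univ := fun k => (ht_anti (Nat.zero_le k)).trans ht0
  have hpart : ∀ k, IsCubePartition ν (levelPartition s p q ν (t k)) := fun k =>
    isCubePartition_levelPartition hm h hν (ht_pos k) (htk k)
  have hvol : ∀ k, ∀ Q ∈ levelPartition s p q ν (t k), 0 < volume.real Q := fun k Q hQ => by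
    obtain ⟨-, c, r, hr, -, -, -, e⟩ := (hpart k).isSubcube Q hQ
    rw [e]; positivity
  have hratio : ∀ k, ∀ Q ∈ levelPartition s p q ν (t (k + 1)), ∀ Q' ∈ levelPartition s p q ν (t k),
      Q ⊆ Q' → (2 : ℝ) ^ (-R) * volume.real Q' ≤ volume.real Q := fun k Q hQ Q' hQ' hsub => by
    have h1 := (abs_le.1 (hR k Q hQ Q' hQ' hsub)).1
    have h2 : -R + Real.logb 2 (volume.real Q') ≤ Real.logb 2 (volume.real Q) := by linarith
    have h3 := Real.rpow_le_rpow_of_exponent_le (one_le_two (α := ℝ)) h2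
    rwa [Real.rpow_add two_pos, Real.rpow_logb two_pos (by norm_num) (hvol _ Q' hQ'),
      Real.rpow_logb two_pos (by norm_num) (hvol _ Q hQ)] at h3
  refine ⟨hpart, fun k Q hQ => ?_, ⟨(2 : ℝ) ^ (-R), by positivity, hratio⟩,
    fun k => Real.rpow_pos_of_pos (ht_pos k) _, ?_, fun k Q hQ => ?_, fun ε hε =>
    eventually_volume_lt hm hν ht_lim hε⟩
  · exact levelPartition_nested hν (ht_anti k.le_succ) (htk k) hQ
  -- The constant of `level_ratio` with `c = 2^{-R}`; taking `q`-th roots turns it into the bound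
  -- for the scale factors.
  · set a := (((2 : ℝ)⁻¹ ^ m) * ((2 : ℝ)⁻¹ ^ m) ^ (q.toReal * rhoHat m s p / m)) *
      ((2 : ℝ) ^ (-R) * ((2 : ℝ) ^ (-R)) ^ (q.toReal * rhoHat m s p / m))
    have ha : 0 < a := by positivity
    refine ⟨(a⁻¹) ^ (1 / q.toReal), by positivity, fun k => ?_⟩
    have hk : a * t k ≤ t (k + 1) := level_ratio hm h hν hν0 (ht_pos (k + 1)) (ht_anti k.le_succ)
      (htk k) (by positivity) (hratio k)
    rw [← Real.mul_rpow (by positivity) (ht_pos _).le]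
    refine Real.rpow_le_rpow (ht_pos _).le ?_ (by positivity)
    rwa [le_inv_mul_iff₀ ha]
  · have hlt : cubeWeight s p q ν Q < t k := hQ.choose_spec.2.1
    have h0 : 0 ≤ cubeWeight s p q ν Q := by unfold cubeWeight; positivity
    refine le_trans (le_of_eq ?_) (Real.rpow_le_rpow h0 hlt.le (by positivity :
      0 ≤ 1 / q.toReal))
    rw [cubeWeight, Real.mul_rpow measureReal_nonneg (by positivity), ← Real.rpow_mul
      measureReal_nonneg, one_div]
    congr 2
    field_simp

theorem isPartitionSequence_dyadic (hm : 0 < m) (hρ : 0 < rhoHat m s p)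
    (hν : ν (openCube m)ᶜ = 0) (hj_pos : ∀ k, 1 ≤ j k) (hj_mono : StrictMono j) {R : ℕ}
    (hR : ∀ k, j (k + 1) ≤ j k + R) :
    IsPartitionSequence s p ∞ ν (fun k => dyadicCubes ν (j k))
      (fun k => (2 : ℝ) ^ (-((k : ℝ) + 1) * rhoHat m s p)) := by
  have hjk : ∀ k, k + 1 ≤ j k := fun k => by
    induction k with
    | zero => exact hj_pos 0
    | succ k ih => have := hj_mono k.lt_succ_self; lia
  have hm' : (0 : ℝ) < m := by exact_mod_cast hm
  have hvol : ∀ n, ∀ Q ∈ dyadicCubes ν n, volume.real Q = ((2 ^ n : ℝ)⁻¹) ^ m := by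
    rintro n Q ⟨⟨l, rfl⟩, -⟩
    exact volume_real_dyadicCube n l
  refine ⟨fun k => isCubePartition_dyadicCubes hν (j k), fun k Q hQ => ?_,
    ⟨((2 ^ R : ℝ)⁻¹) ^ m, by positivity, fun k Q hQ Q' hQ' _ => ?_⟩, fun k => by positivity,
    ⟨2 ^ rhoHat m s p, by positivity, fun k => le_of_eq ?_⟩, fun k Q hQ => ?_, fun ε hε => ?_⟩
  · obtain ⟨hpos, x, -, rfl⟩ := (mem_dyadicCubes_iff _ Q hν).1 hQ
    have hsub := dyadicAt_antitone x (hj_mono k.lt_succ_self).le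
    exact ⟨dyadicAt (j k) x, ⟨⟨_, rfl⟩, hpos.trans_le (measure_mono hsub)⟩, hsub⟩
  · rw [hvol _ Q hQ, hvol _ Q' hQ', ← mul_pow, ← mul_inv, ← pow_add]
    have : (2 : ℝ) ^ j (k + 1) ≤ 2 ^ (R + j k) :=
      pow_le_pow_right₀ one_le_two (by have := hR k; lia)
    gcongr
  · rw [← Real.rpow_add two_pos]
    congr 1
    push_cast
    ring
  -- For `q = ∞` the exponent `(q.toReal)⁻¹` is `0`, so the mass factor is `1`; the rest is `2^{-j_k
  -- ϱ̂}`, and `k + 1 ≤ j k`.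
  · rw [hvol _ Q hQ, ENNReal.toReal_top, inv_zero, Real.rpow_zero, one_mul, ← Real.rpow_natCast,
      ← Real.rpow_mul (by positivity), mul_div_cancel₀ _ hm'.ne', ← Real.rpow_natCast,
      ← Real.rpow_neg two_pos.le, ← Real.rpow_mul two_pos.le]
    refine Real.rpow_le_rpow_of_exponent_le one_le_two ?_
    have : (k : ℝ) + 1 ≤ j k := by exact_mod_cast hjk k
    nlinarith
  · have h1 : Tendsto (fun n : ℕ => (((2 : ℝ)⁻¹) ^ m) ^ n) atTop (𝓝 0) :=
      tendsto_pow_atTop_nhds_zero_of_lt_one (by positivity) (pow_lt_one₀ (by norm_num)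
        (by norm_num) hm.ne')
    have h2 := h1.comp hj_mono.tendsto_atTop
    filter_upwards [h2.eventually_lt_const hε] with k hk Q hQ
    rw [hvol _ Q hQ]
    simp only [Function.comp_apply] at hk
    rwa [← pow_mul, mul_comm, pow_mul, inv_pow] at hk

theorem exists_isPartitionSequence [IsFiniteMeasure ν] (hm : 0 < m) (hρ : 0 < rhoHat m s p) [Fact (1 ≤ q)]
    (hν : ν (openCube m)ᶜ = 0) (hν0 : ν ≠ 0)
    (ht_pos : ∀ k, 0 < t k) (ht_anti : Antitone t) (ht_lim : Tendsto t atTop (𝓝 0))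
    (hj_pos : ∀ k, 1 ≤ j k) (hj_mono : StrictMono j) (hgap : BoundedLevelGap s p q ν t j) :
    ∃ k₀, IsPartitionSequence s p q ν (fun k => partition s p q ν t j (k₀ + k))
      (fun k => (scaleFactor m s p q t (k₀ + k)).toReal) := by
  obtain ⟨hlevel, R, hR⟩ := hgap
  rcases eq_or_ne q ∞ with rfl | hq
  · refine ⟨0, ?_⟩
    convert isPartitionSequence_dyadic (ν := ν) hm hρ hν hj_pos hj_mono hR using 2 with k k
    · simp [partition]
    · rw [scaleFactor, if_pos rfl, ENNReal.toReal_ofReal (by positivity), zero_add]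
  · obtain ⟨R', hR'⟩ := hlevel hq
    have hνpos : 0 < ν.real Set.univ := by
      rw [measureReal_def]
      exact ENNReal.toReal_pos (by simpa using hν0) (measure_ne_top _ _)
    -- From `k₀` on, `t k` is below the total mass and the level sets really are partitions.
    obtain ⟨k₀, hk₀⟩ := (ht_lim.eventually_lt_const hνpos).exists
    refine ⟨k₀, ?_⟩
    convert isPartitionSequence_level (ν := ν) (t := fun k => t (k₀ + k)) hm hρ hq hν hν0
      (fun k => ht_pos _) (fun a b hab => ht_anti (by lia))
      (ht_lim.comp (tendsto_add_atTop_nat k₀ |>.congr fun k => add_comm _ _))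
      (by simpa using hk₀.le) (fun k => hR' (k₀ + k)) using 2 with k k
    · simp [partition, hq]
    · rw [scaleFactor, if_neg hq, ENNReal.toReal_ofReal (Real.rpow_nonneg (ht_pos _).le _)]

end PartitionSequences

end SobolevWidths

namespace SobolevWidths

/-! ### Comparison of sequence norms with each other and with local `L^q`-norms. -/

section SequenceNorms

variable {q : ℝ≥0∞} [hq1 : Fact (1 ≤ q)] {ι ι' : Type*} [Fintype ι] [Fintype ι']

theorem toReal_pos_of_fact (hq : q ≠ ∞) : 0 < q.toReal :=
  ENNReal.toReal_pos (one_pos.trans_le hq1.out).ne' hq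

/-- If `|y i| ≤ B F(φ i)` and the fibres of `φ` have at most `K` elements then
`‖y‖ ≤ B K ‖F‖`. -/
theorem norm_toLp_le_of_fiber [DecidableEq ι'] (y : ι → ℝ) (F : ι' → ℝ) (φ : ι → ι') {B K : ℝ} (hB : 0 ≤ B)
    (hK : 1 ≤ K) (hcard : ∀ j, ((Finset.univ.filter fun i => φ i = j).card : ℝ) ≤ K)
    (hy : ∀ i, |y i| ≤ B * |F (φ i)|) :
    ‖(WithLp.toLp q y : PiLp q (fun _ : ι => ℝ))‖ ≤
      B * K * ‖(WithLp.toLp q F : PiLp q (fun _ : ι' => ℝ))‖ := by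
  rcases eq_or_ne q ∞ with rfl | hq
  · have hF : ∀ j, |F j| ≤ ‖(WithLp.toLp ∞ F : PiLp ∞ (fun _ : ι' => ℝ))‖ := fun j =>
      PiLp.norm_apply_le (WithLp.toLp ∞ F : PiLp ∞ (fun _ : ι' => ℝ)) j
    rw [PiLp.norm_toLp, pi_norm_le_iff_of_nonneg (by positivity)]
    intro i
    refine (hy i).trans ?_
    calc B * |F (φ i)| ≤ B * 1 * ‖(WithLp.toLp ∞ F : PiLp ∞ (fun _ : ι' => ℝ))‖ := by
          rw [mul_one]; exact mul_le_mul_of_nonneg_left (hF _) hB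
      _ ≤ _ := by gcongr
  · have hr := toReal_pos_of_fact hq
    set r := q.toReal
    have hr1 : 1 ≤ r := by
      have := ENNReal.toReal_mono hq hq1.out
      simpa using this
    rw [PiLp.norm_eq_sum hr, PiLp.norm_eq_sum hr]
    simp only [Real.norm_eq_abs]
    have h1 : ∑ i, |y i| ^ r ≤ B ^ r * (K * ∑ j, |F j| ^ r) := by
      calc ∑ i, |y i| ^ r ≤ ∑ i, B ^ r * |F (φ i)| ^ r := by
            refine Finset.sum_le_sum fun i _ => ?_
            rw [← Real.mul_rpow hB (abs_nonneg _)]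
            exact Real.rpow_le_rpow (abs_nonneg _) (hy i) hr.le
        _ = B ^ r * ∑ j, ∑ i ∈ Finset.univ.filter (fun i => φ i = j), |F (φ i)| ^ r := by
            rw [← Finset.mul_sum, Finset.sum_fiberwise]
        _ ≤ B ^ r * ∑ j, K * |F j| ^ r := by
            refine mul_le_mul_of_nonneg_left (Finset.sum_le_sum fun j _ => ?_) (by positivity)
            have h2 : ∑ i ∈ Finset.univ.filter (fun i => φ i = j), |F (φ i)| ^ r =
                ∑ i ∈ Finset.univ.filter (fun i => φ i = j), |F j| ^ r :=
              Finset.sum_congr rfl fun i hi => by rw [(Finset.mem_filter.1 hi).2]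
            rw [h2, Finset.sum_const, nsmul_eq_mul]
            exact mul_le_mul_of_nonneg_right (hcard j) (by positivity)
        _ = B ^ r * (K * ∑ j, |F j| ^ r) := by simp only [Finset.mul_sum]
    refine (Real.rpow_le_rpow (by positivity) h1 (by positivity)).trans ?_
    rw [Real.mul_rpow (by positivity) (by positivity), Real.mul_rpow (by positivity)
      (by positivity), ← Real.rpow_mul hB, mul_one_div_cancel hr.ne', Real.rpow_one, ← mul_assoc]
    refine mul_le_mul_of_nonneg_right (mul_le_mul_of_nonneg_left ?_ hB) (by positivity)
    -- The natural factor is `K^{1/r}`; since `K ≥ 1` and `r ≥ 1` it is at most `K`, a bound that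
    -- also covers the case `∞`.
    exact (Real.rpow_le_rpow_of_exponent_le hK (by rw [div_le_one hr]; exact hr1)).trans
      (Real.rpow_one K).le

theorem norm_toLp_le_of_injective (y : ι → ℝ) (F : ι' → ℝ) {φ : ι → ι'} {B : ℝ} (hB : 0 ≤ B)
    (hφ : Function.Injective φ) (hy : ∀ i, |y i| ≤ B * |F (φ i)|) :
    ‖(WithLp.toLp q y : PiLp q (fun _ : ι => ℝ))‖ ≤
      B * ‖(WithLp.toLp q F : PiLp q (fun _ : ι' => ℝ))‖ := by
  classical
  have := norm_toLp_le_of_fiber (q := q) y F φ hB le_rfl (fun j => ?_) hy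
  · simpa using this
  · have : (Finset.univ.filter fun i => φ i = j).card ≤ 1 :=
      Finset.card_le_one.2 fun a ha b hb =>
        hφ ((Finset.mem_filter.1 ha).2.trans (Finset.mem_filter.1 hb).2.symm)
    exact_mod_cast this

variable {α : Type*} [MeasurableSpace α] {μ : Measure α} {g : α → ℝ} {Q : ι → Set α}

theorem norm_toLp_eLpNorm_of_ne_top (hq : q ≠ ∞) (hg : eLpNorm g q μ ≠ ∞) :
    ‖(WithLp.toLp q fun i => (eLpNorm g q (μ.restrict (Q i))).toReal : PiLp q (fun _ : ι => ℝ))‖ =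
      ((∑ i, ∫⁻ x in Q i, ‖g x‖ₑ ^ q.toReal ∂μ) ^ (1 / q.toReal)).toReal := by
  have hr := toReal_pos_of_fact hq
  have hq0 : q ≠ 0 := (one_pos.trans_le hq1.out).ne'
  have hfin : ∀ i, ∫⁻ x in Q i, ‖g x‖ₑ ^ q.toReal ∂μ ≠ ∞ := fun i => by
    have h1 : eLpNorm g q (μ.restrict (Q i)) ≠ ∞ :=
      ((eLpNorm_mono_measure g Measure.restrict_le_self).trans_lt hg.lt_top).ne
    rw [eLpNorm_eq_lintegral_rpow_enorm_toReal hq0 hq] at h1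
    intro h2
    rw [h2, ENNReal.top_rpow_of_pos (by positivity)] at h1
    exact h1 rfl
  rw [PiLp.norm_eq_sum hr, ← ENNReal.toReal_rpow, ENNReal.toReal_sum fun i _ => hfin i]
  congr 1
  refine Finset.sum_congr rfl fun i _ => ?_
  rw [Real.norm_of_nonneg ENNReal.toReal_nonneg, eLpNorm_eq_lintegral_rpow_enorm_toReal hq0 hq,
    ENNReal.toReal_rpow, ← ENNReal.rpow_mul, one_div_mul_cancel hr.ne', ENNReal.rpow_one]

theorem norm_toLp_eLpNorm_restrict_le (hg : eLpNorm g q μ ≠ ∞) (hQ : ∀ i, MeasurableSet (Q i))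
    (hd : Pairwise (Function.onFun Disjoint Q)) :
    ‖(WithLp.toLp q fun i => (eLpNorm g q (μ.restrict (Q i))).toReal : PiLp q (fun _ : ι => ℝ))‖ ≤
      (eLpNorm g q μ).toReal := by
  have hq0 : q ≠ 0 := (one_pos.trans_le hq1.out).ne'
  by_cases hq : q = ∞
  · subst hq
    rw [PiLp.norm_toLp, pi_norm_le_iff_of_nonneg ENNReal.toReal_nonneg]
    intro i
    rw [Real.norm_of_nonneg ENNReal.toReal_nonneg]
    exact ENNReal.toReal_mono hg (eLpNorm_mono_measure g Measure.restrict_le_self)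
  · rw [norm_toLp_eLpNorm_of_ne_top hq hg]
    refine ENNReal.toReal_mono hg ?_
    rw [eLpNorm_eq_lintegral_rpow_enorm_toReal hq0 hq]
    refine ENNReal.rpow_le_rpow ?_ (by positivity)
    rw [← tsum_fintype (L := .unconditional _), ← lintegral_iUnion hQ hd]
    exact setLIntegral_le_lintegral _ _

theorem eLpNorm_le_norm_toLp_restrict (hg : eLpNorm g q μ ≠ ∞) (hQ : ∀ i, MeasurableSet (Q i))
    (hd : Pairwise (Function.onFun Disjoint Q)) (hcov : ∀ᵐ x ∂μ, ∃ i, x ∈ Q i) :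
    (eLpNorm g q μ).toReal ≤ ‖(WithLp.toLp q fun i => (eLpNorm g q (μ.restrict (Q i))).toReal :
      PiLp q (fun _ : ι => ℝ))‖ := by
  have hq0 : q ≠ 0 := (one_pos.trans_le hq1.out).ne'
  by_cases hq : q = ∞
  · subst hq
    set N := ‖(WithLp.toLp ∞ fun i => (eLpNorm g ∞ (μ.restrict (Q i))).toReal :
      PiLp ∞ (fun _ : ι => ℝ))‖
    have hN : ∀ i, (eLpNorm g ∞ (μ.restrict (Q i))).toReal ≤ N := fun i => by
      have := PiLp.norm_apply_le (WithLp.toLp ∞ fun i => (eLpNorm g ∞ (μ.restrict (Q i))).toReal :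
        PiLp ∞ (fun _ : ι => ℝ)) i
      rwa [Real.norm_of_nonneg ENNReal.toReal_nonneg] at this
    have hall : ∀ᵐ x ∂μ, ∀ i, x ∈ Q i → ‖g x‖ₑ ≤ ENNReal.ofReal N := by
      rw [ae_all_iff]
      intro i
      rw [← ae_restrict_iff' (hQ i)]
      filter_upwards [ae_le_eLpNormEssSup (f := g) (μ := μ.restrict (Q i))] with x hx
      refine hx.trans ?_
      rw [← eLpNorm_exponent_top]
      refine (ENNReal.le_ofReal_iff_toReal_le ?_ (norm_nonneg _)).2 (hN i)
      exact ((eLpNorm_mono_measure g Measure.restrict_le_self).trans_lt hg.lt_top).ne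
    refine ENNReal.toReal_le_of_le_ofReal (norm_nonneg _) ?_
    rw [eLpNorm_exponent_top]
    refine eLpNormEssSup_le_of_ae_enorm_bound ?_
    filter_upwards [hall, hcov] with x hx ⟨i, hi⟩
    exact hx i hi
  · rw [norm_toLp_eLpNorm_of_ne_top hq hg]
    refine le_of_eq ?_
    rw [eLpNorm_eq_lintegral_rpow_enorm_toReal hq0 hq, ← tsum_fintype (L := .unconditional _),
      ← lintegral_iUnion hQ hd]
    congr 2
    rw [← setLIntegral_univ]
    refine setLIntegral_congr (Filter.EventuallyEq.symm (ae_eq_univ.2 ?_))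
    have : (⋃ i, Q i)ᶜ = {x | ¬ ∃ i, x ∈ Q i} := by ext; simp
    rw [this]
    exact ae_iff.1 hcov

end SequenceNorms

/-! ### Restriction to a set as a contraction of `L^q`. -/

section Cutoff

variable {α : Type*} [MeasurableSpace α] {μ : Measure α} {q : ℝ≥0∞} [Fact (1 ≤ q)]

/-- Multiplication by the indicator function of `A`, as a contraction of `L^q`. -/
noncomputable def cutoff (q : ℝ≥0∞) [Fact (1 ≤ q)] (μ : Measure α) {A : Set α}
    (hA : MeasurableSet A) : Lp ℝ q μ →L[ℝ] Lp ℝ q μ :=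
  LinearMap.mkContinuous
    { toFun := fun u => ((Lp.memLp u).indicator hA).toLp _
      map_add' := fun u v => by
        rw [← MemLp.toLp_add]
        refine MemLp.toLp_congr _ _ ?_
        filter_upwards [Lp.coeFn_add u v] with x hx
        rw [Pi.add_apply]
        by_cases hxA : x ∈ A
        · rw [Set.indicator_of_mem hxA, Set.indicator_of_mem hxA, Set.indicator_of_mem hxA, hx,
            Pi.add_apply]
        · rw [Set.indicator_of_notMem hxA, Set.indicator_of_notMem hxA,
            Set.indicator_of_notMem hxA, add_zero]
      map_smul' := fun c u => by
        rw [RingHom.id_apply, ← MemLp.toLp_const_smul]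
        refine MemLp.toLp_congr _ _ ?_
        filter_upwards [Lp.coeFn_smul c u] with x hx
        rw [Pi.smul_apply]
        by_cases hxA : x ∈ A
        · rw [Set.indicator_of_mem hxA, Set.indicator_of_mem hxA, hx, Pi.smul_apply]
        · rw [Set.indicator_of_notMem hxA, Set.indicator_of_notMem hxA, smul_zero] } 1 fun u => by
    rw [one_mul]
    change ‖((Lp.memLp u).indicator hA).toLp (A.indicator u)‖ ≤ ‖u‖
    rw [Lp.norm_toLp, Lp.norm_def]
    exact ENNReal.toReal_mono (Lp.eLpNorm_ne_top u) (eLpNorm_indicator_le _)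

theorem cutoff_apply {A : Set α} (hA : MeasurableSet A) (u : Lp ℝ q μ) :
    cutoff q μ hA u = ((Lp.memLp u).indicator hA).toLp (A.indicator u) := rfl

theorem cutoff_coeFn {A : Set α} (hA : MeasurableSet A) (u : Lp ℝ q μ) :
    cutoff q μ hA u =ᵐ[μ] A.indicator u := by
  rw [cutoff_apply]
  exact MemLp.coeFn_toLp _

theorem norm_cutoff {A : Set α} (hA : MeasurableSet A) (u : Lp ℝ q μ) :
    ‖cutoff q μ hA u‖ = (eLpNorm u q (μ.restrict A)).toReal := by
  rw [cutoff_apply, Lp.norm_toLp, eLpNorm_indicator_eq_eLpNorm_restrict hA]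

theorem norm_cutoff_le {A : Set α} (hA : MeasurableSet A) (u : Lp ℝ q μ) :
    ‖cutoff q μ hA u‖ ≤ ‖u‖ := by
  rw [norm_cutoff, Lp.norm_def]
  exact ENNReal.toReal_mono (Lp.eLpNorm_ne_top u)
    (eLpNorm_mono_measure _ Measure.restrict_le_self)

theorem cutoff_cutoff_of_subset {A B : Set α} (hA : MeasurableSet A) (hB : MeasurableSet B)
    (hAB : A ⊆ B) (u : Lp ℝ q μ) : cutoff q μ hA (cutoff q μ hB u) = cutoff q μ hA u := by
  refine Lp.ext ?_
  filter_upwards [cutoff_coeFn hA (cutoff q μ hB u), cutoff_coeFn hB u, cutoff_coeFn hA u]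
    with x h1 h2 h3
  rw [h1, h3]
  by_cases hx : x ∈ A
  · simp [hx, h2, hAB hx]
  · simp [hx]

theorem cutoff_cutoff_of_disjoint {A B : Set α} (hA : MeasurableSet A) (hB : MeasurableSet B)
    (hAB : Disjoint A B) (u : Lp ℝ q μ) : cutoff q μ hA (cutoff q μ hB u) = 0 := by
  refine Lp.ext ?_
  filter_upwards [cutoff_coeFn hA (cutoff q μ hB u), cutoff_coeFn hB u, Lp.coeFn_zero ℝ q μ]
    with x h1 h2 h3
  rw [h1, h3]
  by_cases hx : x ∈ A
  · simp [hx, h2, Set.disjoint_left.1 hAB hx]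
  · simp [hx]

theorem sum_cutoff {ι : Type*} [Fintype ι] {Q : ι → Set α} (hQ : ∀ i, MeasurableSet (Q i))
    (hd : Pairwise (Function.onFun Disjoint Q)) (hcov : ∀ᵐ x ∂μ, ∃ i, x ∈ Q i) (u : Lp ℝ q μ) :
    ∑ i, cutoff q μ (hQ i) u = u := by
  refine Lp.ext ?_
  have h1 : ∀ᵐ x ∂μ, ∀ i, cutoff q μ (hQ i) u x = (Q i).indicator u x :=
    ae_all_iff.2 fun i => cutoff_coeFn (hQ i) u
  filter_upwards [h1, hcov, Lp.coeFn_finsetSum Finset.univ fun i => cutoff q μ (hQ i) u]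
    with x hx ⟨i, hi⟩ hs
  rw [hs, Finset.sum_apply, Finset.sum_eq_single i]
  · rw [hx i, Set.indicator_of_mem hi]
  · intro k _ hk
    rw [hx k, Set.indicator_of_notMem (Set.disjoint_left.1 (hd hk.symm) hi)]
  · simp

theorem norm_le_norm_toLp_cutoff {ι : Type*} [Fintype ι] {Q : ι → Set α}
    (hQ : ∀ i, MeasurableSet (Q i)) (hd : Pairwise (Function.onFun Disjoint Q))
    (hcov : ∀ᵐ x ∂μ, ∃ i, x ∈ Q i) (u : Lp ℝ q μ) :
    ‖u‖ ≤ ‖(WithLp.toLp q fun i => ‖cutoff q μ (hQ i) u‖ : PiLp q (fun _ : ι => ℝ))‖ := by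
  simp only [norm_cutoff]
  exact eLpNorm_le_norm_toLp_restrict (Lp.eLpNorm_ne_top u) hQ hd hcov

theorem norm_cutoff_sub_le [IsFiniteMeasure μ] {A : Set α} (hA : MeasurableSet A) {u v : Lp ℝ q μ}
    {a : ℝ} (ha : 0 ≤ a) (h : ∀ᵐ x ∂μ, x ∈ A → |u x - v x| ≤ a) :
    ‖cutoff q μ hA (u - v)‖ ≤ μ.real A ^ (q.toReal)⁻¹ * a := by
  rw [norm_cutoff]
  refine ENNReal.toReal_le_of_le_ofReal (by positivity) ?_
  have h1 : ∀ᵐ x ∂(μ.restrict A), ‖(u - v : Lp ℝ q μ) x‖ ≤ a := by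
    rw [ae_restrict_iff' hA]
    filter_upwards [h, Lp.coeFn_sub u v] with x hx hs hxA
    rw [hs]
    exact hx hxA
  refine (eLpNorm_le_of_ae_bound h1).trans (le_of_eq ?_)
  rw [Measure.restrict_apply_univ, ENNReal.ofReal_mul (by positivity), measureReal_def,
    ENNReal.toReal_rpow, ENNReal.ofReal_toReal]
  exact ENNReal.rpow_ne_top_of_nonneg (by positivity) (measure_ne_top _ _)

end Cutoff

end SobolevWidths

namespace SobolevWidths

/-! ### Polynomial projections on a single cube. -/

section LocalProjections

variable {m : ℕ} {q : ℝ≥0∞} [Fact (1 ≤ q)] {ν : Measure (Fin m → ℝ)} [IsFiniteMeasure ν]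
  {Q Q' : Set (Fin m → ℝ)}

theorem memLp_indicator_eval (q : ℝ≥0∞) (ν : Measure (Fin m → ℝ)) [IsFiniteMeasure ν]
    (hQ : IsSubcube Q) (P : MvPolynomial (Fin m) ℝ) :
    MemLp (Q.indicator fun x => MvPolynomial.eval x P) q ν := by
  obtain ⟨hmeas, c, r, -, -, -, hsub, -⟩ := hQ
  have hc : Continuous fun x => MvPolynomial.eval x P := MvPolynomial.continuous_eval P
  obtain ⟨C, hC⟩ := (isCompact_closedBall c r).exists_bound_of_continuousOn hc.continuousOn
  refine MemLp.of_bound (hc.measurable.indicator hmeas).aestronglyMeasurable (max C 0)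
    (Eventually.of_forall fun x => ?_)
  by_cases hx : x ∈ Q
  · rw [Set.indicator_of_mem hx]
    exact (hC x (hsub hx)).trans (le_max_left _ _)
  · rw [Set.indicator_of_notMem hx, norm_zero]
    exact le_max_right _ _

/-- The linear map sending a polynomial to its restriction to `Q`, extended by zero. -/
noncomputable def polyOn (s : ℕ) (q : ℝ≥0∞) [Fact (1 ≤ q)] (ν : Measure (Fin m → ℝ))
    [IsFiniteMeasure ν] (hQ : IsSubcube Q) :
    MvPolynomial.restrictTotalDegree (Fin m) ℝ s →ₗ[ℝ] Lp ℝ q ν where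
  toFun P := (memLp_indicator_eval q ν hQ P).toLp (Q.indicator fun x => MvPolynomial.eval x P.1)
  map_add' P P' := by
    rw [← MemLp.toLp_add]
    refine MemLp.toLp_congr _ _ (Eventually.of_forall fun x => ?_)
    rw [Pi.add_apply]
    by_cases hx : x ∈ Q <;> simp [hx]
  map_smul' c P := by
    rw [RingHom.id_apply, ← MemLp.toLp_const_smul]
    refine MemLp.toLp_congr _ _ (Eventually.of_forall fun x => ?_)
    rw [Pi.smul_apply]
    by_cases hx : x ∈ Q <;> simp [hx]

theorem polyOn_coeFn {s : ℕ} (hQ : IsSubcube Q)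
    (P : MvPolynomial.restrictTotalDegree (Fin m) ℝ s) :
    polyOn s q ν hQ P =ᵐ[ν] Q.indicator fun x => MvPolynomial.eval x P.1 :=
  MemLp.coeFn_toLp (memLp_indicator_eval q ν hQ P.1)

theorem cutoff_polyOn {s : ℕ} (hQ : IsSubcube Q)
    (P : MvPolynomial.restrictTotalDegree (Fin m) ℝ s) :
    cutoff q ν hQ.1 (polyOn s q ν hQ P) = polyOn s q ν hQ P := by
  refine Lp.ext ?_
  filter_upwards [cutoff_coeFn hQ.1 (polyOn s q ν hQ P), polyOn_coeFn (q := q) (ν := ν) hQ P]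
    with x h1 h2
  rw [h1]
  by_cases hx : x ∈ Q <;> simp [hx, h2]

theorem cutoff_polyOn_of_subset {s : ℕ} (hQ : IsSubcube Q) (hQ' : IsSubcube Q') (h : Q ⊆ Q')
    (P : MvPolynomial.restrictTotalDegree (Fin m) ℝ s) :
    cutoff q ν hQ.1 (polyOn s q ν hQ' P) = polyOn s q ν hQ P := by
  refine Lp.ext ?_
  filter_upwards [cutoff_coeFn hQ.1 (polyOn s q ν hQ' P), polyOn_coeFn (q := q) (ν := ν) hQ P,
    polyOn_coeFn (q := q) (ν := ν) hQ' P] with x h1 h2 h3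
  rw [h1, h2]
  by_cases hx : x ∈ Q
  · simp [hx, h3, h hx]
  · simp [hx]

/-- The system is chosen inside `L^q_ν` itself, which makes its bounds independent of the cube and
of the geometry of `ν`. -/
theorem exists_local_system (s : ℕ) (q : ℝ≥0∞) [Fact (1 ≤ q)] (ν : Measure (Fin m → ℝ))
    [IsFiniteMeasure ν] (hQ : IsSubcube Q) :
    ∃ (b : Fin (polyDim m (s + 1)) → Lp ℝ q ν)
      (l : Fin (polyDim m (s + 1)) → StrongDual ℝ (Lp ℝ q ν)),
      (∀ i, b i ∈ LinearMap.range (polyOn s q ν hQ)) ∧ (∀ i, ‖b i‖ ≤ 1) ∧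
      (∀ i, ‖l i‖ ≤ 1) ∧ ∀ w ∈ LinearMap.range (polyOn s q ν hQ), ∑ i, l i w • b i = w :=
  exists_auerbach_system _ (LinearMap.finrank_range_le _)

/-- An Auerbach basis of the polynomials on `Q` in `L^q_ν`. -/
noncomputable def localBasis (s : ℕ) (q : ℝ≥0∞) [Fact (1 ≤ q)] (ν : Measure (Fin m → ℝ))
    [IsFiniteMeasure ν] (hQ : IsSubcube Q) : Fin (polyDim m (s + 1)) → Lp ℝ q ν :=
  (exists_local_system s q ν hQ).choose

/-- The coordinate functionals of `localBasis`. -/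
noncomputable def localCoord (s : ℕ) (q : ℝ≥0∞) [Fact (1 ≤ q)] (ν : Measure (Fin m → ℝ))
    [IsFiniteMeasure ν] (hQ : IsSubcube Q) :
    Fin (polyDim m (s + 1)) → StrongDual ℝ (Lp ℝ q ν) :=
  (exists_local_system s q ν hQ).choose_spec.choose

variable {s : ℕ}

theorem localBasis_mem (hQ : IsSubcube Q) (i : Fin (polyDim m (s + 1))) :
    localBasis s q ν hQ i ∈ LinearMap.range (polyOn s q ν hQ) :=
  (exists_local_system s q ν hQ).choose_spec.choose_spec.1 i

theorem norm_localBasis_le (hQ : IsSubcube Q) (i : Fin (polyDim m (s + 1))) :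
    ‖localBasis s q ν hQ i‖ ≤ 1 :=
  (exists_local_system s q ν hQ).choose_spec.choose_spec.2.1 i

theorem abs_localCoord_le (hQ : IsSubcube Q) (i : Fin (polyDim m (s + 1))) (u : Lp ℝ q ν) :
    |localCoord s q ν hQ i u| ≤ ‖u‖ := by
  have h1 := (exists_local_system s q ν hQ).choose_spec.choose_spec.2.2.1 i
  have h2 := (localCoord s q ν hQ i).le_of_opNorm_le h1 u
  rwa [one_mul, Real.norm_eq_abs] at h2

theorem sum_localCoord (hQ : IsSubcube Q) {w : Lp ℝ q ν}
    (hw : w ∈ LinearMap.range (polyOn s q ν hQ)) :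
    ∑ i, localCoord s q ν hQ i w • localBasis s q ν hQ i = w :=
  (exists_local_system s q ν hQ).choose_spec.choose_spec.2.2.2 w hw

/-- A projection of `L^q_ν` onto the polynomials on `Q`. -/
noncomputable def localProj (s : ℕ) (q : ℝ≥0∞) [Fact (1 ≤ q)] (ν : Measure (Fin m → ℝ))
    [IsFiniteMeasure ν] (hQ : IsSubcube Q) : Lp ℝ q ν →L[ℝ] Lp ℝ q ν :=
  ∑ i, ((localCoord s q ν hQ i).comp (cutoff q ν hQ.1)).smulRight (localBasis s q ν hQ i)

theorem localProj_apply (hQ : IsSubcube Q) (u : Lp ℝ q ν) : localProj s q ν hQ u =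
    ∑ i, localCoord s q ν hQ i (cutoff q ν hQ.1 u) • localBasis s q ν hQ i := by
  simp [localProj]

theorem localProj_mem (hQ : IsSubcube Q) (u : Lp ℝ q ν) :
    localProj s q ν hQ u ∈ LinearMap.range (polyOn s q ν hQ) := by
  rw [localProj_apply]
  exact Submodule.sum_mem _ fun i _ => Submodule.smul_mem _ _ (localBasis_mem hQ i)

theorem norm_localProj_le (hQ : IsSubcube Q) (u : Lp ℝ q ν) :
    ‖localProj s q ν hQ u‖ ≤ polyDim m (s + 1) * ‖cutoff q ν hQ.1 u‖ := by
  rw [localProj_apply]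
  refine (norm_sum_le _ _).trans ?_
  have h : ∀ i ∈ Finset.univ, ‖localCoord s q ν hQ i (cutoff q ν hQ.1 u) • localBasis s q ν hQ i‖
      ≤ ‖cutoff q ν hQ.1 u‖ := fun i _ => by
    rw [norm_smul, Real.norm_eq_abs]
    exact (mul_le_mul (abs_localCoord_le hQ i _) (norm_localBasis_le hQ i) (norm_nonneg _)
      (norm_nonneg _)).trans (mul_one _).le
  refine (Finset.sum_le_card_nsmul _ _ _ h).trans (le_of_eq ?_)
  rw [Finset.card_univ, Fintype.card_fin, nsmul_eq_mul]

theorem cutoff_of_mem_range (hQ : IsSubcube Q) {w : Lp ℝ q ν}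
    (hw : w ∈ LinearMap.range (polyOn s q ν hQ)) : cutoff q ν hQ.1 w = w := by
  obtain ⟨P, rfl⟩ := hw
  exact cutoff_polyOn hQ P

theorem cutoff_mem_range_of_subset (hQ : IsSubcube Q) (hQ' : IsSubcube Q') (h : Q ⊆ Q')
    {w : Lp ℝ q ν} (hw : w ∈ LinearMap.range (polyOn s q ν hQ')) :
    cutoff q ν hQ.1 w ∈ LinearMap.range (polyOn s q ν hQ) := by
  obtain ⟨P, rfl⟩ := hw
  exact ⟨P, (cutoff_polyOn_of_subset hQ hQ' h P).symm⟩

theorem localProj_of_mem_range (hQ : IsSubcube Q) {w : Lp ℝ q ν}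
    (hw : w ∈ LinearMap.range (polyOn s q ν hQ)) : localProj s q ν hQ w = w := by
  rw [localProj_apply, cutoff_of_mem_range hQ hw, sum_localCoord hQ hw]

/-- Lebesgue's inequality: the projection reproduces polynomials, so its error is at most one plus
its norm times the error of any polynomial. -/
theorem norm_cutoff_sub_localProj_le (hQ : IsSubcube Q) (u : Lp ℝ q ν) {P : (Fin m → ℝ) → ℝ}
    (hP : IsPolyFun s P) {a : ℝ} (ha : 0 ≤ a) (h : ∀ᵐ x ∂ν, x ∈ Q → |u x - P x| ≤ a) :
    ‖cutoff q ν hQ.1 u - localProj s q ν hQ u‖ ≤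
      (1 + polyDim m (s + 1)) * (ν.real Q ^ (q.toReal)⁻¹ * a) := by
  obtain ⟨R, hR, hRP⟩ := hP
  set w := polyOn s q ν hQ ⟨R, hR⟩
  have hw : w ∈ LinearMap.range (polyOn s q ν hQ) := ⟨_, rfl⟩
  have h1 : ‖cutoff q ν hQ.1 (u - w)‖ ≤ ν.real Q ^ (q.toReal)⁻¹ * a := by
    refine norm_cutoff_sub_le hQ.1 ha ?_
    filter_upwards [h, polyOn_coeFn (q := q) (ν := ν) hQ ⟨R, hR⟩] with x hx h2 hxQ
    rw [h2, Set.indicator_of_mem hxQ, hRP]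
    exact hx hxQ
  have h2 : cutoff q ν hQ.1 u - localProj s q ν hQ u =
      cutoff q ν hQ.1 (u - w) - localProj s q ν hQ (u - w) := by
    rw [map_sub, map_sub, localProj_of_mem_range hQ hw, cutoff_of_mem_range hQ hw]
    abel
  rw [h2, add_mul, one_mul]
  refine (norm_sub_le _ _).trans (add_le_add h1 ((norm_localProj_le hQ _).trans ?_))
  exact mul_le_mul_of_nonneg_left h1 (Nat.cast_nonneg _)

end LocalProjections

/-! ### Piecewise polynomial projections, coefficients and synthesis. -/

section FamilyProjections

variable {m : ℕ} {q : ℝ≥0∞} [Fact (1 ≤ q)] {ν : Measure (Fin m → ℝ)} [IsFiniteMeasure ν] {s : ℕ}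
  {ι : Type*} [Fintype ι] {Q : ι → Set (Fin m → ℝ)}

/-- The piecewise polynomial projection for a family of disjoint cubes. -/
noncomputable def familyProj (s : ℕ) (q : ℝ≥0∞) [Fact (1 ≤ q)] (ν : Measure (Fin m → ℝ))
    [IsFiniteMeasure ν] (hQ : ∀ i, IsSubcube (Q i)) : Lp ℝ q ν →L[ℝ] Lp ℝ q ν :=
  ∑ i, localProj s q ν (hQ i)

theorem cutoff_familyProj (hQ : ∀ i, IsSubcube (Q i)) (hd : Pairwise (Function.onFun Disjoint Q))
    (u : Lp ℝ q ν) (i : ι) :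
    cutoff q ν (hQ i).1 (familyProj s q ν hQ u) = localProj s q ν (hQ i) u := by
  have h0 : familyProj s q ν hQ u = ∑ k, localProj s q ν (hQ k) u := by simp [familyProj]
  rw [h0, map_sum, Finset.sum_eq_single i]
  · exact cutoff_of_mem_range (hQ i) (localProj_mem (hQ i) u)
  · intro k _ hk
    rw [← cutoff_of_mem_range (hQ k) (localProj_mem (hQ k) u)]
    exact cutoff_cutoff_of_disjoint _ _ (hd hk.symm) _
  · simp

variable {M : ℕ} {Q : Fin M → Set (Fin m → ℝ)}

/-- The coefficients of a piecewise polynomial function. -/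
noncomputable def familyCoeff (s : ℕ) (q : ℝ≥0∞) [Fact (1 ≤ q)] (ν : Measure (Fin m → ℝ))
    [IsFiniteMeasure ν] (hQ : ∀ i, IsSubcube (Q i)) :
    Lp ℝ q ν →L[ℝ] PiLp q (fun _ : Fin (polyDim m (s + 1) * M) => ℝ) :=
  ((PiLp.continuousLinearEquiv q ℝ fun _ : Fin (polyDim m (s + 1) * M) => ℝ).symm :
    (Fin (polyDim m (s + 1) * M) → ℝ) →L[ℝ] _).comp
    (ContinuousLinearMap.pi fun i =>
      (localCoord s q ν (hQ (finProdFinEquiv.symm i).2) (finProdFinEquiv.symm i).1).comp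
        (cutoff q ν (hQ (finProdFinEquiv.symm i).2).1))

theorem familyCoeff_apply (hQ : ∀ i, IsSubcube (Q i)) (u : Lp ℝ q ν)
    (i : Fin (polyDim m (s + 1) * M)) :
    familyCoeff s q ν hQ u i = localCoord s q ν (hQ (finProdFinEquiv.symm i).2)
      (finProdFinEquiv.symm i).1 (cutoff q ν (hQ (finProdFinEquiv.symm i).2).1 u) := rfl

theorem familyCoeff_apply_finProdFinEquiv (hQ : ∀ i, IsSubcube (Q i)) (u : Lp ℝ q ν)
    (a : Fin (polyDim m (s + 1))) (b : Fin M) : familyCoeff s q ν hQ u (finProdFinEquiv (a, b)) =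
      localCoord s q ν (hQ b) a (cutoff q ν (hQ b).1 u) := by
  rw [familyCoeff_apply]
  have h : ∀ c : Fin (polyDim m (s + 1)) × Fin M, c = (a, b) →
      localCoord s q ν (hQ c.2) c.1 (cutoff q ν (hQ c.2).1 u) =
        localCoord s q ν (hQ b) a (cutoff q ν (hQ b).1 u) := by
    rintro _ rfl
    rfl
  exact h _ (Equiv.symm_apply_apply _ _)

/-- The piecewise polynomial function with given coefficients. -/
noncomputable def familySynth (s : ℕ) (q : ℝ≥0∞) [Fact (1 ≤ q)] (ν : Measure (Fin m → ℝ))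
    [IsFiniteMeasure ν] (hQ : ∀ i, IsSubcube (Q i)) :
    PiLp q (fun _ : Fin (polyDim m (s + 1) * M) => ℝ) →L[ℝ] Lp ℝ q ν :=
  ∑ a, ∑ b, (PiLp.proj q (fun _ : Fin (polyDim m (s + 1) * M) => ℝ)
    (finProdFinEquiv (a, b))).smulRight (localBasis s q ν (hQ b) a)

theorem familySynth_apply (hQ : ∀ i, IsSubcube (Q i))
    (x : PiLp q (fun _ : Fin (polyDim m (s + 1) * M) => ℝ)) :
    familySynth s q ν hQ x = ∑ a, ∑ b, x (finProdFinEquiv (a, b)) • localBasis s q ν (hQ b) a := by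
  simp [familySynth]

theorem familySynth_familyCoeff (hQ : ∀ i, IsSubcube (Q i))
    (hd : Pairwise (Function.onFun Disjoint Q)) (hcov : ∀ᵐ x ∂ν, ∃ i, x ∈ Q i) {u : Lp ℝ q ν}
    (hu : ∀ b, cutoff q ν (hQ b).1 u ∈ LinearMap.range (polyOn s q ν (hQ b))) :
    familySynth s q ν hQ (familyCoeff s q ν hQ u) = u := by
  rw [familySynth_apply, Finset.sum_comm]
  simp only [familyCoeff_apply_finProdFinEquiv]
  have h : ∀ b ∈ Finset.univ, ∑ a, localCoord s q ν (hQ b) a (cutoff q ν (hQ b).1 u) •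
      localBasis s q ν (hQ b) a = cutoff q ν (hQ b).1 u := fun b _ => sum_localCoord (hQ b) (hu b)
  rw [Finset.sum_congr rfl h]
  exact sum_cutoff (fun i => (hQ i).1) hd hcov u

/-- For a fixed basis index `a` the summands live on disjoint cubes, so their `L^q`-norm is
controlled by the `ℓ_q`-norm of the coefficients. The triangle inequality over the `κ` values of `a`
gives the factor `κ`. -/
theorem norm_familySynth_le (hQ : ∀ i, IsSubcube (Q i))
    (hd : Pairwise (Function.onFun Disjoint Q)) (hcov : ∀ᵐ x ∂ν, ∃ i, x ∈ Q i) :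
    ‖familySynth s q ν hQ‖ ≤ polyDim m (s + 1) := by
  refine ContinuousLinearMap.opNorm_le_bound _ (Nat.cast_nonneg _) fun x => ?_
  rw [familySynth_apply]
  refine (norm_sum_le _ _).trans ?_
  have h : ∀ a ∈ Finset.univ, ‖∑ b, x (finProdFinEquiv (a, b)) • localBasis s q ν (hQ b) a‖ ≤ ‖x‖ := by
    intro a _
    refine (norm_le_norm_toLp_cutoff (fun b => (hQ b).1) hd hcov _).trans ?_
    have hinj : Function.Injective fun b : Fin M => finProdFinEquiv (a, b) := fun b b' hbb => by
      simpa using finProdFinEquiv.injective hbb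
    refine (norm_toLp_le_of_injective _ (WithLp.ofLp x) zero_le_one hinj fun b => ?_).trans ?_
    · have hcut : cutoff q ν (hQ b).1
          (∑ b, x (finProdFinEquiv (a, b)) • localBasis s q ν (hQ b) a) =
          x (finProdFinEquiv (a, b)) • localBasis s q ν (hQ b) a := by
        rw [map_sum, Finset.sum_eq_single b]
        · rw [map_smul, cutoff_of_mem_range (hQ b) (localBasis_mem (hQ b) a)]
        · intro k _ hk
          rw [map_smul, ← cutoff_of_mem_range (hQ k) (localBasis_mem (hQ k) a),
            cutoff_cutoff_of_disjoint _ _ (hd hk.symm), smul_zero]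
        · simp
      rw [hcut, one_mul, abs_norm, norm_smul, Real.norm_eq_abs]
      exact (mul_le_mul_of_nonneg_left (norm_localBasis_le (hQ b) a) (abs_nonneg _)).trans
        (mul_one _).le
    · rw [one_mul]
  refine (Finset.sum_le_card_nsmul _ _ _ h).trans (le_of_eq ?_)
  rw [Finset.card_univ, Fintype.card_fin, nsmul_eq_mul]

end FamilyProjections

end SobolevWidths

namespace SobolevWidths

/-! ### Boundedness of the Sobolev ball in `L^q_ν` and the local projection error. -/

section SobolevBallBounds

variable {m : ℕ} {s : ℕ} {p q : ℝ≥0∞} [hp : Fact (1 ≤ p)] [Fact (1 ≤ q)]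
  {ν : Measure (Fin m → ℝ)} [IsFiniteMeasure ν]

/-- The centre of the unit cube. -/
noncomputable def cubeCenter (m : ℕ) : Fin m → ℝ := fun _ => 1 / 2

theorem ball_cubeCenter : Metric.ball (cubeCenter m) (1 / 2) = openCube m := by
  rw [ball_pi _ (by norm_num), openCube]
  refine Set.pi_congr rfl fun i _ => ?_
  rw [Real.ball_eq_Ioo, cubeCenter]
  norm_num

theorem closedBall_cubeCenter : Metric.closedBall (cubeCenter m) (1 / 2) = closedCube m := by
  rw [closedBall_pi _ (by norm_num), closedCube]
  refine Set.pi_congr rfl fun i _ => ?_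
  rw [Real.closedBall_eq_Icc, cubeCenter]
  norm_num

theorem volume_openCube : volume (openCube m) = 1 := by
  rw [openCube, Real.volume_pi_Ioo]
  simp

instance isProbabilityMeasure_cubeMeasure : IsProbabilityMeasure (cubeMeasure m) :=
  ⟨by rw [cubeMeasure, Measure.restrict_apply_univ, volume_openCube]⟩

theorem isSubcube_openCube : IsSubcube (openCube m) :=
  ⟨measurableSet_openCube, cubeCenter m, 1 / 2, by norm_num, ball_cubeCenter.le,
    ball_cubeCenter.le, closedBall_cubeCenter ▸ openCube_subset_closedCube, by
      rw [measureReal_def, volume_openCube]; norm_num⟩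

theorem eq_zero_of_polyOn_eq_zero {P : MvPolynomial.restrictTotalDegree (Fin m) ℝ s}
    (h : polyOn s 1 (cubeMeasure m) isSubcube_openCube P = 0) : P = 0 := by
  have h1 : (fun x => MvPolynomial.eval x P.1) =ᵐ[volume.restrict (openCube m)] fun _ => 0 := by
    have h2 := polyOn_coeFn (q := 1) (ν := cubeMeasure m) isSubcube_openCube P
    have h3 := Lp.coeFn_zero ℝ 1 (cubeMeasure m)
    rw [← h] at h3
    change ∀ᵐ x ∂cubeMeasure m, _
    filter_upwards [h2, h3, (ae_restrict_mem measurableSet_openCube :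
      ∀ᵐ x ∂cubeMeasure m, x ∈ openCube m)] with x hx h0 hxQ
    rw [Set.indicator_of_mem hxQ, h0] at hx
    exact hx.symm
  have h2 : Set.EqOn (fun x => MvPolynomial.eval x P.1) (fun _ => 0) (openCube m) :=
    Measure.eqOn_open_of_ae_eq h1 isOpen_openCube
      (MvPolynomial.continuous_eval P.1).continuousOn continuousOn_const
  refine Subtype.ext (MvPolynomial.funext_set (fun _ => Set.Ioo (0 : ℝ) 1)
    (fun _ => Set.Ioo_infinite one_pos) fun x hx => ?_)
  simpa using h2 hx

/-- On polynomials the uniform norm on the cube is bounded by the `L¹`-norm. -/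
theorem exists_poly_sup_bound (m s : ℕ) : ∃ K : ℝ, 0 ≤ K ∧ ∀ P : MvPolynomial.restrictTotalDegree (Fin m) ℝ s,
    ∀ x ∈ closedCube m, |MvPolynomial.eval x P.1| ≤
      K * ‖polyOn s 1 (cubeMeasure m) isSubcube_openCube P‖ := by
  have hcube : IsSubcube (openCube m) := isSubcube_openCube
  choose B hB using localBasis_mem (s := s) (q := 1) (ν := cubeMeasure m) hcube
  have hbound : ∀ i, ∃ K, ∀ x ∈ closedCube m, ‖MvPolynomial.eval x (B i).1‖ ≤ K := fun i =>
    isCompact_closedCube.exists_bound_of_continuousOn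
      (MvPolynomial.continuous_eval (B i).1).continuousOn
  choose K hK using hbound
  refine ⟨∑ i, |K i|, Finset.sum_nonneg fun _ _ => abs_nonneg _, fun P x hx => ?_⟩
  set w := polyOn s 1 (cubeMeasure m) hcube P with hw
  -- With respect to Lebesgue measure a polynomial is determined by its class, so the Auerbach
  -- expansion lifts to the polynomials themselves.
  have hP : P = ∑ i, localCoord s 1 (cubeMeasure m) hcube i w • B i := by
    rw [← sub_eq_zero]
    refine eq_zero_of_polyOn_eq_zero ?_
    rw [map_sub, map_sum]
    simp only [map_smul, hB]
    rw [sum_localCoord hcube ⟨P, rfl⟩, sub_self]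
  have hev : MvPolynomial.eval x P.1 =
      ∑ i, localCoord s 1 (cubeMeasure m) hcube i w * MvPolynomial.eval x (B i).1 := by
    conv_lhs => rw [hP]
    simp [MvPolynomial.smul_eval]
  rw [hev, Finset.sum_mul]
  refine (Finset.abs_sum_le_sum_abs _ _).trans (Finset.sum_le_sum fun i _ => ?_)
  rw [abs_mul, mul_comm]
  exact mul_le_mul ((hK i x hx).trans (le_abs_self _)) (abs_localCoord_le hcube i w) (abs_nonneg _)
    (abs_nonneg _)

/-- Needed for the first block, which has no preceding projection to subtract. On the whole cube `f`
is uniformly close to a polynomial, whose `L¹`-norm is bounded through that of `f`; on a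
finite-dimensional space this bounds its sup norm. -/
theorem exists_sobolevBall_norm_le (hρ : 0 < rhoHat m (s + 1) p) (q : ℝ≥0∞) [Fact (1 ≤ q)]
    (hν : ν (openCube m)ᶜ = 0) :
    ∃ K : ℝ, 0 ≤ K ∧ ∀ u ∈ sobolevBall (s + 1) p q ν, ‖u‖ ≤ K := by
  obtain ⟨C, hC, happrox⟩ := exists_poly_approx s hρ
  obtain ⟨K, hK, hsup⟩ := exists_poly_sup_bound m s
  set A : ℝ := C * (1 / 2) ^ rhoHat m (s + 1) p + 1 with hA
  have hA0 : 0 ≤ A := by positivity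
  refine ⟨ν.real Set.univ ^ (q.toReal)⁻¹ * (A + K * (1 + A)), by positivity, ?_⟩
  rintro u ⟨f, hfc, hfs, hf1, huf⟩
  have hgrad : eLpNorm (gradNorm (s + 1) p f) p (cubeMeasure m) ≤ 1 := le_add_self.trans hf1
  have hf : eLpNorm f p (cubeMeasure m) ≤ 1 := le_self_add.trans hf1
  obtain ⟨F, ⟨P, hP, hPF⟩, hF⟩ := happrox f hfc hfs (hgrad.trans_lt ENNReal.one_lt_top).ne
    (cubeCenter m) (1 / 2) (by norm_num) ball_cubeCenter.le 1 one_pos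
  rw [ball_cubeCenter, closedBall_cubeCenter] at hF
  have hE : (eLpNorm (gradNorm (s + 1) p f) p (volume.restrict (openCube m))).toReal ≤ 1 :=
    ENNReal.toReal_le_of_le_ofReal zero_le_one (by simpa [cubeMeasure] using hgrad)
  have hfP : ∀ x ∈ closedCube m, |f x - MvPolynomial.eval x P| ≤ A := fun x hx => by
    rw [hPF]
    refine (hF x hx).trans ?_
    rw [hA]
    exact add_le_add_left (mul_le_of_le_one_right (by positivity) hE) _
  set R : MvPolynomial.restrictTotalDegree (Fin m) ℝ s := ⟨P, hP⟩
  have hnorm : ‖polyOn s 1 (cubeMeasure m) isSubcube_openCube R‖ ≤ 1 + A := by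
    rw [Lp.norm_def]
    refine ENNReal.toReal_le_of_le_ofReal (by positivity) ?_
    have hae : polyOn s 1 (cubeMeasure m) isSubcube_openCube R =ᵐ[cubeMeasure m]
        f + fun x => MvPolynomial.eval x P - f x := by
      filter_upwards [polyOn_coeFn (q := 1) (ν := cubeMeasure m) isSubcube_openCube R,
        (ae_restrict_mem measurableSet_openCube : ∀ᵐ x ∂cubeMeasure m, x ∈ openCube m)]
        with x hx hxQ
      rw [hx, Set.indicator_of_mem hxQ]
      simp [R]
    rw [eLpNorm_congr_ae hae, ENNReal.ofReal_add zero_le_one hA0, ENNReal.ofReal_one]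
    have hfm := hfs.1.aestronglyMeasurable
    have hPm : AEStronglyMeasurable (fun x => MvPolynomial.eval x P) (cubeMeasure m) :=
      (MvPolynomial.continuous_eval P).aestronglyMeasurable
    refine (eLpNorm_add_le hfm (hPm.sub hfm) le_rfl).trans (add_le_add ?_ ?_)
    · exact (eLpNorm_le_eLpNorm_of_exponent_le hp.out hfm).trans hf
    · refine (eLpNorm_le_of_ae_bound (C := A) ?_).trans ?_
      · filter_upwards [(ae_restrict_mem measurableSet_openCube :
          ∀ᵐ x ∂cubeMeasure m, x ∈ openCube m)] with x hx
        rw [Real.norm_eq_abs, Pi.sub_apply, abs_sub_comm]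
        exact hfP x (openCube_subset_closedCube hx)
      · simp
  rw [Lp.norm_def]
  refine ENNReal.toReal_le_of_le_ofReal (by positivity) ?_
  have hb : ∀ᵐ x ∂ν, ‖u x‖ ≤ A + K * (1 + A) := by
    have hmem : ∀ᵐ x ∂ν, x ∈ openCube m := ae_iff.2 hν
    filter_upwards [huf, hmem] with x hx hxQ
    have hxc := openCube_subset_closedCube hxQ
    have h1 := hfP x hxc
    have h2 := (hsup R x hxc).trans (mul_le_mul_of_nonneg_left hnorm hK)
    rw [hx, Real.norm_eq_abs]
    calc |f x| = |(f x - MvPolynomial.eval x P) + MvPolynomial.eval x P| := by ring_nf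
      _ ≤ _ := (abs_add_le _ _).trans (add_le_add h1 h2)
  refine (eLpNorm_le_of_ae_bound hb).trans (le_of_eq ?_)
  rw [ENNReal.ofReal_mul (by positivity), measureReal_def, ENNReal.toReal_rpow,
    ENNReal.ofReal_toReal (ENNReal.rpow_ne_top_of_nonneg (by positivity) (measure_ne_top _ _))]

/-- The function `g` is the gradient norm of the representative and serves all cubes at once, so
that its local norms can later be summed. -/
theorem exists_localProj_error (hm : 0 < m) (hρ : 0 < rhoHat m (s + 1) p) (q : ℝ≥0∞)
    [Fact (1 ≤ q)] : ∃ C : ℝ, 0 ≤ C ∧ ∀ u ∈ sobolevBall (s + 1) p q ν, ∃ g : (Fin m → ℝ) → ℝ,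
      eLpNorm g p (cubeMeasure m) ≤ 1 ∧ ∀ (Q : Set (Fin m → ℝ)) (hQ : IsSubcube Q),
        ‖cutoff q ν hQ.1 u - localProj s q ν hQ u‖ ≤
          C * (ν.real Q ^ (q.toReal)⁻¹ * volume.real Q ^ (rhoHat m (s + 1) p / m)) *
            (eLpNorm g p ((cubeMeasure m).restrict Q)).toReal := by
  obtain ⟨C, hC, happrox⟩ := exists_poly_approx s hρ
  have hm' : (0 : ℝ) < m := by exact_mod_cast hm
  refine ⟨(1 + polyDim m (s + 1)) * C, by positivity, ?_⟩
  rintro u ⟨f, hfc, hfs, hf1, huf⟩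
  have hgrad : eLpNorm (gradNorm (s + 1) p f) p (cubeMeasure m) ≤ 1 := le_add_self.trans hf1
  have hgrad' := (hgrad.trans_lt ENNReal.one_lt_top).ne
  refine ⟨_, hgrad, fun Q hQ => ?_⟩
  obtain ⟨hmeas, c, r, hr, hcube, hball, hsub, hvol⟩ := id hQ
  set ρ := rhoHat m (s + 1) p
  set a := ν.real Q ^ (q.toReal)⁻¹
  set g := gradNorm (s + 1) p f
  have ha : 0 ≤ a := by positivity
  set E := (eLpNorm g p ((cubeMeasure m).restrict Q)).toReal
  have hE0 : 0 ≤ E := ENNReal.toReal_nonneg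
  have hE : (eLpNorm g p (volume.restrict (Metric.ball c r))).toReal ≤ E := by
    refine ENNReal.toReal_mono ?_ (eLpNorm_mono_measure _ ?_)
    · exact ((eLpNorm_mono_measure _ Measure.restrict_le_self).trans_lt hgrad'.lt_top).ne
    · rw [cubeMeasure, Measure.restrict_restrict hmeas]
      exact Measure.restrict_mono_set _ (Set.subset_inter hball hcube)
  have hr' : r ^ ρ ≤ volume.real Q ^ (ρ / m) := by
    rw [hvol, ← Real.rpow_natCast, ← Real.rpow_mul (by positivity), mul_div_cancel₀ _ hm'.ne']
    exact Real.rpow_le_rpow hr.le (by linarith) hρ.le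
  -- The approximating polynomial depends on `δ`, but the projection does not, so `δ` may tend to
  -- zero afterwards.
  have key : ∀ δ > 0, ‖cutoff q ν hQ.1 u - localProj s q ν hQ u‖ ≤
      (1 + polyDim m (s + 1)) * (a * (C * volume.real Q ^ (ρ / m) * E + δ)) := fun δ hδ => by
    obtain ⟨P, hP, hPf⟩ := happrox f hfc hfs hgrad' c r hr hcube δ hδ
    refine norm_cutoff_sub_localProj_le hQ u hP (by positivity) ?_
    filter_upwards [huf] with x hx hxQ
    rw [hx]
    refine (hPf x (hsub hxQ)).trans ?_
    gcongr
  have hlim : Tendsto (fun δ : ℝ => (1 + polyDim m (s + 1)) *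
      (a * (C * volume.real Q ^ (ρ / m) * E + δ))) (𝓝[>] 0)
      (𝓝 ((1 + polyDim m (s + 1)) * (a * (C * volume.real Q ^ (ρ / m) * E + 0)))) :=
    (Continuous.tendsto (by fun_prop) 0).mono_left nhdsWithin_le_nhds
  refine (ge_of_tendsto hlim (eventually_mem_nhdsWithin.mono fun δ hδ => key δ hδ)).trans
    (le_of_eq ?_)
  ring

end SobolevBallBounds

end SobolevWidths

namespace SobolevWidths

/-! ### The telescoping decomposition along a partition sequence. -/

namespace IsCubePartition

variable {m : ℕ} {ν : Measure (Fin m → ℝ)} {P : Set (Set (Fin m → ℝ))}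

theorem exists_enumeration (h : IsCubePartition ν P) :
    ∃ Q : Fin P.ncard → Set (Fin m → ℝ), Set.range Q = P ∧ Function.Injective Q := by
  have := h.finite.to_subtype
  let e : Fin P.ncard ≃ P := (Finite.equivFin P).symm
  exact ⟨fun i => e i, by
    ext Q
    exact ⟨fun ⟨i, hi⟩ => hi ▸ (e i).2, fun hQ => ⟨e.symm ⟨Q, hQ⟩, by simp⟩⟩,
    Subtype.val_injective.comp e.injective⟩

/-- The cubes of a finite partition. -/
noncomputable def cell (h : IsCubePartition ν P) : Fin P.ncard → Set (Fin m → ℝ) :=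
  h.exists_enumeration.choose

theorem cell_mem (h : IsCubePartition ν P) (i : Fin P.ncard) : h.cell i ∈ P := by
  have h1 : h.exists_enumeration.choose i ∈ Set.range h.exists_enumeration.choose := ⟨i, rfl⟩
  rwa [h.exists_enumeration.choose_spec.1] at h1

theorem exists_cell_eq (h : IsCubePartition ν P) {Q : Set (Fin m → ℝ)} (hQ : Q ∈ P) :
    ∃ i, h.cell i = Q := by
  rw [← h.exists_enumeration.choose_spec.1] at hQ
  exact hQ

theorem isSubcube_cell (h : IsCubePartition ν P) (i : Fin P.ncard) : IsSubcube (h.cell i) :=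
  h.isSubcube _ (h.cell_mem i)

theorem disjoint_cell (h : IsCubePartition ν P) : Pairwise (Function.onFun Disjoint h.cell) :=
  fun i k hik => Set.disjoint_left.2 fun x hi hk =>
    hik (h.exists_enumeration.choose_spec.2 (h.disjoint _ (h.cell_mem i) _ (h.cell_mem k) x hi hk))

theorem cover_cell (h : IsCubePartition ν P) : ∀ᵐ x ∂ν, ∃ i, x ∈ h.cell i := by
  filter_upwards [h.cover] with x ⟨Q, hQ, hx⟩
  obtain ⟨i, rfl⟩ := h.exists_cell_eq hQ
  exact ⟨i, hx⟩

end IsCubePartition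

theorem IsSubcube.volume_pos {m : ℕ} {Q : Set (Fin m → ℝ)} (h : IsSubcube Q) :
    0 < volume.real Q := by
  obtain ⟨-, c, r, hr, -, -, -, hv⟩ := h
  rw [hv]
  positivity

theorem IsSubcube.volume_ne_top {m : ℕ} {Q : Set (Fin m → ℝ)} (h : IsSubcube Q) :
    volume Q ≠ ∞ := by
  intro h0
  have := h.volume_pos
  simp [measureReal_def, h0] at this

/-- Disjoint sets inside `B` of volume at least `c vol(B)` number at most `1 / c`. -/
theorem card_mul_le_one {m : ℕ} {ι : Type*} (S : Finset ι) {Q : ι → Set (Fin m → ℝ)}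
    {B : Set (Fin m → ℝ)} {c : ℝ} (hQ : ∀ i, MeasurableSet (Q i))
    (hd : Pairwise (Function.onFun Disjoint Q)) (hB : 0 < volume.real B) (hBt : volume B ≠ ∞)
    (hsub : ∀ i ∈ S, Q i ⊆ B) (hc : ∀ i ∈ S, c * volume.real B ≤ volume.real (Q i)) :
    S.card * c ≤ 1 := by
  have h1 : volume.real (⋃ i ∈ S, Q i) = ∑ i ∈ S, volume.real (Q i) :=
    measureReal_biUnion_finset (fun i _ k _ hik => hd hik) (fun i _ => hQ i)
      fun i hi => ((measure_mono (hsub i hi)).trans_lt hBt.lt_top).ne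
  have h2 : volume.real (⋃ i ∈ S, Q i) ≤ volume.real B :=
    measureReal_mono (Set.iUnion₂_subset hsub) hBt
  have h3 := Finset.card_nsmul_le_sum S (fun i => volume.real (Q i)) _ hc
  rw [nsmul_eq_mul, ← h1] at h3
  have h4 : (S.card * c) * volume.real B ≤ 1 * volume.real B := by linarith
  exact le_of_mul_le_mul_right h4 hB

namespace IsPartitionSequence

variable {m : ℕ} {s : ℕ} {p q : ℝ≥0∞} {ν : Measure (Fin m → ℝ)} {P : ℕ → Set (Set (Fin m → ℝ))} {T : ℕ → ℝ}

theorem exists_parent (h : IsPartitionSequence s p q ν P T) (k : ℕ) (b : Fin (P (k + 1)).ncard) :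
    ∃ b', (h.isCubePartition (k + 1)).cell b ⊆ (h.isCubePartition k).cell b' := by
  obtain ⟨Q', hQ', hsub⟩ := h.nested k _ ((h.isCubePartition (k + 1)).cell_mem b)
  obtain ⟨b', rfl⟩ := (h.isCubePartition k).exists_cell_eq hQ'
  exact ⟨b', hsub⟩

/-- The cube of the previous partition that contains a given one. -/
noncomputable def parent (h : IsPartitionSequence s p q ν P T) (k : ℕ)
    (b : Fin (P (k + 1)).ncard) : Fin (P k).ncard := (h.exists_parent k b).choose

theorem subset_parent (h : IsPartitionSequence s p q ν P T) (k : ℕ) (b : Fin (P (k + 1)).ncard) :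
    (h.isCubePartition (k + 1)).cell b ⊆ (h.isCubePartition k).cell (h.parent k b) :=
  (h.exists_parent k b).choose_spec

/-- Children are disjoint and each fills at least the fraction `c` of the parent's volume. -/
theorem exists_card_parent_le (h : IsPartitionSequence s p q ν P T) : ∃ K : ℝ, 0 ≤ K ∧
    ∀ k b', ((Finset.univ.filter fun b => h.parent k b = b').card : ℝ) ≤ K := by
  obtain ⟨c, hc, hratio⟩ := h.ratio
  refine ⟨c⁻¹, by positivity, fun k b' => ?_⟩
  have hb' := (h.isCubePartition k).isSubcube_cell b'
  have hsub : ∀ b ∈ Finset.univ.filter fun b => h.parent k b = b',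
      (h.isCubePartition (k + 1)).cell b ⊆ (h.isCubePartition k).cell b' := fun b hb =>
    (Finset.mem_filter.1 hb).2 ▸ h.subset_parent k b
  have := card_mul_le_one (Finset.univ.filter fun b => h.parent k b = b')
    (fun b => ((h.isCubePartition (k + 1)).isSubcube_cell b).1) (h.isCubePartition (k + 1)).disjoint_cell
    hb'.volume_pos hb'.volume_ne_top hsub fun b hb =>
      hratio k _ ((h.isCubePartition (k + 1)).cell_mem b) _ ((h.isCubePartition k).cell_mem b')
        (hsub b hb)
  rwa [← one_div, le_div_iff₀ hc]

variable [Fact (1 ≤ q)] [IsFiniteMeasure ν]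

/-- The piecewise polynomial projection at level `k`. -/
noncomputable def proj (h : IsPartitionSequence (s + 1) p q ν P T) (k : ℕ) :
    Lp ℝ q ν →L[ℝ] Lp ℝ q ν :=
  familyProj s q ν (h.isCubePartition k).isSubcube_cell

/-- The differences of consecutive projections. -/
noncomputable def diff (h : IsPartitionSequence (s + 1) p q ν P T) : ℕ → Lp ℝ q ν →L[ℝ] Lp ℝ q ν
  | 0 => h.proj 0
  | k + 1 => h.proj (k + 1) - h.proj k

theorem sum_diff (h : IsPartitionSequence (s + 1) p q ν P T) (u : Lp ℝ q ν) (n : ℕ) :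
    ∑ k ∈ Finset.range (n + 1), h.diff k u = h.proj n u := by
  induction n with
  | zero => simp [diff]
  | succ n ih => rw [Finset.sum_range_succ, ih]; simp [diff]

theorem cutoff_proj (h : IsPartitionSequence (s + 1) p q ν P T) (k : ℕ) (u : Lp ℝ q ν)
    (b : Fin (P k).ncard) :
    cutoff q ν ((h.isCubePartition k).isSubcube_cell b).1 (h.proj k u) =
      localProj s q ν ((h.isCubePartition k).isSubcube_cell b) u :=
  cutoff_familyProj _ (h.isCubePartition k).disjoint_cell u b

theorem cutoff_diff_succ (h : IsPartitionSequence (s + 1) p q ν P T) (k : ℕ) (u : Lp ℝ q ν)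
    (b : Fin (P (k + 1)).ncard) :
    cutoff q ν ((h.isCubePartition (k + 1)).isSubcube_cell b).1 (h.diff (k + 1) u) =
      localProj s q ν ((h.isCubePartition (k + 1)).isSubcube_cell b) u -
        cutoff q ν ((h.isCubePartition (k + 1)).isSubcube_cell b).1
          (localProj s q ν ((h.isCubePartition k).isSubcube_cell (h.parent k b)) u) := by
  rw [diff, sub_apply, map_sub, cutoff_proj, ← cutoff_proj h k u,
    cutoff_cutoff_of_subset _ _ (h.subset_parent k b)]

theorem cutoff_diff_mem (h : IsPartitionSequence (s + 1) p q ν P T) (k : ℕ) (u : Lp ℝ q ν)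
    (b : Fin (P k).ncard) :
    cutoff q ν ((h.isCubePartition k).isSubcube_cell b).1 (h.diff k u) ∈
      LinearMap.range (polyOn s q ν ((h.isCubePartition k).isSubcube_cell b)) := by
  cases k with
  | zero =>
    rw [diff, cutoff_proj]
    exact localProj_mem _ u
  | succ k =>
    rw [cutoff_diff_succ]
    exact Submodule.sub_mem _ (localProj_mem _ u)
      (cutoff_mem_range_of_subset _ _ (h.subset_parent k b) (localProj_mem _ u))

/-- On a child cube the difference of projections equals the error of the parent's projection,
restricted, minus the child's own error. -/
theorem norm_cutoff_diff_succ_le (h : IsPartitionSequence (s + 1) p q ν P T) (k : ℕ)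
    (u : Lp ℝ q ν) (b : Fin (P (k + 1)).ncard) :
    ‖cutoff q ν ((h.isCubePartition (k + 1)).isSubcube_cell b).1 (h.diff (k + 1) u)‖ ≤
      ‖cutoff q ν ((h.isCubePartition (k + 1)).isSubcube_cell b).1 u -
        localProj s q ν ((h.isCubePartition (k + 1)).isSubcube_cell b) u‖ +
      ‖cutoff q ν ((h.isCubePartition k).isSubcube_cell (h.parent k b)).1 u -
        localProj s q ν ((h.isCubePartition k).isSubcube_cell (h.parent k b)) u‖ := by
  set hb := (h.isCubePartition (k + 1)).isSubcube_cell b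
  set hb' := (h.isCubePartition k).isSubcube_cell (h.parent k b)
  have e : cutoff q ν hb.1 (h.diff (k + 1) u) =
      cutoff q ν hb.1 (cutoff q ν hb'.1 u - localProj s q ν hb' u) -
        (cutoff q ν hb.1 u - localProj s q ν hb u) := by
    rw [cutoff_diff_succ, map_sub, cutoff_cutoff_of_subset hb.1 hb'.1 (h.subset_parent k b)]
    abel
  rw [e]
  refine (norm_sub_le _ _).trans ?_
  have h1 := norm_cutoff_le hb.1 (cutoff q ν hb'.1 u - localProj s q ν hb' u)
  linarith

variable [hp : Fact (1 ≤ p)]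

/-- Only shrinking volumes matter. Each local gradient norm is bounded by one, and the factors
`ν(Q)^{1/q}`, being the local `L^q`-norms of the constant `1`, sum in `ℓ_q` to at most
`ν(ℝ^m)^{1/q}`. No relation between `p` and `q` is used. -/
theorem tendsto_proj (h : IsPartitionSequence (s + 1) p q ν P T) (hm : 0 < m)
    (hρ : 0 < rhoHat m (s + 1) p) {u : Lp ℝ q ν} (hu : u ∈ sobolevBall (s + 1) p q ν) :
    Tendsto (fun n => h.proj n u) atTop (𝓝 u) := by
  obtain ⟨C, hC, herr⟩ := exists_localProj_error (ν := ν) (s := s) hm hρ q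
  obtain ⟨g, hg, hgQ⟩ := herr u hu
  set ρ := rhoHat m (s + 1) p
  have hm' : (0 : ℝ) < m := by exact_mod_cast hm
  set A : ℝ := ν.real Set.univ ^ (q.toReal)⁻¹
  have hA : 0 ≤ A := by positivity
  have key : ∀ ε > 0, ∀ᶠ n in atTop, ‖h.proj n u - u‖ ≤ C * ε * A := by
    intro ε hε
    filter_upwards [h.volume_small (ε ^ (m / ρ)) (by positivity)] with n hn
    set Q := (h.isCubePartition n).cell
    have hQ := (h.isCubePartition n).isSubcube_cell
    have hd := (h.isCubePartition n).disjoint_cell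
    have hone : ∀ b, (eLpNorm (fun _ => (1 : ℝ)) q (ν.restrict (Q b))).toReal =
        ν.real (Q b) ^ (q.toReal)⁻¹ := fun b => by
      have hpos := (h.isCubePartition n).measure_pos _ ((h.isCubePartition n).cell_mem b)
      rw [eLpNorm_const _ (one_pos.trans_le (Fact.out : 1 ≤ q)).ne'
        (by simpa [Measure.restrict_eq_zero] using hpos.ne')]
      simp [measureReal_def, ENNReal.toReal_rpow]
    have hone' : eLpNorm (fun _ => (1 : ℝ)) q ν ≠ ∞ := (memLp_const 1).eLpNorm_ne_top
    rw [norm_sub_rev]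
    refine (norm_le_norm_toLp_cutoff (fun b => (hQ b).1) hd (h.isCubePartition n).cover_cell
      _).trans ?_
    refine (norm_toLp_le_of_injective _
      (fun b => (eLpNorm (fun _ => (1 : ℝ)) q (ν.restrict (Q b))).toReal)
      (show 0 ≤ C * ε by positivity) Function.injective_id fun b => ?_).trans
      (mul_le_mul_of_nonneg_left ((norm_toLp_eLpNorm_restrict_le hone' (fun b => (hQ b).1) hd).trans
        ?_) (by positivity))
    · rw [id, hone, abs_norm, map_sub, cutoff_proj, abs_of_nonneg (by positivity)]
      refine (hgQ _ (hQ b)).trans ?_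
      have h1 : (eLpNorm g p ((cubeMeasure m).restrict (Q b))).toReal ≤ 1 :=
        ENNReal.toReal_le_of_le_ofReal zero_le_one
          ((eLpNorm_mono_measure _ Measure.restrict_le_self).trans (by simpa using hg))
      have h2 : volume.real (Q b) ^ (ρ / m) ≤ ε := by
        refine (Real.rpow_le_rpow measureReal_nonneg
          (hn _ ((h.isCubePartition n).cell_mem b)).le (by positivity)).trans (le_of_eq ?_)
        rw [← Real.rpow_mul hε.le, div_mul_div_cancel₀ hρ.ne', div_self hm'.ne', Real.rpow_one]
      calc _ ≤ C * (ν.real (Q b) ^ (q.toReal)⁻¹ * ε) * 1 := by gcongr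
        _ = _ := by ring
    · refine ENNReal.toReal_le_of_le_ofReal hA ?_
      refine (eLpNorm_le_of_ae_bound (C := 1) (by simp)).trans (le_of_eq ?_)
      rw [ENNReal.ofReal_one, mul_one]
      change _ = ENNReal.ofReal (ν.real Set.univ ^ (q.toReal)⁻¹)
      rw [measureReal_def, ENNReal.toReal_rpow,
        ENNReal.ofReal_toReal (ENNReal.rpow_ne_top_of_nonneg (by positivity) (measure_ne_top _ _))]
  rw [tendsto_iff_norm_sub_tendsto_zero, Metric.tendsto_atTop']
  intro ε hε
  have hpos : 0 < ε / (C * A + 1) := by positivity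
  obtain ⟨n₀, hn₀⟩ := eventually_atTop.1 (key _ hpos)
  refine ⟨n₀, fun n hn => ?_⟩
  rw [Real.dist_eq, sub_zero, abs_norm]
  refine (hn₀ n hn.le).trans_lt ?_
  have h1 : C * (ε / (C * A + 1)) * A = ε * ((C * A) / (C * A + 1)) := by ring
  rw [h1]
  refine mul_lt_of_lt_one_right hε ?_
  rw [div_lt_one (by positivity)]
  linarith

/-- At positive levels a coefficient is at most a constant times `T (k + 1)` times the gradient norm
on the parent cube. Each parent accounts for boundedly many coefficients, and the parents' gradient
norms have `ℓ_p`-norm at most one. -/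
theorem exists_coeff_bound (h : IsPartitionSequence (s + 1) p q ν P T) (hm : 0 < m)
    (hρ : 0 < rhoHat m (s + 1) p) (hν : ν (openCube m)ᶜ = 0) : ∃ C : ℝ, 0 ≤ C ∧
    ∀ u ∈ sobolevBall (s + 1) p q ν, ∀ k, ‖(WithLp.toLp p (WithLp.ofLp
      (familyCoeff s q ν (h.isCubePartition k).isSubcube_cell (h.diff k u))) :
        PiLp p (fun _ : Fin (polyDim m (s + 1) * (P k).ncard) => ℝ))‖ ≤ C * T k := by
  classical
  obtain ⟨C, hC, herr⟩ := exists_localProj_error (ν := ν) (s := s) hm hρ q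
  obtain ⟨K, hK, hball⟩ := exists_sobolevBall_norm_le (s := s) hρ q hν
  obtain ⟨F, hF, hfib⟩ := h.exists_card_parent_le
  obtain ⟨D, hD, hratio⟩ := h.scale_ratio
  set κ : ℕ := polyDim m (s + 1) with hκ
  have hT0 := h.scale_pos 0
  -- Level zero: all coefficients are bounded by `κ K`, and they are counted as one fibre over a
  -- single point.
  set C₀ : ℝ := κ * K * max 1 ((κ * (P 0).ncard : ℕ) : ℝ) *
    ‖(WithLp.toLp p fun _ => 1 : PiLp p (fun _ : Unit => ℝ))‖
  set C₁ : ℝ := C * (1 + D) * max 1 (κ * F)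
  have hC₀ : 0 ≤ C₀ := by positivity
  have hC₁ : 0 ≤ C₁ := by positivity
  refine ⟨max (C₀ / T 0) C₁, le_max_of_le_right hC₁, fun u hu k => ?_⟩
  cases k with
  | zero =>
    refine le_trans ?_ (mul_le_mul_of_nonneg_right (le_max_left _ _) hT0.le)
    rw [div_mul_cancel₀ _ hT0.ne']
    refine norm_toLp_le_of_fiber _ (fun _ : Unit => (1 : ℝ)) (fun _ => ()) (B := κ * K)
      (by positivity) (le_max_left _ _) (fun j => le_max_of_le_right ?_) fun i => ?_
    · exact_mod_cast (Finset.card_filter_le _ _).trans (by simp [hκ])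
    · rw [familyCoeff_apply]
      refine (abs_localCoord_le _ _ _).trans ?_
      rw [diff, cutoff_proj, abs_one, mul_one]
      refine (norm_localProj_le _ u).trans ?_
      gcongr
      exact (norm_cutoff_le _ u).trans (hball u hu)
  | succ k =>
    obtain ⟨g, hg, hgQ⟩ := herr u hu
    have hgt : eLpNorm g p (cubeMeasure m) ≠ ∞ := (hg.trans_lt ENNReal.one_lt_top).ne
    have hTk := h.scale_pos k
    have hTk' := h.scale_pos (k + 1)
    refine le_trans ?_ (mul_le_mul_of_nonneg_right (le_max_right _ _) hTk'.le)
    set G : Set (Fin m → ℝ) → ℝ := fun Q => (eLpNorm g p ((cubeMeasure m).restrict Q)).toReal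
    have hG0 : ∀ Q, 0 ≤ G Q := fun Q => ENNReal.toReal_nonneg
    have hGmono : ∀ {Q Q'}, Q ⊆ Q' → G Q ≤ G Q' := fun hQ =>
      ENNReal.toReal_mono ((eLpNorm_mono_measure _ Measure.restrict_le_self).trans_lt hgt.lt_top).ne
        (eLpNorm_mono_measure _ (Measure.restrict_mono_set _ hQ))
    have herr' : ∀ k b, ‖cutoff q ν ((h.isCubePartition k).isSubcube_cell b).1 u -
        localProj s q ν ((h.isCubePartition k).isSubcube_cell b) u‖ ≤
          C * T k * G ((h.isCubePartition k).cell b) := fun k b => by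
      refine (hgQ _ _).trans ?_
      gcongr
      exact h.weight_le k _ ((h.isCubePartition k).cell_mem b)
    have hsum : ‖(WithLp.toLp p fun b => G ((h.isCubePartition k).cell b) :
        PiLp p (fun _ : Fin (P k).ncard => ℝ))‖ ≤ 1 :=
      (norm_toLp_eLpNorm_restrict_le hgt (fun b => ((h.isCubePartition k).isSubcube_cell b).1)
        (h.isCubePartition k).disjoint_cell).trans
        (ENNReal.toReal_le_of_le_ofReal zero_le_one (by simpa using hg))
    -- The factor `1 + D` collects the child's error and the parent's error, the latter rescaled
    -- from `T k` to `T (k + 1)`.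
    refine (norm_toLp_le_of_fiber _ (fun b => G ((h.isCubePartition k).cell b))
      (fun i => h.parent k (finProdFinEquiv.symm i).2) (B := C * (1 + D) * T (k + 1))
      (K := max 1 (κ * F)) (by positivity) (le_max_left _ _)
      (fun j => le_max_of_le_right ?_) fun i => ?_).trans ?_
    · have hcard : (Finset.univ.filter fun i : Fin (κ * (P (k + 1)).ncard) =>
          h.parent k (finProdFinEquiv.symm i).2 = j).card =
          κ * (Finset.univ.filter fun b => h.parent k b = j).card := by
        have h1 : (Finset.univ.filter fun i : Fin (κ * (P (k + 1)).ncard) =>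
            h.parent k (finProdFinEquiv.symm i).2 = j).card =
            ((Finset.univ : Finset (Fin κ)) ×ˢ
              Finset.univ.filter fun b => h.parent k b = j).card :=
          Finset.card_equiv finProdFinEquiv.symm fun i => by simp
        rw [h1, Finset.card_product, Finset.card_univ, Fintype.card_fin]
      rw [hcard, Nat.cast_mul]
      exact mul_le_mul_of_nonneg_left (hfib k j) (Nat.cast_nonneg _)
    · rw [familyCoeff_apply]
      refine (abs_localCoord_le _ _ _).trans ((h.norm_cutoff_diff_succ_le k u _).trans ?_)
      rw [abs_of_nonneg (hG0 _)]
      set b := (finProdFinEquiv.symm i).2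
      have h1 := herr' (k + 1) b
      have h2 := herr' k (h.parent k b)
      have h3 : C * T (k + 1) * G ((h.isCubePartition (k + 1)).cell b) ≤
          C * T (k + 1) * G ((h.isCubePartition k).cell (h.parent k b)) :=
        mul_le_mul_of_nonneg_left (hGmono (h.subset_parent k b)) (by positivity)
      have h4 : C * T k * G ((h.isCubePartition k).cell (h.parent k b)) ≤
          C * (D * T (k + 1)) * G ((h.isCubePartition k).cell (h.parent k b)) :=
        mul_le_mul_of_nonneg_right (mul_le_mul_of_nonneg_left (hratio k) hC) (hG0 _)
      calc _ ≤ C * T (k + 1) * G ((h.isCubePartition k).cell (h.parent k b)) +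
            C * (D * T (k + 1)) * G ((h.isCubePartition k).cell (h.parent k b)) :=
            add_le_add (h1.trans h3) (h2.trans h4)
        _ = _ := by ring
    · calc _ ≤ C * (1 + D) * T (k + 1) * max 1 (κ * F) * 1 :=
            mul_le_mul_of_nonneg_left hsum (by positivity)
        _ = _ := by ring

theorem exists_blockDecomposition (h : IsPartitionSequence (s + 1) p q ν P T) (hm : 0 < m)
    (hρ : 0 < rhoHat m (s + 1) p) (hν : ν (openCube m)ᶜ = 0) : ∃ c₁ c₂ : ℝ≥0,
    Nonempty (BlockDecomposition (sobolevBall (s + 1) p q ν) p q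
      (fun k => polyDim m (s + 1) * (P k).ncard) (fun k => (T k).toNNReal) c₁ c₂) := by
  obtain ⟨C, hC, hcoeff⟩ := h.exists_coeff_bound hm hρ hν
  refine ⟨polyDim m (s + 1), C.toNNReal, ⟨
    { coeff := fun k =>
        (familyCoeff s q ν (h.isCubePartition k).isSubcube_cell).comp (h.diff k)
      synth := fun k => familySynth s q ν (h.isCubePartition k).isSubcube_cell
      norm_synth_le := fun k => by
        simpa using norm_familySynth_le (h.isCubePartition k).isSubcube_cell
          (h.isCubePartition k).disjoint_cell (h.isCubePartition k).cover_cell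
      coeff_le := fun u hu k => ?_
      tendsto_sum := fun u hu => ?_ }⟩⟩
  · rw [Real.coe_toNNReal _ hC, Real.coe_toNNReal _ (h.scale_pos k).le]
    exact hcoeff u hu k
  -- The first `n + 1` differences add up to the projection of level `n`, whence the shift.
  · rw [← tendsto_add_atTop_iff_nat 1]
    refine (h.tendsto_proj hm hρ hu).congr fun n => ?_
    rw [← h.sum_diff u n]
    exact Finset.sum_congr rfl fun k _ => (familySynth_familyCoeff _
      (h.isCubePartition k).disjoint_cell (h.isCubePartition k).cover_cell
      (h.cutoff_diff_mem k u)).symm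

end IsPartitionSequence

/-! ### Restoring the discarded initial levels. -/

section Shift

variable {V : Type*} [NormedAddCommGroup V] [NormedSpace ℝ V] {A : Set V} {p q : ℝ≥0∞}
  [Fact (1 ≤ p)] [Fact (1 ≤ q)] {N : ℕ → ℕ} {T : ℕ → ℝ≥0} {c₁ c₂ : ℝ≥0}

/-- Prepend an empty block. -/
noncomputable def BlockDecomposition.cons
    (D : BlockDecomposition A p q (fun k => N (k + 1)) (fun k => T (k + 1)) c₁ c₂) :
    BlockDecomposition A p q N T c₁ c₂ where
  coeff
    | 0 => 0
    | k + 1 => D.coeff k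
  synth
    | 0 => 0
    | k + 1 => D.synth k
  norm_synth_le
    | 0 => by simp
    | k + 1 => D.norm_synth_le k
  coeff_le x hx
    | 0 => by simp; positivity
    | k + 1 => D.coeff_le x hx k
  tendsto_sum x hx := by
    rw [← tendsto_add_atTop_iff_nat 1]
    refine (D.tendsto_sum x hx).congr fun n => ?_
    rw [Finset.sum_range_succ']
    simp

/-- Zero blocks fit any dimension and scale, so indices before `k₀` can be reinstated without
changing the constants. -/
theorem BlockDecomposition.nonempty_of_shift {k₀ : ℕ} (h : Nonempty (BlockDecomposition A p q
    (fun k => N (k + k₀)) (fun k => T (k + k₀)) c₁ c₂)) :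
    Nonempty (BlockDecomposition A p q N T c₁ c₂) := by
  induction k₀ with
  | zero => exact h
  | succ k₀ ih =>
    refine ih (h.map fun D => ?_)
    refine BlockDecomposition.cons (N := fun k => N (k + k₀)) (T := fun k => T (k + k₀)) ?_
    simpa only [add_assoc, add_comm 1 k₀] using D

end Shift

end SobolevWidths

namespace SobolevWidths

/-! ### Test functions as elements of the Sobolev ball. -/

section TestFunctions

variable {m : ℕ}

/-- `D` is local and its formal adjoint is `c • D`. -/
structure IsSelfAdjointUpTo (c : ℝ) (D : Module.End ℝ (smoothFunctions m)) : Prop where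
  tsupport_subset : ∀ g : smoothFunctions m,
    tsupport (D g : (Fin m → ℝ) → ℝ) ⊆ tsupport (g : (Fin m → ℝ) → ℝ)
  integral_eq : ∀ f g : smoothFunctions m, HasCompactSupport (g : (Fin m → ℝ) → ℝ) →
    ∫ x, (f : (Fin m → ℝ) → ℝ) x * (D g : (Fin m → ℝ) → ℝ) x =
      c * ∫ x, (D f : (Fin m → ℝ) → ℝ) x * (g : (Fin m → ℝ) → ℝ) x

namespace IsSelfAdjointUpTo

theorem one : IsSelfAdjointUpTo 1 (1 : Module.End ℝ (smoothFunctions m)) :=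
  ⟨fun _ => subset_rfl, fun f g _ => by simp⟩

/-- Moving the operators across one at a time reverses their order; commutation restores it. -/
theorem mul {c c' : ℝ} {D D' : Module.End ℝ (smoothFunctions m)} (h : IsSelfAdjointUpTo c D)
    (h' : IsSelfAdjointUpTo c' D') (hc : Commute D D') : IsSelfAdjointUpTo (c * c') (D * D') where
  tsupport_subset g := (h.tsupport_subset (D' g)).trans (h'.tsupport_subset g)
  integral_eq f g hg := by
    have hg' : HasCompactSupport (D' g : (Fin m → ℝ) → ℝ) :=
      hg.of_isClosed_subset (isClosed_tsupport _) (h'.tsupport_subset g)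
    rw [Module.End.mul_apply, h.integral_eq f _ hg', h'.integral_eq _ g hg, ← mul_assoc, hc.eq,
      Module.End.mul_apply]

theorem pow {c : ℝ} {D : Module.End ℝ (smoothFunctions m)} (h : IsSelfAdjointUpTo c D) (n : ℕ) :
    IsSelfAdjointUpTo (c ^ n) (D ^ n) := by
  induction n with
  | zero => simpa using one
  | succ n ih =>
    rw [pow_succ, pow_succ]
    exact ih.mul h (Commute.pow_self D n)

theorem partialEnd (i : Fin m) : IsSelfAdjointUpTo (-1) (partialEnd i) where
  tsupport_subset g := tsupport_fderiv_apply_subset ℝ _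
  integral_eq f g hg := by
    have hf := f.2
    have hg' := g.2
    have hDf : Continuous (partialDeriv i f) := (contDiff_partialDeriv f.2 i).continuous
    have hDg : Continuous (partialDeriv i g) := (contDiff_partialDeriv g.2 i).continuous
    have hfc : Continuous (f : (Fin m → ℝ) → ℝ) := (differentiable_of_smooth f.2).continuous
    have hgc : Continuous (g : (Fin m → ℝ) → ℝ) := (differentiable_of_smooth g.2).continuous
    rw [neg_one_mul]
    exact integral_mul_fderiv_eq_neg_fderiv_mul_of_integrable
      ((hDf.mul hgc).integrable_of_hasCompactSupport hg.mul_left)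
      ((hfc.mul hDg).integrable_of_hasCompactSupport (hasCompactSupport_partialDeriv hg i).mul_left)
      ((hfc.mul hgc).integrable_of_hasCompactSupport hg.mul_left)
      (fun x _ => differentiable_of_smooth f.2 x) fun x _ => differentiable_of_smooth g.2 x

theorem multiEnd (k : Fin m → ℕ) : IsSelfAdjointUpTo ((-1) ^ ∑ i, k i) (multiEnd k) := by
  rw [SobolevWidths.multiEnd, Fin.sum_univ_def]
  induction List.finRange m with
  | nil => simpa using one
  | cons i l ih =>
    rw [List.map_cons, List.sum_cons, pow_add, List.map_cons, List.prod_cons]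
    refine ((partialEnd i).pow _).mul ih (Commute.list_prod_right _ _ fun D hD => ?_)
    obtain ⟨j, -, rfl⟩ := List.mem_map.1 hD
    exact (partialEnd_commute i j).pow_pow _ _

end IsSelfAdjointUpTo

theorem integral_cubeMeasure_of_tsupport_subset {F : (Fin m → ℝ) → ℝ} {g : (Fin m → ℝ) → ℝ}
    (hg : tsupport g ⊆ openCube m) (hF : ∀ x, g x = 0 → F x = 0) :
    ∫ x, F x ∂(cubeMeasure m) = ∫ x, F x :=
  setIntegral_eq_integral_of_forall_compl_eq_zero fun x hx =>
    hF x (image_eq_zero_of_notMem_tsupport fun h => hx (hg h))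

theorem IsTestFunction.memLp {φ : (Fin m → ℝ) → ℝ} (hφ : IsTestFunction φ) (p : ℝ≥0∞)
    (μ : Measure (Fin m → ℝ)) [IsFiniteMeasureOnCompacts μ] : MemLp φ p μ :=
  hφ.1.continuous.memLp_of_hasCompactSupport hφ.2.1

theorem IsTestFunction.multiDeriv {φ : (Fin m → ℝ) → ℝ} (hφ : IsTestFunction φ) (k : Fin m → ℕ) :
    IsTestFunction (multiDeriv k φ) := by
  have h := (IsSelfAdjointUpTo.multiEnd k).tsupport_subset ⟨φ, hφ.1⟩
  rw [coe_multiEnd] at h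
  exact ⟨contDiff_multiDeriv hφ.1 k, hφ.2.1.of_isClosed_subset (isClosed_tsupport _) h,
    h.trans hφ.2.2⟩

theorem IsTestFunction.isWeakDerivLp {φ : (Fin m → ℝ) → ℝ} (hφ : IsTestFunction φ) (p : ℝ≥0∞)
    (k : Fin m → ℕ) : IsWeakDerivLp p k φ (SobolevWidths.multiDeriv k φ) := by
  refine ⟨((hφ.multiDeriv k).memLp p volume).restrict _, fun ψ hψ => ?_⟩
  rw [integral_cubeMeasure_of_tsupport_subset (hψ.multiDeriv k).2.2 fun x hx => by
      rw [hx, mul_zero],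
    integral_cubeMeasure_of_tsupport_subset hψ.2.2 fun x hx => by rw [hx, mul_zero]]
  have h := (IsSelfAdjointUpTo.multiEnd k).integral_eq ⟨φ, hφ.1⟩ ⟨ψ, hψ.1⟩ hψ.2.1
  rwa [coe_multiEnd, coe_multiEnd] at h

theorem IsTestFunction.memSobolev {φ : (Fin m → ℝ) → ℝ} (hφ : IsTestFunction φ) (s : ℕ)
    (p : ℝ≥0∞) : MemSobolev s p φ :=
  ⟨(hφ.memLp p volume).restrict _, fun k _ => ⟨_, hφ.isWeakDerivLp p k⟩⟩

/-- `weakDeriv` is an arbitrary choice, so computing it for test functions needs uniqueness, which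
is the fundamental lemma of the calculus of variations. -/
theorem IsWeakDerivLp.ae_eq {p : ℝ≥0∞} [hp : Fact (1 ≤ p)] {k : Fin m → ℕ}
    {f g g' : (Fin m → ℝ) → ℝ} (h : IsWeakDerivLp p k f g) (h' : IsWeakDerivLp p k f g') :
    g =ᵐ[cubeMeasure m] g' := by
  have hi := h.1.integrable hp.out
  have hi' := h'.1.integrable hp.out
  have key : ∀ᵐ x ∂(volume : Measure (Fin m → ℝ)), x ∈ openCube m → (g - g') x = 0 := by
    refine isOpen_openCube.ae_eq_zero_of_integral_contDiff_smul_eq_zero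
      (IntegrableOn.locallyIntegrableOn (hi.sub hi')) fun ψ hψ hψc hψs => ?_
    have hψt : IsTestFunction ψ := ⟨hψ, hψc, hψs⟩
    rw [← integral_cubeMeasure_of_tsupport_subset hψs fun x hx => by rw [hx, zero_smul]]
    have e := (h.2 ψ hψt).symm.trans (h'.2 ψ hψt)
    have e' := mul_left_cancel₀ (by simp) e
    obtain ⟨K, hK⟩ := hψc.exists_bound_of_continuous hψ.continuous
    have hm : ∀ {u : (Fin m → ℝ) → ℝ}, Integrable u (cubeMeasure m) →
        Integrable (fun x => u x * ψ x) (cubeMeasure m) := fun hu =>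
      hu.mul_bdd hψ.continuous.aestronglyMeasurable (Eventually.of_forall hK)
    have h3 : ∀ x, ψ x • (g - g') x = g x * ψ x - g' x * ψ x := fun x => by
      rw [Pi.sub_apply, smul_eq_mul]; ring
    simp only [h3]
    rw [integral_sub (hm hi) (hm hi'), e', sub_self]
  rw [cubeMeasure]
  filter_upwards [(ae_restrict_iff' measurableSet_openCube).2 key] with x hx
  exact sub_eq_zero.1 hx

theorem IsTestFunction.gradNorm_ae_eq {φ : (Fin m → ℝ) → ℝ} (hφ : IsTestFunction φ) (s : ℕ)
    (p : ℝ≥0∞) [Fact (1 ≤ p)] : gradNorm s p φ =ᵐ[cubeMeasure m]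
      fun x => √(∑ k ∈ Finset.piAntidiag Finset.univ s, |SobolevWidths.multiDeriv k φ x| ^ 2) := by
  have h : ∀ᵐ x ∂(cubeMeasure m), ∀ k : (Finset.piAntidiag (Finset.univ : Finset (Fin m)) s),
      weakDeriv p k φ x = SobolevWidths.multiDeriv k φ x := by
    rw [ae_all_iff]
    intro k
    exact ((hφ.memSobolev s p).isWeakDerivLp
      (Finset.mem_piAntidiag.1 k.2).1.le).ae_eq (hφ.isWeakDerivLp p k)
  filter_upwards [h] with x hx
  rw [gradNorm]
  congr 1
  exact Finset.sum_congr rfl fun k hk => by rw [hx ⟨k, hk⟩]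

variable {ι : Type*} [Fintype ι]

theorem IsTestFunction.sum_const_mul {φ : ι → (Fin m → ℝ) → ℝ} (hφ : ∀ i, IsTestFunction (φ i))
    (c : ι → ℝ) : IsTestFunction fun x => ∑ i, c i * φ i x := by
  have hK : IsCompact (⋃ i, tsupport (φ i)) := isCompact_iUnion fun i => (hφ i).2.1
  have h0 : ∀ x ∉ ⋃ i, tsupport (φ i), ∑ i, c i * φ i x = 0 := fun x hx => by
    refine Finset.sum_eq_zero fun i _ => ?_
    rw [image_eq_zero_of_notMem_tsupport fun h => hx (Set.mem_iUnion.2 ⟨i, h⟩), mul_zero]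
  refine ⟨ContDiff.sum fun i _ => contDiff_const.mul (hφ i).1, HasCompactSupport.intro hK h0, ?_⟩
  refine (closure_minimal (fun x hx => ?_) hK.isClosed).trans
    (Set.iUnion_subset fun i => (hφ i).2.2)
  by_contra h
  exact hx (h0 x h)

theorem multiDeriv_sum_const_mul {φ : ι → (Fin m → ℝ) → ℝ}
    (hφ : ∀ i, ContDiff ℝ ((⊤ : ℕ∞) : WithTop ℕ∞) (φ i)) (c : ι → ℝ) (k : Fin m → ℕ) :
    multiDeriv k (fun x => ∑ i, c i * φ i x) = fun x => ∑ i, c i * multiDeriv k (φ i) x := by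
  let F : ι → smoothFunctions m := fun i => ⟨φ i, hφ i⟩
  have h : ((∑ i, c i • F i : smoothFunctions m) : (Fin m → ℝ) → ℝ) =
      fun x => ∑ i, c i * φ i x := by
    ext x
    simp [F, Finset.sum_apply]
  rw [← h, ← coe_multiEnd, map_sum]
  ext x
  simp [F, Finset.sum_apply, coe_multiEnd]

/-- Small multiples of test functions span a parallelepiped inside the unit ball of `W^{s,p}`. -/
theorem exists_scale_sobolevNorm_le {φ : ι → (Fin m → ℝ) → ℝ} (hφ : ∀ i, IsTestFunction (φ i))
    (s : ℕ) (p : ℝ≥0∞) [Fact (1 ≤ p)] : ∃ δ > 0, ∀ c : ι → ℝ, (∀ i, |c i| ≤ δ) →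
      sobolevNorm s p (fun x => ∑ i, c i * φ i x) ≤ 1 := by
  have hb : ∀ {ψ : (Fin m → ℝ) → ℝ}, IsTestFunction ψ → ∃ K, ∀ x, ‖ψ x‖ ≤ K := fun h =>
    h.2.1.exists_bound_of_continuous h.1.continuous
  choose K hK using fun i => hb (hφ i)
  choose L hL using fun (k : Fin m → ℕ) i => hb ((hφ i).multiDeriv k)
  have hK0 : ∀ i, 0 ≤ K i := fun i => (norm_nonneg _).trans (hK i 0)
  have hL0 : ∀ k i, 0 ≤ L k i := fun k i => (norm_nonneg _).trans (hL k i 0)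
  set A := ∑ i, K i
  set B := √(∑ k ∈ Finset.piAntidiag (Finset.univ : Finset (Fin m)) s, (∑ i, L k i) ^ 2)
  have hA : 0 ≤ A := Finset.sum_nonneg fun i _ => hK0 i
  have hB : 0 ≤ B := Real.sqrt_nonneg _
  -- `A` bounds the functions and `B` the gradients for coefficients of size at most one; on a
  -- probability space sup bounds are `L^p` bounds.
  refine ⟨(A + B + 1)⁻¹, by positivity, fun c hc => ?_⟩
  set δ := (A + B + 1)⁻¹
  have hδ : 0 < δ := by positivity
  have hsum : ∀ (ψ : ι → (Fin m → ℝ) → ℝ) (M : ι → ℝ), (∀ i x, ‖ψ i x‖ ≤ M i) → ∀ x,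
      |∑ i, c i * ψ i x| ≤ δ * ∑ i, M i := fun ψ M hM x => by
    rw [Finset.mul_sum]
    refine (Finset.abs_sum_le_sum_abs _ _).trans (Finset.sum_le_sum fun i _ => ?_)
    rw [abs_mul]
    exact mul_le_mul (hc i) (hM i x) (abs_nonneg _) hδ.le
  have h1 : eLpNorm (fun x => ∑ i, c i * φ i x) p (cubeMeasure m) ≤ ENNReal.ofReal (δ * A) := by
    refine (eLpNorm_le_of_ae_bound (C := δ * A) (Eventually.of_forall fun x => ?_)).trans
      (by simp)
    exact hsum φ K hK x
  have h2 : eLpNorm (gradNorm s p fun x => ∑ i, c i * φ i x) p (cubeMeasure m) ≤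
      ENNReal.ofReal (δ * B) := by
    rw [eLpNorm_congr_ae ((IsTestFunction.sum_const_mul hφ c).gradNorm_ae_eq s p)]
    refine (eLpNorm_le_of_ae_bound (C := δ * B) (Eventually.of_forall fun x => ?_)).trans
      (by simp)
    rw [Real.norm_of_nonneg (Real.sqrt_nonneg _)]
    refine Real.sqrt_le_iff.2 ⟨by positivity, ?_⟩
    rw [mul_pow, Real.sq_sqrt (Finset.sum_nonneg fun _ _ => sq_nonneg _), Finset.mul_sum]
    refine Finset.sum_le_sum fun k _ => ?_
    rw [multiDeriv_sum_const_mul (fun i => (hφ i).1), ← mul_pow]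
    exact pow_le_pow_left₀ (abs_nonneg _) (hsum _ _ (hL k) x) 2
  refine (add_le_add h1 h2).trans ?_
  rw [← ENNReal.ofReal_add (by positivity) (by positivity), ← mul_add]
  refine ENNReal.ofReal_le_one.2 ?_
  rw [inv_mul_le_one₀ (by positivity)]
  linarith

end TestFunctions

/-! ### Positivity of the widths of the Sobolev ball. -/

section Positivity

variable {m : ℕ} {p q : ℝ≥0∞} [Fact (1 ≤ p)] [Fact (1 ≤ q)] {ν : Measure (Fin m → ℝ)}
  [IsFiniteMeasure ν]

/-- Finitely many distinct points of an open set are centres of disjoint small balls in it. -/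
theorem exists_disjoint_closedBalls {E ι : Type*} [MetricSpace E] [Finite ι] {U : Set E}
    (hU : IsOpen U) {x : ι → E} (hx : Function.Injective x) (hxU : ∀ i, x i ∈ U) :
    ∃ r > 0, (∀ i, Metric.closedBall (x i) r ⊆ U) ∧
      Pairwise (Function.onFun Disjoint fun i => Metric.closedBall (x i) r) := by
  have h1 : ∀ᶠ r in 𝓝[>] (0 : ℝ), ∀ i, Metric.closedBall (x i) r ⊆ U := by
    rw [eventually_all]
    intro i
    obtain ⟨ε, hε, hball⟩ := Metric.nhds_basis_closedBall.mem_iff.1 (hU.mem_nhds (hxU i))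
    filter_upwards [Ioo_mem_nhdsGT hε] with r hr
    exact (Metric.closedBall_subset_closedBall hr.2.le).trans hball
  have h2 : ∀ᶠ r in 𝓝[>] (0 : ℝ), ∀ i k, i ≠ k →
      Disjoint (Metric.closedBall (x i) r) (Metric.closedBall (x k) r) := by
    rw [eventually_all]
    intro i
    rw [eventually_all]
    intro k
    by_cases hik : i = k
    · exact Eventually.of_forall fun r h => absurd hik h
    · have hd : 0 < dist (x i) (x k) / 2 := half_pos (dist_pos.2 (hx.ne hik))
      filter_upwards [Ioo_mem_nhdsGT hd] with r hr _
      exact Metric.closedBall_disjoint_closedBall (by linarith [hr.2])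
  obtain ⟨r, ⟨hr1, hr2⟩, hr⟩ := ((h1.and h2).and eventually_mem_nhdsWithin).exists
  exact ⟨r, hr, hr1, fun i k hik => hr2 i k hik⟩

/-- Around each chosen support point there is a ball of positive measure on which its own bump
equals one and all the others vanish. A combination that is null in `L^q_ν` therefore has zero
coefficients. -/
theorem nWidth_sobolevBall_pos (star : WidthKind) (s n : ℕ) (hsupp : ν.support ⊆ openCube m)
    (hinf : ν.support.Infinite) : 0 < nWidth star n (sobolevBall s p q ν) := by
  let e : ℕ ↪ ν.support := hinf.natEmbedding
  let x : Fin (n + 1) → (Fin m → ℝ) := fun i => e i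
  have hx : Function.Injective x :=
    Subtype.val_injective.comp (e.injective.comp Fin.val_injective)
  have hxs : ∀ i, x i ∈ ν.support := fun i => (e i).2
  obtain ⟨r, hr, hrU, hrd⟩ := exists_disjoint_closedBalls isOpen_openCube hx fun i => hsupp (hxs i)
  let φ : ∀ i, ContDiffBump (x i) := fun i => ⟨r / 2, r, half_pos hr, half_lt_self hr⟩
  have hφ : ∀ i, IsTestFunction (φ i) := fun i =>
    ⟨(φ i).contDiff, (φ i).hasCompactSupport, (φ i).tsupport_eq.trans_subset (hrU i)⟩
  obtain ⟨δ, hδ, hnorm⟩ := exists_scale_sobolevNorm_le hφ s p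
  have hsum : ∀ c : Fin (n + 1) → ℝ, ((∑ i, c i • (δ • ((hφ i).memLp q ν).toLp (φ i)) : Lp ℝ q ν) :
      (Fin m → ℝ) → ℝ) =ᵐ[ν] fun y => ∑ i, (c i * δ) * φ i y := fun c => by
    have h1 : ∀ᵐ y ∂ν, ∀ i, (c i • (δ • ((hφ i).memLp q ν).toLp (φ i)) : Lp ℝ q ν) y =
        (c i * δ) * φ i y := by
      rw [ae_all_iff]
      intro i
      rw [smul_smul]
      filter_upwards [Lp.coeFn_smul (c i * δ) (((hφ i).memLp q ν).toLp (φ i)),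
        ((hφ i).memLp q ν).coeFn_toLp] with y h2 h3
      rw [h2, Pi.smul_apply, h3, smul_eq_mul]
    filter_upwards [h1, Lp.coeFn_finsetSum Finset.univ fun i =>
      (c i • (δ • ((hφ i).memLp q ν).toLp (φ i)) : Lp ℝ q ν)] with y h2 h3
    rw [h3, Finset.sum_apply]
    exact Finset.sum_congr rfl fun i _ => h2 i
  refine nWidth_pos (v := fun i => δ • ((hφ i).memLp q ν).toLp (φ i)) star ?_ fun c hc => ?_
  · rw [Fintype.linearIndependent_iff]
    intro c hc i
    have h1 := hsum c
    rw [hc] at h1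
    have hpos : 0 < ν (Metric.ball (x i) (r / 2)) :=
      (Measure.mem_support_iff_forall _).1 (hxs i) _ (Metric.ball_mem_nhds _ (half_pos hr))
    have h2 : ∀ᵐ y ∂ν, ∑ i, (c i * δ) * φ i y = 0 := by
      filter_upwards [h1, Lp.coeFn_zero ℝ q ν] with y h3 h4
      rw [← h3, h4, Pi.zero_apply]
    obtain ⟨y, hy, hyb⟩ : ∃ y, ∑ i, (c i * δ) * φ i y = 0 ∧ y ∈ Metric.ball (x i) (r / 2) := by
      by_contra! hcon
      refine hpos.ne' (measure_mono_null (fun y hy => ?_) (ae_iff.1 h2))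
      exact fun h => hcon y h hy
    have hyr : y ∈ Metric.closedBall (x i) r :=
      (Metric.ball_subset_closedBall.trans
        (Metric.closedBall_subset_closedBall (half_lt_self hr).le)) hyb
    rw [Finset.sum_eq_single i, (φ i).one_of_mem_closedBall (Metric.ball_subset_closedBall hyb),
      mul_one] at hy
    · exact (mul_eq_zero.1 hy).resolve_right hδ.ne'
    · intro k _ hk
      have hyk : y ∉ tsupport (φ k) := by
        rw [(φ k).tsupport_eq]
        exact Set.disjoint_left.1 (hrd hk.symm) hyr
      rw [image_eq_zero_of_notMem_tsupport hyk, mul_zero]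
    · simp
  · have hT := IsTestFunction.sum_const_mul hφ fun i => c i * δ
    exact ⟨_, hT.1.continuous.continuousOn, hT.memSobolev s p, hnorm _ fun i => by
      rw [abs_mul, abs_of_pos hδ]
      exact mul_le_of_le_one_left hδ.le (hc i), hsum c⟩

end Positivity

end SobolevWidths

/-! ### Assembly of the theorem. -/

namespace SobolevWidths

theorem pos_of_infinite_subset_openCube {m : ℕ} {S : Set (Fin m → ℝ)} (h : S.Infinite) : 0 < m := by
  rcases Nat.eq_zero_or_pos m with rfl | hm
  · exact absurd (Set.toFinite S) h
  · exact hm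

theorem order_pos_of_rhoHat_pos {m s : ℕ} {p : ℝ≥0∞} (h : 0 < rhoHat m s p) : 0 < s := by
  have h1 : 0 ≤ (m : ℝ) * (p⁻¹).toReal := by positivity
  rw [rhoHat] at h
  exact_mod_cast (by linarith : (0 : ℝ) < s)

theorem exists_nWidth_sobolevBall_le {m s : ℕ} {p q : ℝ≥0∞} [Fact (1 ≤ p)] [Fact (1 ≤ q)]
    (hm : 0 < m) (hρ : 0 < rhoHat m s p) {ν : Measure (Fin m → ℝ)} [IsFiniteMeasure ν]
    (hν : ν (openCube m)ᶜ = 0) (hν0 : ν ≠ 0) {t : ℕ → ℝ} (ht_pos : ∀ k, 0 < t k)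
    (ht_anti : Antitone t) (ht_lim : Tendsto t atTop (𝓝 0)) {j : ℕ → ℕ} (hj_pos : ∀ k, 1 ≤ j k)
    (hj_mono : StrictMono j) (hgap : BoundedLevelGap s p q ν t j) :
    ∃ C : ℝ≥0, ∀ (star : WidthKind) (nn : ℕ → ℕ) (n : ℕ), HasSum nn n →
      nWidth star n (sobolevBall s p q ν) ≤
        C * ∑' k : ℕ, scaleFactor m s p q t k *
          nWidth star (nn k) (lpBall p q (polyDim m s * (partition s p q ν t j k).ncard)) := by
  -- The condition `ϱ̂ > 0` forces order at least one, so the truncated subtraction in `polyDim` is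
  -- harmless and the new `s` is the polynomial degree.
  obtain ⟨s, rfl⟩ := Nat.exists_eq_succ_of_ne_zero (order_pos_of_rhoHat_pos hρ).ne'
  obtain ⟨k₀, h⟩ := exists_isPartitionSequence hm hρ hν hν0 ht_pos ht_anti ht_lim hj_pos hj_mono hgap
  simp only [add_comm k₀] at h
  obtain ⟨c₁, c₂, hD⟩ := h.exists_blockDecomposition hm hρ hν
  obtain ⟨D⟩ := BlockDecomposition.nonempty_of_shift
    (N := fun k => polyDim m (s + 1) * (partition (s + 1) p q ν t j k).ncard)
    (T := fun k => (scaleFactor m (s + 1) p q t k).toReal.toNNReal) hD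
  refine ⟨c₁ * c₂, fun star nn n hn => (D.nWidth_le star hn).trans (le_of_eq ?_)⟩
  congr 1
  refine tsum_congr fun k => ?_
  have hk : scaleFactor m (s + 1) p q t k ≠ ∞ := by
    rw [scaleFactor]
    split_ifs <;> exact ENNReal.ofReal_ne_top
  have e : ((scaleFactor m (s + 1) p q t k).toReal.toNNReal : ℝ≥0∞) =
      scaleFactor m (s + 1) p q t k := ENNReal.ofReal_toReal hk
  rw [e]

end SobolevWidths
theorem proposition3p4 (m s : ℕ) (p q : ℝ≥0∞) [Fact (1 ≤ p)] [Fact (1 ≤ q)]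
    (hρ : 0 < rhoHat m s p)
    (ν : Measure (Fin m → ℝ)) [IsFiniteMeasure ν]
    (hsupp : ν.support ⊆ openCube m) (hinf : ν.support.Infinite)
    (t : ℕ → ℝ) (ht_pos : ∀ k, 0 < t k) (ht_anti : Antitone t) (ht_lim : Tendsto t atTop (𝓝 0))
    (j : ℕ → ℕ) (hj_pos : ∀ k, 1 ≤ j k) (hj_mono : StrictMono j)
    (hgap : BoundedLevelGap s p q ν t j) :
    ∃ C : ℝ≥0, ∀ (star : WidthKind) (nn : ℕ → ℕ) (n : ℕ), HasSum nn n →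
      0 < nWidth star n (sobolevBall s p q ν) ∧
      nWidth star n (sobolevBall s p q ν) ≤
        C * ∑' k : ℕ, scaleFactor m s p q t k *
          nWidth star (nn k) (lpBall p q (polyDim m s * (partition s p q ν t j k).ncard)) := by
  -- The complement of the support is null, so `ν` lives on the open cube.
  have hν : ν (openCube m)ᶜ = 0 :=
    measure_mono_null (Set.compl_subset_compl.2 hsupp) Measure.measure_compl_support
  have hν0 : ν ≠ 0 := by
    rintro rfl
    rw [Measure.support_zero] at hinf
    exact hinf Set.finite_empty
  obtain ⟨C, hC⟩ := exists_nWidth_sobolevBall_le (pos_of_infinite_subset_openCube hinf) hρ hν hν0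
    ht_pos ht_anti ht_lim hj_pos hj_mono hgap
  exact ⟨C, fun star nn n hn =>
    ⟨nWidth_sobolevBall_pos star s n hsupp hinf, hC star nn n hn⟩⟩
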